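/- Let $c_1,c_2,c_3,\varepsilon\in\mathbb C$ be arbitrary, $r(v)=\frac{c_1}{2}v^2+c_2v+c_3$, and consider the chain, for $u_n=u_n(x,y)$, $n\in\mathbb Z$, $$u_{n,xy}=\alpha_nu_{n,x}u_{n,y}+\beta_nu_{n,x}+\gamma_nu_{n,y}+\delta_n,\qquad \alpha_n=\frac1{u_n-u_{n-1}}-\frac1{u_{n+1}-u_n},\tag{1}$$ $$\beta_n=r'(u_n)-r(u_n)\alpha_n,\quad \gamma_n=\varepsilon\,(r'(u_n)-r(u_n)\alpha_n),\quad \delta_n=-\varepsilon\, r(u_n)\,(r'(u_n)-r(u_n)\alpha_n)$$ on the domain $u_n\ne u_{n-1}$, $u_{n+1}\ne u_n$. *Definitions.* A cut-off of the chain at the nodes $N_1<N_2-1$ is the system consisting of (1) for $N_1<n<N_2$ with $u_{N_1}=\varphi_1(x,y,u_{N_1+1},\dots)$, $u_{N_2}=\varphi_2(x,y,u_{N_2-1},\dots)$. Since the chain does not depend on $n$ explicitly, one may take $N_1=-1$, $N_2=N+1$, $N\ge0$; write $f_i$ for the right-hand side of the $i$-th equation, $0\le i\le N$. Functions are analytic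 functions of $x$, $y$ and finitely many dynamical variables $u_i,u_{i,x},u_{i,y},u_{i,xx},u_{i,yy},\dots$ on an open set; $D_x,D_y$ are the total derivatives by virtue of the system. A $y$-integral is a function $I(x,y,\mathbf u,\mathbf u_x,\mathbf u_{xx},\dots)$ with $D_yI=0$; $x$-integrals are defined symmetrically. The system is Darboux integrable if, near generic points of its domain, it has complete sets of $y$-integrals and of $x$-integrals. A complete set of $y$-integrals consists of $N+1$ of them, $I_0,\dots,I_N$ of orders $k_0,\dots,k_N\ge1$ with $\det\big(\partial I_j/\partial(\partial_x^{k_j}u_i)\big)\neq0$ (so that the $I_j$ and all their $D_x$-derivatives are functionally independent), and the $I_j$ have to be autonomous (not explicitly dependent on $x,y$) if the system is; similarly for $x$. The chain is integrable if there exist $\varphi_1,\varphi_2$ such that the cut-off system is Darboux integrable for all integers $N_1<N_2-1$. For a cut-off system put $$Y=\sum_{i=0}^N\Big(u_{i,y}\frac{\partial}{\partial u_i}+f_i\frac{\partial}{\partial u_{i,x}}+D_xf_i\frac{\partial}{\partial u_{i,xx}}+\cdots\Big),\qquad Y_i=\Big[\frac{\partial}{\partial u_{i,y}},Y\Big],\qquad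 Y_{i+k,\dots,i}=[Y_{i+k},Y_{i+k-1,\dots,i}].$$ Let $\mathcal L(y,N)$ be the Lie algebra generated by $\frac{\partial}{\partial y}+Y,\,Y_0,\dots,Y_N$ over the ring of functions, and $R=\frac{\partial}{\partial y}+Y-\sum_iu_{i,y}Y_i$. For an autonomous system let $\mathcal L^{\circ}(y,N)$ be the algebra generated by $Y,Y_0,\dots,Y_N$, and $R^{\circ}=Y-\sum_iu_{i,y}Y_i$. The algebras $\mathcal L(x,N)$, $\mathcal L^{\circ}(x,N)$ and their operators are defined by interchanging $x$ and $y$. **Theorem.** 1) The chain (1) is integrable. 2) If $\lambda$ is a root of $r$, then for every $N\ge0$ the cut-off $u_{-1}=u_{N+1}=\lambda$ gives a Darboux integrable system. If $r=c_3$ is constant, then for all constants $c_4,c_5$ and every $N\ge0$ so does the cut-off $u_{-1}=c_3(\varepsilon x+y)+c_4$, $u_{N+1}=c_3(\varepsilon x+y)+c_5$. 3) For each of these systems, on every open subset of the domain of the system, both characteristic algebras $\mathcal L(y,N)$ and $\mathcal L(x,N)$ are finite-dimensional over the ring of functions, with the basis $$R,\quad\{Y_i\}_{i=0}^N,\quad\{Y_{i+1,i}\}_{i=0}^{N-1},\quad\{Y_{i+2,i+1,i}\}_{i=0}^{N-2},\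 \dots,\ Y_{N,N-1,\dots,0}.$$ 4) For the cut-off $u_{-1}=u_{N+1}=\lambda$, $r(\lambda)=0$, the algebras $\mathcal L^{\circ}(y,N)$ and $\mathcal L^{\circ}(x,N)$ are spanned by $R^{\circ}$ together with the same commutators, and these form a basis of $\mathcal L^{\circ}(y,N)$ if $r'(\lambda)\ne0$ and of $\mathcal L^{\circ}(x,N)$ if $\varepsilon r'(\lambda)\neq0$. -/

import Mathlib

open TopologicalSpace

noncomputable section

namespace Chain

/-- The two independent variables `x` and `y`. -/
inductive Dir where
  | x : Dir
  | y : Dir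
  deriving DecidableEq

/-- Coordinates on the jet space of a hyperbolic system for `u_0, …, u_N`: the independent
variables, the unknowns `u_i`, and the unmixed derivatives; `du d i k` is the derivative of
`u_i` of order `k + 1` in the direction `d`. Mixed derivatives are eliminated by the system. -/
inductive Coord (N : ℕ) where
  | t : Dir → Coord N
  | u : Fin (N + 1) → Coord N
  | du : Dir → Fin (N + 1) → ℕ → Coord N
  deriving DecidableEq

/-- The jet space, with the product topology. -/
abbrev Jet (N : ℕ) : Type := Coord N → ℂ

variable {N : ℕ}

/-- `g` depends on finitely many coordinates and is an analytic function of them. -/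
def IsDyn (U : Opens (Jet N)) (g : U → ℂ) : Prop :=
  ∃ (S : Finset (Coord N)) (G : (S → ℂ) → ℂ),
    AnalyticOnNhd ℂ G (S.restrict '' (U : Set (Jet N))) ∧
      ∀ p : U, g p = G (S.restrict p.1)

/-- A representation by finitely many variables may be enlarged to more variables. -/
theorem enlarge (U : Opens (Jet N)) {S T : Finset (Coord N)} (h : S ⊆ T) {G : (S → ℂ) → ℂ}
    (hG : AnalyticOnNhd ℂ G (S.restrict '' (U : Set (Jet N)))) :
    AnalyticOnNhd ℂ (fun v : T → ℂ => G (fun s => v ⟨s.1, h s.2⟩))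
      (T.restrict '' (U : Set (Jet N))) := by
  rintro _ ⟨p, hp, rfl⟩
  have h1 : AnalyticAt ℂ (fun (v : T → ℂ) (s : S) => v ⟨s.1, h s.2⟩) (T.restrict p) :=
    analyticAt_pi_iff.2 fun s =>
      (ContinuousLinearMap.proj (R := ℂ) (φ := fun _ : T => ℂ) ⟨s.1, h s.2⟩).analyticAt _
  have h2 : AnalyticAt ℂ G ((fun (v : T → ℂ) (s : S) => v ⟨s.1, h s.2⟩) (T.restrict p)) :=
    hG _ ⟨p, hp, rfl⟩
  exact h2.comp h1

theorem isDyn_const (U : Opens (Jet N)) (a : ℂ) : IsDyn U fun _ => a :=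
  ⟨∅, fun _ => a, fun _ _ => analyticAt_const, fun _ => rfl⟩

theorem isDyn_op (U : Opens (Jet N)) {g h : U → ℂ} (hg : IsDyn U g) (hh : IsDyn U h)
    (op : ℂ → ℂ → ℂ)
    (hop : ∀ (E : Type) [NormedAddCommGroup E] [NormedSpace ℂ E] (a b : E → ℂ) (e : E),
      AnalyticAt ℂ a e → AnalyticAt ℂ b e → AnalyticAt ℂ (fun z => op (a z) (b z)) e) :
    IsDyn U fun p => op (g p) (h p) := by
  obtain ⟨S, G, hG, eG⟩ := hg
  obtain ⟨T, H, hH, eH⟩ := hh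
  refine ⟨S ∪ T, _, fun v hv => hop _ _ _ v
    (enlarge U Finset.subset_union_left hG v hv) (enlarge U Finset.subset_union_right hH v hv), ?_⟩
  intro p
  change op (g p) (h p) = _
  rw [eG, eH]
  rfl

/-- The ring `F` of analytic functions of finitely many dynamical variables on the open set `U`
of the jet space. -/
def funAlg (U : Opens (Jet N)) : Subalgebra ℂ (U → ℂ) where
  carrier := {g | IsDyn U g}
  mul_mem' ha hb := isDyn_op U ha hb (· * ·) fun _ _ _ _ _ _ h1 h2 => h1.mul h2
  add_mem' ha hb := isDyn_op U ha hb (· + ·) fun _ _ _ _ _ _ h1 h2 => h1.add h2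
  algebraMap_mem' a := isDyn_const U a

/-- The ring `F` as a type. -/
def Fun (U : Opens (Jet N)) : Type := funAlg U

instance (U : Opens (Jet N)) : CommRing (Fun U) := inferInstanceAs (CommRing (funAlg U))

instance (U : Opens (Jet N)) : Algebra ℂ (Fun U) := inferInstanceAs (Algebra ℂ (funAlg U))

/-- The value of an element of `F` at a point. -/
def Fun.val {U : Opens (Jet N)} (g : Fun U) : U → ℂ := Subtype.val g

theorem Fun.isDyn {U : Opens (Jet N)} (g : Fun U) : IsDyn U g.val := Subtype.property g

theorem Fun.ext {U : Opens (Jet N)} {g h : Fun U} (e : ∀ p, g.val p = h.val p) : g = h :=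
  Subtype.ext (funext e)

/-- The derivations of the ring `F`, i.e. the vector fields. -/
abbrev Der (U : Opens (Jet N)) : Type := Derivation ℂ (Fun U) (Fun U)

/-- A coordinate as an element of the ring. -/
def coord (U : Opens (Jet N)) (c : Coord N) : Fun U :=
  ⟨fun p => p.1 c, {c}, fun v => v ⟨c, Finset.mem_singleton_self c⟩,
    fun _ _ => (ContinuousLinearMap.proj (R := ℂ) (φ := fun _ : ({c} : Finset (Coord N)) => ℂ)
      ⟨c, Finset.mem_singleton_self c⟩).analyticAt _, fun _ => rfl⟩

open Classical in
/-- The partial derivative of `g` along the coordinate `c` at the point `p`. -/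
def pdFun (U : Opens (Jet N)) (c : Coord N) (g : U → ℂ) (p : U) : ℂ :=
  deriv (fun z : ℂ => if h : Function.update p.1 c z ∈ U then g ⟨_, h⟩ else 0) (p.1 c)

/-- The partial derivative exists and is computed by any representation of `g`. -/
theorem pdFun_eq_fderiv (U : Opens (Jet N)) (c : Coord N) {g : U → ℂ} {S : Finset (Coord N)}
    {G : (S → ℂ) → ℂ} (hG : AnalyticOnNhd ℂ G (S.restrict '' (U : Set (Jet N))))
    (e : ∀ p : U, g p = G (S.restrict p.1)) (p : U) :
    pdFun U c g p = fderiv ℂ G (S.restrict p.1) (fun s => if s.1 = c then 1 else 0) := by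
  classical
  set L : S → ℂ := fun s => if s.1 = c then 1 else 0 with hL
  have hline : HasDerivAt (fun z : ℂ => S.restrict p.1 + (z - p.1 c) • L) L (p.1 c) := by
    have := (((hasDerivAt_id (p.1 c)).sub_const (p.1 c)).smul_const L).const_add (S.restrict p.1)
    simpa using this
  have hGd : HasFDerivAt G (fderiv ℂ G (S.restrict p.1))
      (S.restrict p.1 + (p.1 c - p.1 c) • L) := by
    have := (hG _ ⟨p.1, p.2, rfl⟩).differentiableAt.hasFDerivAt
    simpa using this
  have hcomp := hGd.comp_hasDerivAt (p.1 c) hline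
  have hnear : ∀ᶠ z in nhds (p.1 c), Function.update p.1 c z ∈ U := by
    have hc : Continuous fun z : ℂ => Function.update p.1 c z :=
      continuous_const.update c continuous_id
    refine hc.continuousAt.eventually_mem (U.isOpen.mem_nhds ?_)
    simp
  refine HasDerivAt.deriv (hcomp.congr_of_eventuallyEq ?_)
  filter_upwards [hnear] with z hz
  rw [dif_pos hz, e]
  simp only [Function.comp]
  congr 1
  funext s
  by_cases hs : s.1 = c
  · simp [hL, hs, Finset.restrict]
  · simp [hL, hs, Finset.restrict]

theorem pdFun_eq_zero (U : Opens (Jet N)) (c : Coord N) {g : U → ℂ} {S : Finset (Coord N)}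
    {G : (S → ℂ) → ℂ} (hG : AnalyticOnNhd ℂ G (S.restrict '' (U : Set (Jet N))))
    (e : ∀ p : U, g p = G (S.restrict p.1)) (hc : c ∉ S) (p : U) : pdFun U c g p = 0 := by
  rw [pdFun_eq_fderiv U c hG e p]
  have : (fun s : S => if s.1 = c then (1 : ℂ) else 0) = 0 := by
    funext s
    have : s.1 ≠ c := fun h => hc (h ▸ s.2)
    simp [this]
  rw [this, map_zero]

theorem isDyn_pdFun (U : Opens (Jet N)) (c : Coord N) {g : U → ℂ} (hg : IsDyn U g) :
    IsDyn U (pdFun U c g) := by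
  obtain ⟨S, G, hG, e⟩ := hg
  refine ⟨S, fun v => fderiv ℂ G v (fun s => if s.1 = c then 1 else 0), ?_,
    pdFun_eq_fderiv U c hG e⟩
  intro v hv
  exact ((ContinuousLinearMap.apply ℂ ℂ
    (fun s : S => if s.1 = c then (1 : ℂ) else 0)).analyticAt _).comp (hG v hv).fderiv

/-- Two functions have a representation in common variables. -/
theorem common_rep (U : Opens (Jet N)) {g h : U → ℂ} (hg : IsDyn U g) (hh : IsDyn U h) :
    ∃ (S : Finset (Coord N)) (G H : (S → ℂ) → ℂ),
      AnalyticOnNhd ℂ G (S.restrict '' (U : Set (Jet N))) ∧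
      AnalyticOnNhd ℂ H (S.restrict '' (U : Set (Jet N))) ∧
      (∀ p : U, g p = G (S.restrict p.1)) ∧ ∀ p : U, h p = H (S.restrict p.1) := by
  obtain ⟨S, G, hG, eG⟩ := hg
  obtain ⟨T, H, hH, eH⟩ := hh
  exact ⟨S ∪ T, _, _, enlarge U Finset.subset_union_left hG,
    enlarge U Finset.subset_union_right hH, fun p => eG p, fun p => eH p⟩

/-- The partial derivative along the coordinate `c` as a derivation of the ring. -/
def pd (U : Opens (Jet N)) (c : Coord N) : Der U :=
  Derivation.mk'
    { toFun := fun g => ⟨pdFun U c g.val, isDyn_pdFun U c g.isDyn⟩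
      map_add' := by
        intro g h
        obtain ⟨S, G, H, hG, hH, eG, eH⟩ := common_rep U g.isDyn h.isDyn
        refine Fun.ext fun p => ?_
        change pdFun U c (g.val + h.val) p = pdFun U c g.val p + pdFun U c h.val p
        have e : ∀ p : U, (g.val + h.val) p = (G + H) (S.restrict p.1) := fun p => by
          simp [eG, eH]
        have hp : S.restrict p.1 ∈ S.restrict '' (U : Set (Jet N)) := ⟨p.1, p.2, rfl⟩
        rw [pdFun_eq_fderiv U c (hG.add hH) e, pdFun_eq_fderiv U c hG eG,
          pdFun_eq_fderiv U c hH eH,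
          fderiv_add (hG _ hp).differentiableAt (hH _ hp).differentiableAt]
        rfl
      map_smul' := by
        intro a g
        obtain ⟨S, G, hG, eG⟩ := g.isDyn
        refine Fun.ext fun p => ?_
        change pdFun U c (a • g.val) p = a * pdFun U c g.val p
        have e : ∀ p : U, (a • g.val) p = (a • G) (S.restrict p.1) := fun p => by
          simp [eG]
        have hp : S.restrict p.1 ∈ S.restrict '' (U : Set (Jet N)) := ⟨p.1, p.2, rfl⟩
        have hG' : AnalyticOnNhd ℂ (a • G) (S.restrict '' (U : Set (Jet N))) := fun v hv =>
          analyticAt_const.smul (hG v hv)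
        rw [pdFun_eq_fderiv U c hG' e, pdFun_eq_fderiv U c hG eG,
          fderiv_const_smul (hG _ hp).differentiableAt]
        rfl }
    (by
      intro g h
      obtain ⟨S, G, H, hG, hH, eG, eH⟩ := common_rep U g.isDyn h.isDyn
      refine Fun.ext fun p => ?_
      change pdFun U c (fun q => g.val q * h.val q) p = g.val p * pdFun U c h.val p + h.val p * pdFun U c g.val p
      have e : ∀ p : U, g.val p * h.val p = (fun v => G v * H v) (S.restrict p.1) := fun p => by
        simp [eG, eH]
      have hp : S.restrict p.1 ∈ S.restrict '' (U : Set (Jet N)) := ⟨p.1, p.2, rfl⟩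
      rw [pdFun_eq_fderiv U c (hG.mul hH) e, pdFun_eq_fderiv U c hG eG,
        pdFun_eq_fderiv U c hH eH,
        fderiv_fun_mul (hG _ hp).differentiableAt (hH _ hp).differentiableAt, eG, eH]
      rfl)

theorem finite_pd (U : Opens (Jet N)) (g : Fun U) : {c | pd U c g ≠ 0}.Finite := by
  obtain ⟨S, G, hG, e⟩ := g.isDyn
  refine S.finite_toSet.subset fun c hc => ?_
  by_contra hS
  refine hc ?_
  refine Fun.ext fun p => ?_
  exact pdFun_eq_zero U c hG e hS p

theorem finite_vf (U : Opens (Jet N)) (a : Coord N → Fun U) (g : Fun U) :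
    (Function.support fun c => a c * pd U c g).Finite :=
  (finite_pd U g).subset fun c hc h => hc (by simp [h])

/-- The vector field `∑_c a_c ∂/∂c` with infinitely many terms; on each function only finitely
many terms are nonzero. -/
def vf (U : Opens (Jet N)) (a : Coord N → Fun U) : Der U :=
  Derivation.mk'
    { toFun := fun g => ∑ᶠ c, a c * pd U c g
      map_add' := by
        intro g h
        rw [← finsum_add_distrib (finite_vf U a g) (finite_vf U a h)]
        exact finsum_congr fun c => by rw [map_add, mul_add]
      map_smul' := by
        intro r g
        rw [RingHom.id_apply, smul_finsum' r (finite_vf U a g)]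
        exact finsum_congr fun c => by rw [Derivation.map_smul, mul_smul_comm] }
    (by
      intro g h
      change ∑ᶠ c, a c * pd U c (g * h) =
        g • (∑ᶠ c, a c * pd U c h) + h • ∑ᶠ c, a c * pd U c g
      rw [smul_finsum' g (finite_vf U a h), smul_finsum' h (finite_vf U a g),
        ← finsum_add_distrib]
      · refine finsum_congr fun c => ?_
        rw [Derivation.leibniz]
        simp only [smul_eq_mul]
        ring
      · exact (finite_vf U a h).subset fun c hc h0 => hc (by simp [h0])
      · exact (finite_vf U a g).subset fun c hc h0 => hc (by simp [h0]))

/-! ### Total derivatives and characteristic operators of the system `u_{i,xy} = f_i` -/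

/-- The total derivative in the direction `d`, on functions of the independent variables, the
unknowns, their first derivatives in the other direction and all derivatives in the
direction `d`. -/
def base (U : Opens (Jet N)) (f : Fin (N + 1) → Fun U) (d : Dir) :
    Der U :=
  vf U fun c => match c with
    | .t e => if e = d then 1 else 0
    | .u i => coord U (.du d i 0)
    | .du e i k => if e = d then coord U (.du d i (k + 1)) else if k = 0 then f i else 0

/-- The total derivative `D_x` or `D_y` by virtue of the system. The mixed derivatives are
`∂_d ∂_e^{k+1} u_i = D_e^k f_i` for `e ≠ d`. -/
def total (U : Opens (Jet N)) (f : Fin (N + 1) → Fun U) (d : Dir) :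
    Der U :=
  vf U fun c => match c with
    | .t e => if e = d then 1 else 0
    | .u i => coord U (.du d i 0)
    | .du e i k => if e = d then coord U (.du d i (k + 1)) else (base U f e)^[k] (f i)

/-- The vector field, written for `d = y`,
`Y = ∑_i (u_{i,y} ∂/∂u_i + f_i ∂/∂u_{i,x} + D_x f_i ∂/∂u_{i,xx} + ⋯)`. -/
def charField (U : Opens (Jet N)) (f : Fin (N + 1) → Fun U) (d : Dir) :
    Der U :=
  vf U fun c => match c with
    | .t _ => 0
    | .u i => coord U (.du d i 0)
    | .du e i k => if e = d then 0 else (base U f e)^[k] (f i)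

/-- `Y_i = [∂/∂u_{i,y}, Y]` (for `d = y`). -/
def charOp (U : Opens (Jet N)) (f : Fin (N + 1) → Fun U) (d : Dir) (i : Fin (N + 1)) :
    Der U :=
  ⁅pd U (.du d i 0), charField U f d⁆

/-- `Y - ∑_i u_{i,y} Y_i` (for `d = y`), for `Y` any extension of the field above. -/
def restOp (U : Opens (Jet N)) (f : Fin (N + 1) → Fun U) (d : Dir)
    (Y : Der U) : Der U :=
  Y - ∑ i, coord U (.du d i 0) • charOp U f d i

/-- The multiple commutators: `multiOp i k = Y_{i+k,…,i}`, that is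
`Y_{i+k,…,i} = [Y_{i+k}, Y_{i+k-1,…,i}]`, starting from `Y_i`. Only used for `i + k ≤ N`. -/
def multiOp (U : Opens (Jet N)) (f : Fin (N + 1) → Fun U) (d : Dir) (i : ℕ) :
    ℕ → Der U
  | 0 => if h : i < N + 1 then charOp U f d ⟨i, h⟩ else 0
  | k + 1 => ⁅(if h : i + (k + 1) < N + 1 then charOp U f d ⟨i + (k + 1), h⟩ else 0),
      multiOp U f d i k⁆

/-- The family `R`, `{Y_i}_{0 ≤ i ≤ N}`, `{Y_{i+1,i}}_{0 ≤ i ≤ N-1}`, …, `Y_{N,…,0}`. -/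
def family (U : Opens (Jet N)) (f : Fin (N + 1) → Fun U) (d : Dir)
    (Y : Der U) :
    Option {q : ℕ × ℕ // q.1 + q.2 ≤ N} → Der U
  | none => restOp U f d Y
  | some q => multiOp U f d q.1.1 q.1.2

/-- The Lie algebra over the ring `F` generated by `Y, Y_0, …, Y_N`: the smallest
Lie–Rinehart subalgebra of the derivations of `F` that contains these operators. -/
def charAlg (U : Opens (Jet N)) (f : Fin (N + 1) → Fun U) (d : Dir)
    (Y : Der U) : Submodule (Fun U) (Der U) :=
  sInf {M | ∃ L : LieRinehartSubalgebra (Fun U) (Der U),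
    Y ∈ L ∧ (∀ i, charOp U f d i ∈ L) ∧ L.toSubmodule = M}

/-! ### Darboux integrability -/

/-- `I` is an integral in the direction `d`; for `d = y` this is a `y`-integral:
`D_y I = 0` and `I` depends on `x, y` and on `u, u_x, u_xx, …` only. -/
def IsIntegral (U : Opens (Jet N)) (f : Fin (N + 1) → Fun U) (d : Dir) (I : Fun U) : Prop :=
  total U f d I = 0 ∧ ∀ i k, pd U (.du d i k) I = 0

/-- The other independent variable. -/
def Dir.other : Dir → Dir
  | .x => .y
  | .y => .x

/-- A complete set of integrals in the direction `d`: as many integrals `I_j` as unknowns, `I_j`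
of order `ord j + 1`, essentially independent, i.e. with the nonvanishing determinant of the
derivatives of the `I_j` with respect to the highest derivatives of the unknowns. Then all the
`I_j` and their total derivatives of all orders are functionally independent. For an autonomous
system the integrals are autonomous. -/
def HasCompleteIntegrals (U : Opens (Jet N)) (f : Fin (N + 1) → Fun U) (d : Dir) : Prop :=
  ∃ (I : Fin (N + 1) → Fun U) (ord : Fin (N + 1) → ℕ),
    (∀ j, IsIntegral U f d (I j)) ∧
    (∀ j i k, ord j < k → pd U (.du d.other i k) (I j) = 0) ∧
    (∀ p : U, (Matrix.of fun j i => (pd U (.du d.other i (ord j)) (I j)).val p).det ≠ 0) ∧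
    ((∀ i e, pd U (.t e) (f i) = 0) → ∀ j e, pd U (.t e) (I j) = 0)

/-- `f` is the restriction to `U` of the right-hand side `g`, which thus is analytic on `U`. -/
def Represents (U : Opens (Jet N)) (g : Fin (N + 1) → Jet N → ℂ)
    (f : Fin (N + 1) → Fun U) : Prop :=
  ∀ i (p : U), (f i).val p = g i p.1

/-- Darboux integrability of the system `u_{i,xy} = g_i`, considered on the set `dom`: near
generic points of `dom` there are complete sets of `x`- and `y`-integrals. -/
def DarbouxIntegrable (dom : Set (Jet N)) (g : Fin (N + 1) → Jet N → ℂ) : Prop :=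
  (interior dom).Nonempty ∧
  ∀ V : Opens (Jet N), (V : Set (Jet N)).Nonempty → (V : Set (Jet N)) ⊆ dom →
    ∃ U : Opens (Jet N), (U : Set (Jet N)).Nonempty ∧ U ≤ V ∧
      ∃ f : Fin (N + 1) → Fun U, Represents U g f ∧ ∀ d, HasCompleteIntegrals U f d

/-! ### Chains and cut-off conditions -/

/-- A cut-off function `φ(x, y, v_1, v_2, …)`; the list holds the values of the unknowns at the
interior nodes, starting from the node next to the cut-off point. -/
abbrev Cutoff : Type := ℂ → ℂ → List ℂ → ℂ

/-- The value at the node `n`: `u_n` for `0 ≤ n ≤ N`, and the cut-off conditions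
`u_{-1} = φ₁(x, y, u_0, u_1, …)`, `u_{N+1} = φ₂(x, y, u_N, u_{N-1}, …)`. -/
def node (N : ℕ) (φ₁ φ₂ : Cutoff) (p : Jet N) (n : ℤ) : ℂ :=
  if n < 0 then φ₁ (p (.t .x)) (p (.t .y)) (List.ofFn fun i : Fin (N + 1) => p (.u i))
  else if h : n.toNat < N + 1 then p (.u ⟨n.toNat, h⟩)
  else φ₂ (p (.t .x)) (p (.t .y)) (List.ofFn fun i : Fin (N + 1) => p (.u i)).reverse

/-- The right-hand sides of the system cut out of the chain
`u_{n,xy} = F(u_{n+1}, u_n, u_{n-1}, u_{n,x}, u_{n,y})`. -/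
def cutRHS (N : ℕ) (F : ℂ → ℂ → ℂ → ℂ → ℂ → ℂ) (φ₁ φ₂ : Cutoff)
    (i : Fin (N + 1)) (p : Jet N) : ℂ :=
  F (node N φ₁ φ₂ p ((i : ℕ) + 1)) (node N φ₁ φ₂ p (i : ℕ)) (node N φ₁ φ₂ p ((i : ℕ) - 1))
    (p (.du .x i 0)) (p (.du .y i 0))

/-- The points where all triples `(u_{n+1}, u_n, u_{n-1})` are in the domain `Ω` of the chain. -/
def cutDom (N : ℕ) (Ω : Set (ℂ × ℂ × ℂ)) (φ₁ φ₂ : Cutoff) : Set (Jet N) :=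
  {p | ∀ i : Fin (N + 1),
    (node N φ₁ φ₂ p ((i : ℕ) + 1), node N φ₁ φ₂ p (i : ℕ), node N φ₁ φ₂ p ((i : ℕ) - 1)) ∈ Ω}

/-- Integrability of a chain: there are cut-off functions such that for all integers
`N₁ < N₂ - 1` the system for `u_n`, `N₁ < n < N₂`, is Darboux integrable. The right-hand side
does not depend on `n` explicitly, so that the system is the one for `N₁ = -1`, `N₂ = N + 1`
with `N = N₂ - N₁ - 2`, up to the names of the unknowns. -/
def IntegrableChain (Ω : Set (ℂ × ℂ × ℂ)) (F : ℂ → ℂ → ℂ → ℂ → ℂ → ℂ) : Prop :=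
  ∃ φ₁ φ₂ : Cutoff, ∀ N₁ N₂ : ℤ, N₁ < N₂ - 1 → ∀ N : ℕ, (N : ℤ) = N₂ - N₁ - 2 →
    DarbouxIntegrable (cutDom N Ω φ₁ φ₂) (cutRHS N F φ₁ φ₂)

/-! ### The classified chain -/

/-- `r(v) = (c₁/2) v² + c₂ v + c₃`. -/
def r (c₁ c₂ c₃ v : ℂ) : ℂ := c₁ / 2 * v ^ 2 + c₂ * v + c₃

/-- `r'(v) = c₁ v + c₂`. -/
def r' (c₁ c₂ v : ℂ) : ℂ := c₁ * v + c₂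

/-- `α(u_{n+1}, u_n, u_{n-1})`. -/
def α (up u um : ℂ) : ℂ := 1 / (u - um) - 1 / (up - u)

/-- `β(u_{n+1}, u_n, u_{n-1})`. -/
def β (c₁ c₂ c₃ up u um : ℂ) : ℂ := r' c₁ c₂ u - r c₁ c₂ c₃ u * α up u um

/-- `γ(u_{n+1}, u_n, u_{n-1})`. -/
def γ (c₁ c₂ c₃ ε up u um : ℂ) : ℂ := ε * (r' c₁ c₂ u - r c₁ c₂ c₃ u * α up u um)

/-- `δ(u_{n+1}, u_n, u_{n-1})`. -/
def δ (c₁ c₂ c₃ ε up u um : ℂ) : ℂ :=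
  -ε * r c₁ c₂ c₃ u * (r' c₁ c₂ u - r c₁ c₂ c₃ u * α up u um)

/-- The right-hand side `α u_{n,x} u_{n,y} + β u_{n,x} + γ u_{n,y} + δ`. -/
def chain (c₁ c₂ c₃ ε up u um ux uy : ℂ) : ℂ :=
  α up u um * ux * uy + β c₁ c₂ c₃ up u um * ux + γ c₁ c₂ c₃ ε up u um * uy
    + δ c₁ c₂ c₃ ε up u um

/-- The domain of the coefficients: `u_n ≠ u_{n-1}` and `u_{n+1} ≠ u_n`. -/
def chainDom : Set (ℂ × ℂ × ℂ) := {v | v.2.1 ≠ v.2.2 ∧ v.1 ≠ v.2.1}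

/-- The explicit basis of the characteristic algebra in the direction `d` over the functions of
`x`, `y` and the dynamical variables: for `d = y` the algebra is generated by
`∂/∂y + Y, Y_0, …, Y_N`, and `R = ∂/∂y + Y - ∑ u_{i,y} Y_i`. In particular the algebra has a
finite basis. -/
def HasExplicitBasis (U : Opens (Jet N)) (f : Fin (N + 1) → Fun U) (d : Dir) : Prop :=
  LinearIndependent (Fun U) (family U f d (pd U (.t d) + charField U f d)) ∧
  Submodule.span (Fun U) (Set.range (family U f d (pd U (.t d) + charField U f d))) =
    charAlg U f d (pd U (.t d) + charField U f d)

end Chain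

end

/-! Put ε_x = ε, ε_y = 1 and π_i^e = u_{i,e} - ε_e r(u_i). The chain is f_i = α_i π_i^x π_i^y +
r'(u_i)(u_{i,x} + ε u_{i,y} - ε r(u_i)). For a direction d and the other direction e this means D
π_i^d = B_i π_i^d, where D is the total derivative along e and B_i is free of derivatives along d.
Hence [D, Y_i] = -B_i Y_i, and ∂/∂t_d + Y = R' + ∑ π_i^d Y_i, where R' prolongs the field u_i ↦ ε_d
r(u_i) and commutes with D; it differs from the R of the theorem by a combination of the Y_i. The
cut-off values g satisfy ∂g/∂t_e = ε_e r(g), so the boundary nodes obey the same formulas with π =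
0.

A vertical field that D maps to a multiple of itself and that kills all u_i is zero
(`IsVert.eq_zero`). Identities between fields therefore reduce to their action on the nodes and
their commutator with D. For E_i = (u_i - u_{i-1}) Y_i this gives Serre-like relations: [E_i, E_j] =
0 for |i - j| ≥ 2, while ad E_i and ad E_{i+1} act on [E_i, E_{i+1}] as 1 and -1
(`CutoffFields.relations`); moreover [R', E_i] is a multiple of E_i. By these relations the
commutator of a generator with a nested commutator is zero or plus or minus a nested commutator
(`lie_nested_mem`), so the span of R' and the nested commutators is closed. Passing from E_i back to
Y_i is triangular (`nested_smul`).

For independence, a linear relation is tested on the quotients p_k of π by the differences of the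
nodes: each E_i scales them by 0 or ±1, and longer commutators kill them. Commuting the relation
with D gives a new relation, which links each diagonal of coefficients to the next (`comb_eq_zero`).
The coefficient of R' is removed by the coordinate t_d, or in the autonomous version by ε_d r'(λ) ≠
0.

The integrals are built from the coefficients of an ordinary differential operator (q_N D + σ_N) ⋯
(q_0 D + σ_0). All Y_i annihilate these coefficients, and R' multiplies them by a common factor ω
with D ω = 0. So the logarithmic derivative of the leading coefficient and the quotients by it are
integrals. Their symbols form a binomial matrix up to nonvanishing column factors
(`symbol_integral`). The construction needs invertible π_i^e and u_i - u_{-1}, which is true on a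
nonempty open part of every nonempty open subset of the domain. Over ℂ, r has a root unless it is
constant, so one of the two cut-offs always exists. -/

noncomputable section

namespace Chain

variable {N : ℕ}

/-! ### The ring of functions: values, inverses, non-zero-divisors. -/

section Functions

variable {U : Opens (Jet N)}

@[simp] theorem Fun.val_add (g h : Fun U) (p : U) : (g + h).val p = g.val p + h.val p := rfl
@[simp] theorem Fun.val_mul (g h : Fun U) (p : U) : (g * h).val p = g.val p * h.val p := rfl
@[simp] theorem Fun.val_sub (g h : Fun U) (p : U) : (g - h).val p = g.val p - h.val p := rfl
@[simp] theorem Fun.val_zero (p : U) : (0 : Fun U).val p = 0 := rfl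
@[simp] theorem Fun.val_one (p : U) : (1 : Fun U).val p = 1 := rfl
@[simp] theorem Fun.val_pow (g : Fun U) (n : ℕ) (p : U) : (g ^ n).val p = g.val p ^ n := rfl
@[simp] theorem Fun.val_algebraMap (z : ℂ) (p : U) : (algebraMap ℂ (Fun U) z).val p = z := rfl
@[simp] theorem val_coord (c : Coord N) (p : U) : (coord U c).val p = p.1 c := rfl

/-- Evaluation at a point as a ring homomorphism. -/
def evalHom (p : U) : Fun U →+* ℂ where
  toFun g := g.val p
  map_one' := rfl
  map_mul' _ _ := rfl
  map_zero' := rfl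
  map_add' _ _ := rfl

theorem Fun.continuous_val (g : Fun U) : Continuous g.val := by
  obtain ⟨S, G, hG, e⟩ := g.isDyn
  have h1 : ContinuousOn G (S.restrict '' (U : Set (Jet N))) := hG.continuousOn
  have h2 : g.val = fun p => G (S.restrict p.1) := funext e
  rw [h2]
  refine h1.comp_continuous ?_ fun p => ⟨p.1, p.2, rfl⟩
  exact (Finset.continuous_restrict S).comp continuous_subtype_val

/-- The inverse of a function without zeros. -/
def Fun.inv (g : Fun U) (h : ∀ p, g.val p ≠ 0) : Fun U :=
  ⟨fun p => (g.val p)⁻¹, by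
    obtain ⟨S, G, hG, e⟩ := g.isDyn
    refine ⟨S, fun v => (G v)⁻¹, ?_, fun p => congrArg _ (e p)⟩
    rintro _ ⟨p, hp, rfl⟩
    refine (hG _ ⟨p, hp, rfl⟩).inv ?_
    have := h ⟨p, hp⟩
    rwa [e] at this⟩

@[simp] theorem Fun.val_inv (g : Fun U) (h : ∀ p, g.val p ≠ 0) (p : U) :
    (g.inv h).val p = (g.val p)⁻¹ := rfl

theorem Fun.mul_inv (g : Fun U) (h : ∀ p, g.val p ≠ 0) : g * g.inv h = 1 :=
  Fun.ext fun p => by simp [h p]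

@[simp] theorem pd_coord (c c' : Coord N) :
    pd U c (coord U c') = if c' = c then 1 else 0 := by
  refine Fun.ext fun p => ?_
  refine (pdFun_eq_fderiv U c (S := {c'})
    (G := ContinuousLinearMap.proj (R := ℂ) (φ := fun _ : ({c'} : Finset (Coord N)) => ℂ)
      ⟨c', Finset.mem_singleton_self c'⟩)
    (fun v _ => ContinuousLinearMap.analyticAt _ v) (fun _ => rfl) p).trans ?_
  rw [ContinuousLinearMap.fderiv]
  by_cases h : c' = c <;> simp [h]

/-- In a representation by finitely many variables both sides are values of the second derivative,
which is symmetric for an analytic function. -/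
theorem pd_comm (c c' : Coord N) (g : Fun U) : pd U c (pd U c' g) = pd U c' (pd U c g) := by
  obtain ⟨S, G, hG, e⟩ := g.isDyn
  let L : Coord N → S → ℂ := fun c s => if s.1 = c then 1 else 0
  have key : ∀ c c' : Coord N, ∀ p : U, (pd U c (pd U c' g)).val p =
      fderiv ℂ (fderiv ℂ G) (S.restrict p.1) (L c) (L c') := by
    intro c c' p
    have h1 : ∀ p : U, (pd U c' g).val p = (fun v => fderiv ℂ G v (L c')) (S.restrict p.1) :=
      pdFun_eq_fderiv U c' hG e
    have hA : AnalyticOnNhd ℂ (fun v => fderiv ℂ G v (L c')) (S.restrict '' (U : Set (Jet N))) :=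
      fun v hv => ((ContinuousLinearMap.apply ℂ ℂ (L c')).analyticAt _).comp (hG v hv).fderiv
    refine (pdFun_eq_fderiv U c hA h1 p).trans ?_
    have hd : DifferentiableAt ℂ (fderiv ℂ G) (S.restrict p.1) :=
      (hG _ ⟨p.1, p.2, rfl⟩).fderiv.differentiableAt
    rw [fderiv_clm_apply hd (differentiableAt_const _)]
    simp [L]
  refine Fun.ext fun p => ?_
  rw [key, key]
  have hs : IsSymmSndFDerivAt ℂ G (S.restrict p.1) :=
    ContDiffAt.isSymmSndFDerivAt_of_omega (hG _ ⟨p.1, p.2, rfl⟩).contDiffAt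
  exact hs _ _

theorem pd_val_eq_zero (c : Coord N) (g : Fun U) (p : U)
    (h : ∀ᶠ q in nhds p, g.val q = 0) : (pd U c g).val p = 0 := by
  classical
  change pdFun U c g.val p = 0
  have hc : Continuous fun z : ℂ => Function.update p.1 c z :=
    continuous_const.update c continuous_id
  have hnear : ∀ᶠ q in nhds p.1, ∀ h : q ∈ U, g.val ⟨q, h⟩ = 0 := by
    rw [nhds_subtype_eq_comap, Filter.eventually_comap] at h
    exact h.mono fun q hq hU => hq ⟨q, hU⟩ rfl
  have hp : Function.update p.1 c (p.1 c) = p.1 := Function.update_eq_self _ _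
  rw [← hp] at hnear
  unfold pdFun
  refine (Filter.EventuallyEq.deriv_eq (f := fun _ => 0) ?_).trans (deriv_const _ _)
  filter_upwards [hc.continuousAt.eventually hnear] with z hz
  split_ifs with h
  · exact hz h
  · rfl

/-- A function with a derivative equal to one is not a zero divisor. -/
theorem mem_nonZeroDivisors_of_pd (c : Coord N) (h : Fun U) (hc : pd U c h = 1) :
    h ∈ nonZeroDivisors (Fun U) := by
  rw [mem_nonZeroDivisors_iff_right]
  intro g hg
  refine Fun.ext fun p => ?_
  by_contra hp
  -- A local argument is needed: `U` may be disconnected, and then the ring has zero divisors. Near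
  -- a point where `g` is nonzero, `h` would vanish identically, and so would its derivative.
  have h1 : ∀ᶠ q in nhds p, g.val q ≠ 0 := g.continuous_val.continuousAt.eventually_ne hp
  have h2 : ∀ᶠ q in nhds p, h.val q = 0 := h1.mono fun q hq => by
    have : (g * h).val q = 0 := by rw [hg]; rfl
    exact (mul_eq_zero.1 this).resolve_left hq
  have h3 := pd_val_eq_zero c h p h2
  rw [hc] at h3
  exact one_ne_zero h3

end Functions

/-! ### Vector fields, determined by their values on coordinates. -/

section VectorFields

variable {U : Opens (Jet N)}

theorem vf_apply (a : Coord N → Fun U) (g : Fun U) : vf U a g = ∑ᶠ c, a c * pd U c g := rfl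

@[simp] theorem vf_coord (a : Coord N → Fun U) (c : Coord N) : vf U a (coord U c) = a c := by
  rw [vf_apply, finsum_eq_single _ c]
  · simp
  · intro c' h
    simp [h.symm]

/-- A derivation that is a (possibly infinite) combination of partial derivatives. -/
def IsVF (X : Der U) : Prop := X = vf U fun c => X (coord U c)

theorem isVF_vf (a : Coord N → Fun U) : IsVF (vf U a) := by
  unfold IsVF
  congr 1
  funext c
  simp

theorem IsVF.apply {X : Der U} (hX : IsVF X) (g : Fun U) :
    X g = ∑ᶠ c, X (coord U c) * pd U c g := by
  conv_lhs => rw [hX]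
  rfl

theorem IsVF.of_apply {X : Der U} (h : ∀ g, X g = ∑ᶠ c, X (coord U c) * pd U c g) : IsVF X :=
  Derivation.ext h

/-- Abstract derivations are not assumed to be fixed by their values on coordinates. All operators
used below satisfy `IsVF`, which makes coordinatewise verification legitimate. -/
theorem IsVF.ext {X Z : Der U} (hX : IsVF X) (hZ : IsVF Z)
    (h : ∀ c, X (coord U c) = Z (coord U c)) : X = Z := by
  rw [hX, hZ]
  simp only [h]

theorem IsVF.apply_sum {X : Der U} (hX : IsVF X) (g : Fun U) {S : Finset (Coord N)}
    (hS : ∀ c, pd U c g ≠ 0 → c ∈ S) : X g = ∑ c ∈ S, X (coord U c) * pd U c g := by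
  rw [hX.apply, finsum_eq_sum_of_support_subset]
  intro c hc
  refine hS c fun h => hc ?_
  simp [h]

theorem isVF_pd (c : Coord N) : IsVF (pd U c) :=
  .of_apply fun g => by
    rw [finsum_eq_single _ c]
    · simp
    · intro c' h
      simp [h]

theorem isVF_zero : IsVF (0 : Der U) := .of_apply fun g => by simp

theorem IsVF.add {X Z : Der U} (hX : IsVF X) (hZ : IsVF Z) : IsVF (X + Z) :=
  .of_apply fun g => by
    have hS : ∀ c, pd U c g ≠ 0 → c ∈ (finite_pd U g).toFinset := fun c hc => by simpa using hc
    rw [finsum_eq_sum_of_support_subset (s := (finite_pd U g).toFinset), Derivation.add_apply,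
      hX.apply_sum g hS, hZ.apply_sum g hS, ← Finset.sum_add_distrib]
    · exact Finset.sum_congr rfl fun c _ => by rw [Derivation.add_apply, add_mul]
    · intro c hc
      refine hS c fun h => hc ?_
      simp [h]

theorem IsVF.smul {X : Der U} (h : Fun U) (hX : IsVF X) : IsVF (h • X) :=
  .of_apply fun g => by
    have hS : ∀ c, pd U c g ≠ 0 → c ∈ (finite_pd U g).toFinset := fun c hc => by simpa using hc
    rw [finsum_eq_sum_of_support_subset (s := (finite_pd U g).toFinset), Derivation.smul_apply,
      hX.apply_sum g hS, smul_eq_mul, Finset.mul_sum]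
    · exact Finset.sum_congr rfl fun c _ => by rw [Derivation.smul_apply, smul_eq_mul, mul_assoc]
    · intro c hc
      refine hS c fun h => hc ?_
      simp [h]

theorem IsVF.sum {ι : Type*} (s : Finset ι) {X : ι → Der U} (h : ∀ i, IsVF (X i)) :
    IsVF (∑ i ∈ s, X i) := by
  classical
  induction s using Finset.induction_on with
  | empty => simpa using isVF_zero
  | insert i s hi ih => rw [Finset.sum_insert hi]; exact (h i).add ih

/-- The second-order terms of X Z and Z X agree because partial derivatives commute; what remains is
the field whose components are the commutator's values on the coordinates. All sums run over the
finitely many variables of `g`. -/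
theorem IsVF.lie {X Z : Der U} (hX : IsVF X) (hZ : IsVF Z) : IsVF ⁅X, Z⁆ :=
  .of_apply fun g => by
    have hS : ∀ c, pd U c g ≠ 0 → c ∈ (finite_pd U g).toFinset := fun c hc => by simpa using hc
    have hS' : ∀ c c', pd U c (pd U c' g) ≠ 0 → c ∈ (finite_pd U g).toFinset := fun c c' hc => by
      refine hS c fun h => hc ?_
      rw [pd_comm, h, map_zero]
    rw [finsum_eq_sum_of_support_subset (s := (finite_pd U g).toFinset)]
    · generalize (finite_pd U g).toFinset = S at hS hS'
      have key : ∀ {X Z : Der U}, IsVF X → IsVF Z → X (Z g) =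
          ∑ c ∈ S, X (Z (coord U c)) * pd U c g +
          ∑ c ∈ S, ∑ c' ∈ S, X (coord U c') * Z (coord U c) * pd U c' (pd U c g) := by
        intro X Z hX hZ
        rw [hZ.apply_sum g hS, map_sum, ← Finset.sum_add_distrib]
        refine Finset.sum_congr rfl fun c _ => ?_
        rw [Derivation.leibniz, hX.apply_sum (pd U c g) fun c' h => hS' c' c h, add_comm]
        congr 1
        · rw [smul_eq_mul, mul_comm]
        · rw [smul_eq_mul, Finset.mul_sum]
          exact Finset.sum_congr rfl fun c' _ => by ring
      rw [Derivation.commutator_apply, key hX hZ, key hZ hX]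
      rw [Finset.sum_comm (s := S) (f := fun c c' =>
        Z (coord U c') * X (coord U c) * pd U c' (pd U c g))]
      simp only [Derivation.commutator_apply, sub_mul, Finset.sum_sub_distrib]
      rw [add_sub_add_comm]
      convert add_zero _ using 2
      rw [sub_eq_zero]
      refine Finset.sum_congr rfl fun c _ => Finset.sum_congr rfl fun c' _ => ?_
      rw [pd_comm c c', mul_comm (X (coord U c'))]
    · intro c hc
      refine hS c fun h => hc ?_
      simp [h]

theorem lie_vf {X : Der U} (hX : IsVF X) (a : Coord N → Fun U)
    (h : ∀ c, vf U a (X (coord U c)) = 0) : ⁅X, vf U a⁆ = vf U fun c => X (a c) :=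
  (hX.lie (isVF_vf a)).ext (isVF_vf _) fun c => by
    rw [Derivation.commutator_apply, vf_coord, vf_coord, h, sub_zero]

end VectorFields

end Chain

end

noncomputable section

namespace Chain

variable {N : ℕ}

/-! ### The total derivative on functions free of one direction; vertical fields. -/

section FreeTotal

variable (U : Opens (Jet N))

/-- The total derivative in the direction `e` on functions of the independent variables, the
unknowns and their derivatives in the direction `e`. -/
def freeTotal (e : Dir) : Der U :=
  vf U fun c => match c with
    | .t e' => if e' = e then 1 else 0
    | .u i => coord U (.du e i 0)
    | .du e' i k => if e' = e then coord U (.du e i (k + 1)) else 0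

/-- `g` does not depend on the derivatives of the unknowns in the direction `d`. -/
def IsFree (d : Dir) (g : Fun U) : Prop := ∀ i k, pd U (.du d i k) g = 0

variable {U}

theorem lie_pd_vf (c : Coord N) (a : Coord N → Fun U) :
    ⁅pd U c, vf U a⁆ = vf U fun c' => pd U c (a c') :=
  lie_vf (isVF_pd c) a fun c' => by
    rw [pd_coord]
    split_ifs <;> simp

theorem isVF_freeTotal (e : Dir) : IsVF (freeTotal U e) := isVF_vf _

theorem isVF_charField (f : Fin (N + 1) → Fun U) (d : Dir) : IsVF (charField U f d) := isVF_vf _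

theorem freeTotal_t (e e' : Dir) :
    freeTotal U e (coord U (.t e')) = if e' = e then 1 else 0 := vf_coord _ _

theorem freeTotal_u (e : Dir) (i : Fin (N + 1)) :
    freeTotal U e (coord U (.u i)) = coord U (.du e i 0) := vf_coord _ _

theorem freeTotal_du (e e' : Dir) (i : Fin (N + 1)) (k : ℕ) :
    freeTotal U e (coord U (.du e' i k)) =
      if e' = e then coord U (.du e i (k + 1)) else 0 := vf_coord _ _

theorem pd_freeTotal_t (e e' : Dir) (g : Fun U) :
    pd U (.t e') (freeTotal U e g) = freeTotal U e (pd U (.t e') g) := by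
  rw [← sub_eq_zero, ← Derivation.commutator_apply, freeTotal, lie_pd_vf]
  convert Derivation.zero_apply g
  refine (isVF_vf _).ext isVF_zero fun c => ?_
  rcases c with e' | i | ⟨e', i, k⟩ <;> simp <;> split_ifs <;> simp

theorem pd_freeTotal_du_of_ne {d e : Dir} (h : e ≠ d) (i : Fin (N + 1)) (k : ℕ) (g : Fun U) :
    pd U (.du d i k) (freeTotal U e g) = freeTotal U e (pd U (.du d i k) g) := by
  rw [← sub_eq_zero, ← Derivation.commutator_apply, freeTotal, lie_pd_vf]
  convert Derivation.zero_apply g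
  refine (isVF_vf _).ext isVF_zero fun c => ?_
  rcases c with e' | i | ⟨e', i, k⟩ <;> simp [h] <;> split_ifs <;> simp [h]

/-- The extra term comes from D ∂_e^{k+1} u_i = ∂_e^{k+2} u_i. It drives the computation of the
symbols of the integrals. -/
theorem pd_freeTotal_du_succ (e : Dir) (i : Fin (N + 1)) (k : ℕ) (g : Fun U) :
    pd U (.du e i (k + 1)) (freeTotal U e g) =
      freeTotal U e (pd U (.du e i (k + 1)) g) + pd U (.du e i k) g := by
  rw [← sub_eq_iff_eq_add', ← Derivation.commutator_apply, freeTotal, lie_pd_vf]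
  congr 1
  refine (isVF_vf _).ext (isVF_pd _) fun c => ?_
  rcases c with e' | i | ⟨e', i, k⟩ <;> simp <;> split_ifs <;> simp_all

theorem IsFree.freeTotal {d e : Dir} (h : e ≠ d) {g : Fun U} (hg : IsFree U d g) :
    IsFree U d (freeTotal U e g) := fun i k => by
  rw [pd_freeTotal_du_of_ne h, hg, map_zero]

theorem IsFree.iterate {d e : Dir} (h : e ≠ d) {g : Fun U} (hg : IsFree U d g) (n : ℕ) :
    IsFree U d ((Chain.freeTotal U e)^[n] g) := by
  induction n with
  | zero => exact hg
  | succ n ih => rw [Function.iterate_succ_apply']; exact ih.freeTotal h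

theorem IsFree.add {d : Dir} {g h : Fun U} (hg : IsFree U d g) (hh : IsFree U d h) :
    IsFree U d (g + h) := fun i k => by rw [map_add, hg, hh, add_zero]

theorem IsFree.mul {d : Dir} {g h : Fun U} (hg : IsFree U d g) (hh : IsFree U d h) :
    IsFree U d (g * h) := fun i k => by rw [Derivation.leibniz, hg, hh]; simp

theorem base_eq_freeTotal (f : Fin (N + 1) → Fun U) {d e : Dir} (h : e ≠ d) {g : Fun U}
    (hg : IsFree U d g) : base U f e g = freeTotal U e g := by
  refine finsum_congr fun c => ?_
  rcases c with e' | i | ⟨e', i, k⟩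
  · rfl
  · rfl
  · by_cases he : e' = e
    · simp [he]
    · have : e' = d := by cases e' <;> cases e <;> cases d <;> simp_all
      subst this
      rw [hg, mul_zero, mul_zero]

/-- `(D + B)^k B`. -/
def prolong (D : Der U) (B : Fun U) : ℕ → Fun U
  | 0 => B
  | k + 1 => D (prolong D B k) + B * prolong D B k

theorem IsFree.prolong {d e : Dir} (h : e ≠ d) {B : Fun U} (hB : IsFree U d B) (k : ℕ) :
    IsFree U d (Chain.prolong (Chain.freeTotal U e) B k) := by
  induction k with
  | zero => exact hB
  | succ k ih => exact (ih.freeTotal h).add (hB.mul ih)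

variable (U) in
/-- A vertical vector field: only derivatives along the unknowns and their derivatives in the
direction other than `d`. -/
structure IsVert (d : Dir) (Z : Der U) : Prop where
  isVF : IsVF Z
  t : ∀ e, Z (coord U (.t e)) = 0
  du : ∀ i k, Z (coord U (.du d i k)) = 0

/-- If Z(g) = 0 then Z(D g) = D(Z g) - m Z(g) = 0. Starting from the unknowns, this reaches all
their derivatives along e, since D raises the order by one. This is the uniqueness principle behind
every commutation relation below. -/
theorem IsVert.eq_zero {d e : Dir} (h : e ≠ d) {Z : Der U} (hZ : IsVert U d Z) (m : Fun U)
    (hm : ⁅freeTotal U e, Z⁆ = m • Z) (hu : ∀ i, Z (coord U (.u i)) = 0) : Z = 0 := by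
  have key : ∀ g, Z g = 0 → Z (freeTotal U e g) = 0 := fun g hg => by
    have := congrArg (fun X : Der U => X g) hm
    simpa [Derivation.commutator_apply, hg] using this
  refine hZ.isVF.ext isVF_zero fun c => ?_
  rw [Derivation.zero_apply]
  rcases c with e' | i | ⟨e', i, k⟩
  · exact hZ.t _
  · exact hu i
  · by_cases he : e' = d
    · exact he ▸ hZ.du i k
    · have : e' = e := by cases e' <;> cases e <;> cases d <;> simp_all
      subst this
      induction k with
      | zero =>
        have := key _ (hu i)
        rwa [freeTotal, vf_coord] at this
      | succ k ih =>
        have := key _ ih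
        rw [freeTotal, vf_coord] at this
        simpa using this

theorem IsVert.smul {d : Dir} {Z : Der U} (g : Fun U) (hZ : IsVert U d Z) : IsVert U d (g • Z) :=
  ⟨hZ.isVF.smul g, fun e => by simp [hZ.t], fun i k => by simp [hZ.du]⟩

theorem IsVert.add {d : Dir} {X Z : Der U} (hX : IsVert U d X) (hZ : IsVert U d Z) :
    IsVert U d (X + Z) :=
  ⟨hX.isVF.add hZ.isVF, fun e => by simp [hX.t, hZ.t], fun i k => by simp [hX.du, hZ.du]⟩

theorem IsVert.zero {d : Dir} : IsVert U d 0 :=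
  ⟨isVF_zero, fun e => by simp, fun i k => by simp⟩

theorem IsVert.lie {d : Dir} {X Z : Der U} (hX : IsVert U d X) (hZ : IsVert U d Z) :
    IsVert U d ⁅X, Z⁆ :=
  ⟨hX.isVF.lie hZ.isVF, fun e => by simp [Derivation.commutator_apply, hX.t, hZ.t],
    fun i k => by simp [Derivation.commutator_apply, hX.du, hZ.du]⟩

end FreeTotal

/-! ### Characteristic operators of a system linear in the d-derivatives. -/

section CharacteristicFields

variable {U : Opens (Jet N)} {d e : Dir} (f ρ B : Fin (N + 1) → Fun U)

/-- The right-hand sides are `f_i = D(ρ_i) + B_i (u_{i,d} - ρ_i)` with `ρ_i`, `B_i` independent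
of the derivatives in the direction `d`. -/
structure IsLinearSystem (d e : Dir) (f ρ B : Fin (N + 1) → Fun U) : Prop where
  ne : e ≠ d
  eq : ∀ i, f i = freeTotal U e (ρ i) + B i * (coord U (.du d i 0) - ρ i)
  free_ρ : ∀ i, IsFree U d (ρ i)
  free_B : ∀ i, IsFree U d (B i)

namespace IsLinearSystem

variable {f ρ B} (hs : IsLinearSystem d e f ρ B)
include hs

/-- With Q = u_{i,d} - ρ_i the system reads D Q = B_i Q, so D^k(B_i Q) = ((D + B_i)^k B_i) Q. -/
theorem iterate_base (i : Fin (N + 1)) (k : ℕ) :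
    (base U f e)^[k] (f i) = (freeTotal U e)^[k + 1] (ρ i) +
      prolong (freeTotal U e) (B i) k * (coord U (.du d i 0) - ρ i) := by
  induction k with
  | zero => exact hs.eq i
  | succ k ih =>
    have hQ : base U f e (coord U (.du d i 0) - ρ i) = B i * (coord U (.du d i 0) - ρ i) := by
      rw [map_sub, base_eq_freeTotal f hs.ne (hs.free_ρ i), base, vf_coord]
      simp [hs.ne.symm, hs.eq i]
    rw [Function.iterate_succ_apply', ih, map_add, Derivation.leibniz, hQ,
      base_eq_freeTotal f hs.ne ((hs.free_ρ i).iterate hs.ne _),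
      base_eq_freeTotal f hs.ne ((hs.free_B i).prolong hs.ne _),
      Function.iterate_succ_apply' _ (k + 1)]
    simp only [smul_eq_mul, prolong]
    ring

omit hs in
theorem isVF_charOp (i : Fin (N + 1)) : IsVF (charOp U f d i) :=
  (isVF_pd _).lie (isVF_vf _)

omit hs in
theorem charOp_coord (i : Fin (N + 1)) (c : Coord N) :
    charOp U f d i (coord U c) = pd U (.du d i 0) (charField U f d (coord U c)) := by
  rw [charOp, Derivation.commutator_apply, pd_coord]
  split_ifs <;> simp

omit hs in
theorem charOp_t (i : Fin (N + 1)) (e' : Dir) : charOp U f d i (coord U (.t e')) = 0 := by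
  rw [charOp_coord, charField, vf_coord, map_zero]

omit hs in
theorem charOp_u (i j : Fin (N + 1)) :
    charOp U f d i (coord U (.u j)) = if j = i then 1 else 0 := by
  rw [charOp_coord, charField, vf_coord, pd_coord]
  simp

omit hs in
theorem charOp_du_self (i j : Fin (N + 1)) (k : ℕ) :
    charOp U f d i (coord U (.du d j k)) = 0 := by
  rw [charOp_coord, charField, vf_coord]
  simp

theorem charOp_du (i j : Fin (N + 1)) (k : ℕ) :
    charOp U f d i (coord U (.du e j k)) =
      if j = i then prolong (freeTotal U e) (B i) k else 0 := by
  rw [charOp_coord, charField, vf_coord]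
  simp only [if_neg hs.ne]
  rw [hs.iterate_base, map_add, Derivation.leibniz, map_sub, (hs.free_ρ j).iterate hs.ne,
    (hs.free_B j).prolong hs.ne, hs.free_ρ, pd_coord]
  by_cases h : j = i
  · simp [h]
  · simp [h]

omit hs in
theorem isVert_charOp (i : Fin (N + 1)) : IsVert U d (charOp U f d i) :=
  ⟨isVF_charOp i, charOp_t i, charOp_du_self i⟩

theorem eq_of_ne {e' : Dir} (h : e' ≠ d) : e' = e := by
  have := hs.ne
  cases e' <;> cases e <;> cases d <;> simp_all

/-- The successive components of Y_i along u_i, u_{i,e}, u_{i,ee}, … start with 1 and each is D +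
B_i applied to the previous one, which is exactly the commutation rule. -/
theorem lie_freeTotal_charOp (i : Fin (N + 1)) :
    ⁅freeTotal U e, charOp U f d i⁆ = -(B i) • charOp U f d i := by
  refine ((isVF_freeTotal e).lie (isVF_charOp i)).ext ((isVF_charOp i).smul _) fun c => ?_
  rw [Derivation.commutator_apply, Derivation.smul_apply]
  rcases c with e' | j | ⟨e', j, k⟩
  · rw [charOp_t, freeTotal_t]; split_ifs <;> simp
  · rw [charOp_u, freeTotal_u, hs.charOp_du]; split_ifs <;> simp [prolong]
  · by_cases he : e' = d
    · subst he; rw [charOp_du_self, freeTotal_du, if_neg hs.ne.symm]; simp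
    · obtain rfl := hs.eq_of_ne he
      rw [freeTotal_du, if_pos rfl, hs.charOp_du, hs.charOp_du]; split_ifs <;> simp [prolong]

end IsLinearSystem

/-- The field `τ ∂/∂t_d + ∑ (ρ_i ∂/∂u_i + D ρ_i ∂/∂u_{i,e} + ⋯)`. -/
def prolField (d e : Dir) (τ : ℂ) (ρ : Fin (N + 1) → Fun U) : Der U :=
  vf U fun c => match c with
    | .t e' => if e' = d then algebraMap ℂ _ τ else 0
    | .u i => ρ i
    | .du e' i k => if e' = d then 0 else (freeTotal U e)^[k + 1] (ρ i)

theorem isVF_prolField (τ : ℂ) : IsVF (prolField d e τ ρ) := isVF_vf _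

theorem prolField_t (τ : ℂ) (e' : Dir) : prolField d e τ ρ (coord U (.t e')) =
    if e' = d then algebraMap ℂ _ τ else 0 := vf_coord _ _

theorem prolField_u (τ : ℂ) (i : Fin (N + 1)) :
    prolField d e τ ρ (coord U (.u i)) = ρ i := vf_coord _ _

theorem prolField_du (τ : ℂ) (e' : Dir) (i : Fin (N + 1)) (k : ℕ) :
    prolField d e τ ρ (coord U (.du e' i k)) =
      if e' = d then 0 else (freeTotal U e)^[k + 1] (ρ i) := vf_coord _ _

/-- The component on each e-derivative of u_i is D of the preceding component, as for the
prolongation of a symmetry; the constant component along t_d is killed by D. -/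
theorem lie_freeTotal_prolField (hne : e ≠ d) (τ : ℂ) :
    ⁅freeTotal U e, prolField d e τ ρ⁆ = 0 := by
  refine ((isVF_freeTotal e).lie (isVF_prolField ρ τ)).ext isVF_zero fun c => ?_
  rw [Derivation.commutator_apply]
  rcases c with e' | j | ⟨e', j, k⟩
  · rw [prolField_t, freeTotal_t]; split_ifs <;> simp
  · rw [prolField_u, freeTotal_u, prolField_du]; simp [hne]
  · rw [prolField_du, freeTotal_du]
    by_cases he : e' = d
    · subst he; simp [hne.symm]
    · have : e' = e := by cases e' <;> cases e <;> cases d <;> simp_all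
      subst this
      rw [if_pos rfl, prolField_du]
      simp [hne, Function.iterate_succ_apply']

theorem IsVert.lie_prolField {Z : Der U} (hZ : IsVert U d Z) (τ : ℂ) :
    IsVert U d ⁅prolField d e τ ρ, Z⁆ :=
  ⟨(isVF_prolField ρ τ).lie hZ.isVF,
    fun e' => by
      rw [Derivation.commutator_apply, hZ.t, prolField_t]; split_ifs <;> simp,
    fun i k => by rw [Derivation.commutator_apply, hZ.du, prolField_du]; simp⟩

variable {f ρ B} in
-- In D^{k+1} ρ_i + ((D + B_i)^k B_i)(u_{i,d} - ρ_i), the first summand is a component of the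
-- prolonged field and the second of Y_i. The values τ = 1 and τ = 0 give the generators of the
-- general and of the autonomous algebra.
theorem IsLinearSystem.charField_eq (hs : IsLinearSystem d e f ρ B) (τ : ℂ) :
    τ • pd U (.t d) + charField U f d = prolField d e τ ρ +
      ∑ i, (coord U (.du d i 0) - ρ i) • charOp U f d i := by
  have h1 : IsVF (τ • pd U (.t d)) := by
    rw [← algebraMap_smul (Fun U)]
    exact (isVF_pd _).smul _
  refine (h1.add (isVF_charField f d)).ext ((isVF_prolField ρ τ).add
    (IsVF.sum _ fun i => (IsLinearSystem.isVF_charOp i).smul _)) fun c => ?_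
  have hsum : ∀ g, (∑ i, (coord U (.du d i 0) - ρ i) • charOp U f d i) g =
      ∑ i, (coord U (.du d i 0) - ρ i) * charOp U f d i g := fun g => by
    rw [← Derivation.coeFnAddMonoidHom_apply, map_sum, Finset.sum_apply]
    rfl
  have hY : ∀ c, charField U f d (coord U c) = _ := fun c => vf_coord _ c
  rw [Derivation.add_apply, Derivation.add_apply, hsum, Derivation.smul_apply, pd_coord, hY]
  rcases c with e' | j | ⟨e', j, k⟩
  · simp only [IsLinearSystem.charOp_t, Coord.t.injEq, prolField_t]
    split_ifs <;> simp [Algebra.algebraMap_eq_smul_one]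
  · simp only [IsLinearSystem.charOp_u, prolField_u]
    simp
  · dsimp only
    by_cases he : e' = d
    · subst he; simp [IsLinearSystem.charOp_du_self, prolField_du]
    · obtain rfl := hs.eq_of_ne he
      simp only [if_neg he, prolField_du, hs.charOp_du, hs.iterate_base]
      simp [mul_comm]

variable {f ρ B} in
theorem IsLinearSystem.restOp_eq (hs : IsLinearSystem d e f ρ B) (τ : ℂ) :
    restOp U f d (τ • pd U (.t d) + charField U f d) =
      prolField d e τ ρ - ∑ i, ρ i • charOp U f d i := by
  rw [restOp, hs.charField_eq]
  simp only [sub_smul, Finset.sum_sub_distrib]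
  abel

end CharacteristicFields

end Chain

end

noncomputable section

namespace Chain

/-! ### Nested commutators in a Lie ring with Serre-like relations. -/

section Nested

variable {L : Type*} [LieRing L]

/-- The nested commutator `[E_{i+k}, [E_{i+k-1}, …, E_i]]`. -/
def nested (E : ℕ → L) (i : ℕ) : ℕ → L
  | 0 => E i
  | k + 1 => ⁅E (i + (k + 1)), nested E i k⁆

theorem nested_eq_zero {E : ℕ → L} {N : ℕ} (hE : ∀ i, N < i → E i = 0) {i k : ℕ}
    (h : N < i + k) : nested E i k = 0 := by
  cases k with
  | zero => exact hE i h
  | succ k => rw [nested, hE _ h, zero_lie]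

/-- The relations between the generators. -/
structure ChainRelations (E : ℕ → L) : Prop where
  comm : ∀ i j, i + 2 ≤ j → ⁅E i, E j⁆ = 0
  left : ∀ i, ⁅E i, ⁅E i, E (i + 1)⁆⁆ = ⁅E i, E (i + 1)⁆
  right : ∀ i, ⁅E (i + 1), ⁅E i, E (i + 1)⁆⁆ = -⁅E i, E (i + 1)⁆

namespace ChainRelations

variable {E : ℕ → L} (hE : ChainRelations E)
include hE

theorem comm' (i j : ℕ) (h : i + 2 ≤ j) : ⁅E j, E i⁆ = 0 := by
  rw [← lie_skew, hE.comm i j h, neg_zero]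

omit hE in
theorem lie_nested_of_comm {k j : ℕ} (h : ⁅E k, E j⁆ = 0) (x : L) :
    ⁅E k, ⁅E j, x⁆⁆ = ⁅E j, ⁅E k, x⁆⁆ := by
  rw [leibniz_lie, h, zero_lie, zero_add]

theorem far (i n k : ℕ) (h : k + 2 ≤ i ∨ i + n + 2 ≤ k) : ⁅E k, nested E i n⁆ = 0 := by
  induction n with
  | zero =>
    rcases h with h | h
    · exact hE.comm k i h
    · exact hE.comm' i k h
  | succ n ih =>
    have h1 : ⁅E k, E (i + (n + 1))⁆ = 0 := by
      rcases h with h | h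
      · exact hE.comm _ _ (by omega)
      · exact hE.comm' _ _ (by omega)
    rw [nested, lie_nested_of_comm h1, ih (by omega), lie_zero]

/-- E_i commutes with every generator of the chain except E_{i+1}, so it can be moved inward until
it meets that innermost entry. -/
theorem lie_pred (i n : ℕ) : ⁅E i, nested E (i + 1) n⁆ = -nested E i (n + 1) := by
  induction n with
  | zero => simp only [nested]; rw [← lie_skew]
  | succ n ih =>
    have h1 : ⁅E i, E (i + 1 + (n + 1))⁆ = 0 := hE.comm _ _ (by omega)
    rw [nested, lie_nested_of_comm h1, ih, lie_neg, nested, nested]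
    congr 3
    ring

theorem nested_succ' (i n : ℕ) : nested E i (n + 1) = -⁅E i, nested E (i + 1) n⁆ := by
  rw [hE.lie_pred, neg_neg]

theorem lie_first (i n : ℕ) : ⁅E i, nested E i (n + 1)⁆ = nested E i (n + 1) := by
  induction n with
  | zero =>
    simp only [nested, zero_add]
    rw [← lie_skew (E (i + 1)), lie_neg, hE.left]
  | succ n ih =>
    have h1 : ⁅E i, E (i + (n + 1 + 1))⁆ = 0 := hE.comm _ _ (by omega)
    rw [nested, lie_nested_of_comm h1, ih]

theorem lie_last (i n : ℕ) : ⁅E (i + n + 1), nested E i (n + 1)⁆ = -nested E i (n + 1) := by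
  induction n generalizing i with
  | zero =>
    simp only [nested, zero_add, add_zero]
    rw [← lie_skew (E (i + 1)) (E i), lie_neg, hE.right]
  | succ n ih =>
    have h1 : ⁅E (i + (n + 1) + 1), E i⁆ = 0 := hE.comm' _ _ (by omega)
    rw [hE.nested_succ', lie_neg, lie_nested_of_comm h1]
    have h2 := ih (i + 1)
    rw [show i + 1 + n + 1 = i + (n + 1) + 1 by ring] at h2
    rw [h2, lie_neg]

/-- Let x be this commutator. The Jacobi identity expands [[E_{i+2}, E_{i+1}], [E_{i+1}, E_i]] in
two ways, and comparison gives x = -x. Division by 2 is where the complex scalars enter. -/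
theorem lie_mid_two [Module ℂ L] (i : ℕ) : ⁅E (i + 1), nested E i 2⁆ = 0 := by
  have e1 : nested E i 1 = ⁅E (i + 1), E i⁆ := rfl
  have e2 : nested E (i + 1) 1 = ⁅E (i + 2), E (i + 1)⁆ := rfl
  have e3 : nested E i 2 = ⁅E (i + 2), nested E i 1⁆ := rfl
  have h1 : ⁅E (i + 1), nested E i 1⁆ = -nested E i 1 := hE.lie_last i 0
  have h2 : ⁅E (i + 1), nested E (i + 1) 1⁆ = nested E (i + 1) 1 := hE.lie_first (i + 1) 0
  have h3 : ⁅E i, nested E (i + 1) 1⁆ = -nested E i 2 := hE.lie_pred i 1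
  have h5 : ⁅nested E (i + 1) 1, nested E i 1⁆ =
      -nested E i 2 + ⁅E (i + 1), nested E i 2⁆ := by
    have h6 : ⁅nested E (i + 1) 1, E i⁆ = nested E i 2 := by rw [← lie_skew, h3, neg_neg]
    have h7 : ⁅nested E (i + 1) 1, E (i + 1)⁆ = -nested E (i + 1) 1 := by rw [← lie_skew, h2]
    rw [e1, leibniz_lie, h7, neg_lie, h6]
  have h4 : ⁅E (i + 1), nested E i 2⁆ = -⁅nested E (i + 1) 1, nested E i 1⁆ - nested E i 2 := by
    rw [e3, leibniz_lie, h1, lie_neg, ← lie_skew (E (i + 1)) (E (i + 2)), ← e2, neg_lie, ← e3]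
    abel
  rw [h5] at h4
  have h6 : (2 : ℂ) • ⁅E (i + 1), nested E i 2⁆ = 0 := by
    rw [two_smul]
    nth_rewrite 1 [h4]
    abel
  exact (smul_eq_zero.1 h6).resolve_left two_ne_zero

theorem lie_mid_last [Module ℂ L] (i n : ℕ) : ⁅E (i + n + 1), nested E i (n + 2)⁆ = 0 := by
  induction n generalizing i with
  | zero => exact hE.lie_mid_two i
  | succ n ih =>
    have h1 : ⁅E (i + (n + 1) + 1), E i⁆ = 0 := hE.comm' _ _ (by omega)
    rw [hE.nested_succ', lie_neg, lie_nested_of_comm h1]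
    have h2 := ih (i + 1)
    rw [show i + 1 + n + 1 = i + (n + 1) + 1 by ring] at h2
    rw [h2, lie_zero, neg_zero]

theorem lie_mid [Module ℂ L] (i a b : ℕ) : ⁅E (i + a + 1), nested E i (a + 2 + b)⁆ = 0 := by
  induction b with
  | zero => exact hE.lie_mid_last i a
  | succ b ih =>
    have h1 : ⁅E (i + a + 1), E (i + (a + 2 + b + 1))⁆ = 0 := hE.comm _ _ (by omega)
    rw [← add_assoc, nested, lie_nested_of_comm h1, ih, lie_zero]

/-- The commutator of a generator with a nested commutator is zero or, up to the sign, a nested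
commutator. -/
theorem lie_nested_mem [Module ℂ L] (S : AddSubgroup L) (hS : ∀ i n, nested E i n ∈ S)
    (k i n : ℕ) : ⁅E k, nested E i n⁆ ∈ S := by
  rcases lt_trichotomy (k + 1) i with h | h | h
  · rw [hE.far i n k (by omega)]; exact S.zero_mem
  · subst h
    rw [hE.lie_pred]; exact S.neg_mem (hS _ _)
  rcases lt_trichotomy (i + n + 1) k with h' | h' | h'
  · rw [hE.far i n k (by omega)]; exact S.zero_mem
  · subst h'
    exact hS i (n + 1)
  rcases n with _ | n
  · obtain rfl : k = i := by omega
    rw [nested, lie_self]; exact S.zero_mem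
  rcases eq_or_ne k i with rfl | h1
  · rw [hE.lie_first]; exact hS _ _
  rcases eq_or_ne k (i + n + 1) with rfl | h2
  · rw [hE.lie_last]; exact S.neg_mem (hS _ _)
  · obtain ⟨a, rfl⟩ : ∃ a, k = i + a + 1 := ⟨k - i - 1, by omega⟩
    obtain ⟨b, rfl⟩ : ∃ b, n = a + 1 + b := ⟨n - a - 1, by omega⟩
    have := hE.lie_mid i a b
    rw [show a + 2 + b = a + 1 + b + 1 by ring] at this
    rw [this]; exact S.zero_mem

end ChainRelations

end Nested

/-! ### Spans over the ring of functions and rescaling of generators. -/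

section Rinehart

variable {A : Type*} [CommRing A] [Algebra ℂ A]

theorem lie_smul' (X Z : Derivation ℂ A A) (g : A) : ⁅X, g • Z⁆ = g • ⁅X, Z⁆ + X g • Z :=
  LieRinehartRing.leibniz_smul_right X Z g

theorem smul_lie' (X Z : Derivation ℂ A A) (g : A) : ⁅g • X, Z⁆ = g • ⁅X, Z⁆ - Z g • X := by
  rw [← lie_skew, lie_smul', ← lie_skew]
  module

theorem lie_apply (X Z : Derivation ℂ A A) (g : A) : ⁅X, Z⁆ g = X (Z g) - Z (X g) :=
  Derivation.commutator_apply g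

/-- If commutators with `X` of the generators are in the span, then so are those of all elements. -/
theorem lie_mem_span {s : Set (Derivation ℂ A A)} {S : Submodule A (Derivation ℂ A A)}
    (hs : s ⊆ S) (X : Derivation ℂ A A)
    (h : ∀ Z ∈ s, ⁅X, Z⁆ ∈ S) {Z : Derivation ℂ A A} (hZ : Z ∈ Submodule.span A s) :
    ⁅X, Z⁆ ∈ S := by
  induction hZ using Submodule.span_induction with
  | mem Z hZ => exact h Z hZ
  | zero => rw [lie_zero]; exact S.zero_mem
  | add Z W _ _ h1 h2 => rw [lie_add]; exact S.add_mem h1 h2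
  | smul g Z hZ h1 =>
    rw [lie_smul']
    exact S.add_mem (S.smul_mem _ h1) (S.smul_mem _ (Submodule.span_le.2 hs hZ))

/-- It suffices to bracket with the generators: commutators with longer nested elements follow by
the Jacobi identity, and those with R by induction on the length. Differentiating coefficients only
adds terms already in the span. -/
theorem span_nested_closed {E : ℕ → Derivation ℂ A A} (hE : ChainRelations E)
    (R : Derivation ℂ A A) (ρ : ℕ → A) (hR : ∀ i, ⁅R, E i⁆ = ρ i • E i)
    {X Z : Derivation ℂ A A}
    (hX : X ∈ Submodule.span A (insert R (Set.range fun q : ℕ × ℕ => nested E q.1 q.2)))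
    (hZ : Z ∈ Submodule.span A (insert R (Set.range fun q : ℕ × ℕ => nested E q.1 q.2))) :
    ⁅X, Z⁆ ∈ Submodule.span A (insert R (Set.range fun q : ℕ × ℕ => nested E q.1 q.2)) := by
  set s := insert R (Set.range fun q : ℕ × ℕ => nested E q.1 q.2) with hs
  set S := Submodule.span A s with hS
  have hsS : s ⊆ S := Submodule.subset_span
  have hRS : R ∈ S := hsS (Set.mem_insert _ _)
  have hFS : ∀ i n, nested E i n ∈ S := fun i n => hsS (Set.mem_insert_of_mem _ ⟨(i, n), rfl⟩)
  have hEk : ∀ k, ∀ Z ∈ S, ⁅E k, Z⁆ ∈ S := fun k Z hZ => by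
    refine lie_mem_span hsS _ ?_ hZ
    rintro _ (rfl | ⟨q, rfl⟩)
    · rw [← lie_skew, hR]
      exact S.neg_mem (S.smul_mem _ (hFS k 0))
    · exact hE.lie_nested_mem S.toAddSubgroup hFS k q.1 q.2
  have hF : ∀ i n, ∀ Z ∈ S, ⁅nested E i n, Z⁆ ∈ S := fun i n => by
    induction n with
    | zero => exact hEk i
    | succ n ih =>
      intro Z hZ
      rw [nested, lie_lie]
      exact S.sub_mem (hEk _ _ (ih _ hZ)) (ih _ (hEk _ _ hZ))
  have hRF : ∀ i n, ⁅R, nested E i n⁆ ∈ S := fun i n => by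
    induction n with
    | zero => rw [nested, hR]; exact S.smul_mem _ (hFS i 0)
    | succ n ih =>
      rw [nested, leibniz_lie, hR, smul_lie']
      exact S.add_mem (S.sub_mem (S.smul_mem _ (hFS i (n + 1))) (S.smul_mem _ (hFS (i + (n + 1)) 0)))
        (hEk _ _ ih)
  have hRZ : ∀ Z ∈ S, ⁅R, Z⁆ ∈ S := fun Z hZ => by
    refine lie_mem_span hsS _ ?_ hZ
    rintro _ (rfl | ⟨q, rfl⟩)
    · rw [lie_self]; exact S.zero_mem
    · exact hRF _ _
  rw [← lie_skew]
  refine S.neg_mem (lie_mem_span hsS Z ?_ hX)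
  rintro _ (rfl | ⟨q, rfl⟩)
  · rw [← lie_skew]; exact S.neg_mem (hRZ Z hZ)
  · rw [← lie_skew]; exact S.neg_mem (hF _ _ Z hZ)

/-- Rescaling of the generators changes nested commutators by a triangular transformation. -/
theorem nested_smul {E Y : ℕ → Derivation ℂ A A} (hE : ChainRelations E) {N : ℕ} (v : ℕ → A)
    (hY : ∀ i, i ≤ N → Y i = v i • E i) (i n : ℕ) (h : i + n ≤ N) :
    nested Y i n - (∏ l ∈ Finset.range (n + 1), v (i + l)) • nested E i n ∈
      Submodule.span A {X | ∃ j b, i ≤ j ∧ j + b ≤ i + n ∧ b < n ∧ X = nested E j b} := by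
  induction n with
  | zero => simp [nested, hY i h]
  | succ n ih =>
    replace ih := ih (by omega)
    obtain ⟨L, hL⟩ : ∃ L, L = nested Y i n -
      (∏ l ∈ Finset.range (n + 1), v (i + l)) • nested E i n := ⟨_, rfl⟩
    rw [← hL] at ih
    set u := ∏ l ∈ Finset.range (n + 1), v (i + l)
    set S := Submodule.span A
      {X | ∃ j b, i ≤ j ∧ j + b ≤ i + (n + 1) ∧ b < n + 1 ∧ X = nested E j b}
    have hS : ∀ j b, i ≤ j → j + b ≤ i + (n + 1) → b < n + 1 → nested E j b ∈ S :=
      fun j b h1 h2 h3 => Submodule.subset_span ⟨j, b, h1, h2, h3, rfl⟩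
    have hEL : ⁅E (i + (n + 1)), L⁆ ∈ S := by
      refine lie_mem_span ?_ _ ?_ ih
      · rintro _ ⟨j, b, h1, h2, h3, rfl⟩
        exact hS j b h1 (by omega) (by omega)
      · rintro _ ⟨j, b, h1, h2, h3, rfl⟩
        -- A lower-order term ending at the index i + n is prolonged by the new generator and stays
        -- shorter than the main term; one ending earlier commutes with it.
        rcases eq_or_ne (j + b) (i + n) with h4 | h4
        · rw [show i + (n + 1) = j + (b + 1) by omega]
          exact hS j (b + 1) h1 (by omega) (by omega)
        · rw [hE.far _ _ _ (by omega)]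
          exact S.zero_mem
    have e : nested Y i n = L + u • nested E i n := by rw [hL]; abel
    rw [nested, hY _ h, e, Finset.prod_range_succ, smul_lie', lie_add, lie_smul']
    have e2 : v (i + (n + 1)) • (⁅E (i + (n + 1)), L⁆ + (u • ⁅E (i + (n + 1)), nested E i n⁆ +
        E (i + (n + 1)) u • nested E i n)) - (L + u • nested E i n) (v (i + (n + 1))) •
        E (i + (n + 1)) - (u * v (i + (n + 1))) • nested E i (n + 1) =
        v (i + (n + 1)) • ⁅E (i + (n + 1)), L⁆ +
        (v (i + (n + 1)) * E (i + (n + 1)) u) • nested E i n -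
        (L + u • nested E i n) (v (i + (n + 1))) • nested E (i + (n + 1)) 0 := by
      simp only [nested]
      module
    rw [e2]
    exact S.sub_mem (S.add_mem (S.smul_mem _ hEL)
      (S.smul_mem _ (hS i n le_rfl (by omega) (by omega))))
      (S.smul_mem _ (hS _ 0 (by omega) (by omega) (by omega)))

/-- The change of family is triangular in the length, and its diagonal entries are products of the
invertible factors `v`, so it is inverted by strong induction on the length. -/
theorem span_nested_smul {E Y : ℕ → Derivation ℂ A A} (hE : ChainRelations E) {N : ℕ}
    (v d : ℕ → A) (hd : ∀ i, i ≤ N → d i * v i = 1)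
    (hY : ∀ i, i ≤ N → Y i = v i • E i) (hE0 : ∀ i, N < i → E i = 0)
    (hY0 : ∀ i, N < i → Y i = 0) :
    Submodule.span A (Set.range fun q : ℕ × ℕ => nested Y q.1 q.2) =
      Submodule.span A (Set.range fun q : ℕ × ℕ => nested E q.1 q.2) := by
  apply le_antisymm
  · rw [Submodule.span_le]
    rintro _ ⟨⟨i, n⟩, rfl⟩
    dsimp only
    rcases lt_or_ge N (i + n) with h | h
    · rw [nested_eq_zero hY0 h]; exact Submodule.zero_mem _
    · have h1 := nested_smul hE v hY i n h
      rw [← sub_add_cancel (nested Y i n)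
        ((∏ l ∈ Finset.range (n + 1), v (i + l)) • nested E i n)]
      refine Submodule.add_mem _ (Submodule.span_mono ?_ h1)
        (Submodule.smul_mem _ _ (Submodule.subset_span ⟨(i, n), rfl⟩))
      rintro _ ⟨j, b, -, -, -, rfl⟩
      exact ⟨(j, b), rfl⟩
  · rw [Submodule.span_le]
    rintro _ ⟨⟨i, n⟩, rfl⟩
    dsimp only
    induction n using Nat.strong_induction_on generalizing i with
    | _ n ih =>
    rcases lt_or_ge N (i + n) with h | h
    · rw [nested_eq_zero hE0 h]; exact Submodule.zero_mem _
    · have h1 := nested_smul hE v hY i n h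
      have h2 : (∏ l ∈ Finset.range (n + 1), d (i + l)) *
          (∏ l ∈ Finset.range (n + 1), v (i + l)) = 1 := by
        rw [← Finset.prod_mul_distrib]
        refine Finset.prod_eq_one fun l hl => hd _ ?_
        rw [Finset.mem_range] at hl
        omega
      have h3 : nested E i n = (∏ l ∈ Finset.range (n + 1), d (i + l)) • (nested Y i n -
          (nested Y i n - (∏ l ∈ Finset.range (n + 1), v (i + l)) • nested E i n)) := by
        rw [sub_sub_cancel, smul_smul, h2, one_smul]
      rw [h3]
      refine Submodule.smul_mem _ _ (Submodule.sub_mem _ (Submodule.subset_span ⟨(i, n), rfl⟩)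
        (Submodule.span_le.2 ?_ h1))
      rintro _ ⟨j, b, -, -, hb, rfl⟩
      exact ih b hb j

end Rinehart

end Chain

end

/-! ### Commutation relations of a cut-off chain. -/

noncomputable section

namespace Chain

variable {A : Type*} [CommRing A] [Algebra ℂ A] {N : ℕ}

local notation "C" => algebraMap ℂ A

theorem derivation_inv (X : Derivation ℂ A A) {d v : A} (h : d * v = 1) :
    X v = -(v ^ 2) * X d := by
  have h1 := congrArg X h
  rw [Derivation.leibniz, Derivation.map_one_eq_zero, smul_eq_mul, smul_eq_mul] at h1
  linear_combination v * h1 - X v * h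

/-- The total derivative, the characteristic operators and their action on the nodes
`w_0 = u_{-1}, w_1 = u_0, …, w_{N+2} = u_{N+1}` of a cut-off chain, on
`π_k = D w_k - ε_e r(w_k)` and on the inverses `v_k` of the differences `w_{k+1} - w_k`. -/
structure CutoffFields (A : Type*) [CommRing A] [Algebra ℂ A] (N : ℕ) where
  D : Derivation ℂ A A
  R : Derivation ℂ A A
  Y : ℕ → Derivation ℂ A A
  h : ℂ
  c₂ : ℂ
  c₃ : ℂ
  ee : ℂ
  ed : ℂ
  w : ℕ → A
  π : ℕ → A
  v : ℕ → A
  Vert : Derivation ℂ A A → Prop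
  vert_smul : ∀ (g : A) Z, Vert Z → Vert (g • Z)
  vert_add : ∀ X Z, Vert X → Vert Z → Vert (X + Z)
  vert_lie : ∀ X Z, Vert X → Vert Z → Vert ⁅X, Z⁆
  vert_lie_R : ∀ Z, Vert Z → Vert ⁅R, Z⁆
  vert_Y : ∀ i, Vert (Y i)
  vert_ext : ∀ (Z : Derivation ℂ A A) (m : A), Vert Z → ⁅D, Z⁆ = m • Z → (∀ k, k ≤ N → Z (w (k + 1)) = 0) → Z = 0
  Y_gt : ∀ i, N < i → Y i = 0
  Y_w : ∀ i k, i ≤ N → k ≤ N + 2 → Y i (w k) = if k = i + 1 then 1 else 0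
  Y_π : ∀ i k, i ≤ N → k ≤ N + 2 → Y i (π k) = if k = i + 1 then (v i - v (i + 1)) * π k else 0
  D_w : ∀ k, k ≤ N + 2 → D (w k) =
    π k + algebraMap ℂ A ee * (algebraMap ℂ A h * w k ^ 2 + algebraMap ℂ A c₂ * w k +
      algebraMap ℂ A c₃)
  R_w : ∀ k, k ≤ N + 2 → R (w k) =
    algebraMap ℂ A ed * (algebraMap ℂ A h * w k ^ 2 + algebraMap ℂ A c₂ * w k + algebraMap ℂ A c₃)
  lie_D_R : ⁅D, R⁆ = 0
  lie_D_Y : ∀ i, i ≤ N → ⁅D, Y i⁆ = -((v i - v (i + 1)) * π (i + 1) +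
    algebraMap ℂ A ee * (2 * algebraMap ℂ A h * w (i + 1) + algebraMap ℂ A c₂)) • Y i
  π_zero : π 0 = 0
  d_mul_v : ∀ k, k ≤ N + 1 → (w (k + 1) - w k) * v k = 1

namespace CutoffFields

variable (S : CutoffFields A N)

/-- The differences of the nodes. -/
def d (k : ℕ) : A := S.w (k + 1) - S.w k

/-- The quotients `π_k / d_k`. -/
def p (k : ℕ) : A := S.π k * S.v k

/-- The normalized generators. -/
def E (i : ℕ) : Derivation ℂ A A := S.d i • S.Y i

/-- The multipliers of the normalized generators: `[D, E_i] = m_i E_i`. -/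
def m (i : ℕ) : A := S.p (i + 1) - S.p i - C S.ee * C S.h * S.d i

theorem d_v {k : ℕ} (hk : k ≤ N + 1) : S.d k * S.v k = 1 := S.d_mul_v k hk

theorem π_eq {k : ℕ} (hk : k ≤ N + 1) : S.π k = S.p k * S.d k := by
  rw [p]
  linear_combination -S.π k * S.d_v hk

theorem E_gt {i : ℕ} (hi : N < i) : S.E i = 0 := by rw [E, S.Y_gt i hi, smul_zero]

theorem vert_E (i : ℕ) : S.Vert (S.E i) := S.vert_smul _ _ (S.vert_Y i)

theorem vert_sub {X Z : Derivation ℂ A A} (hX : S.Vert X) (hZ : S.Vert Z) : S.Vert (X - Z) := by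
  have := S.vert_add _ _ hX (S.vert_smul (-1) _ hZ)
  rwa [neg_one_smul, ← sub_eq_add_neg] at this

theorem E_w {i k : ℕ} (hi : i ≤ N) (hk : k ≤ N + 2) :
    S.E i (S.w k) = if k = i + 1 then S.d i else 0 := by
  rw [E, Derivation.smul_apply, S.Y_w i k hi hk]
  split_ifs <;> simp

theorem E_d {i k : ℕ} (hi : i ≤ N) (hk : k ≤ N + 1) :
    S.E i (S.d k) = if k = i then S.d i else if k = i + 1 then -S.d i else 0 := by
  rw [d, map_sub, S.E_w hi (by omega), S.E_w hi (by omega)]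
  rcases eq_or_ne k i with h | h
  · subst h; simp [d]
  · have h' : k + 1 ≠ i + 1 := by omega
    simp only [h', h, if_false]
    split_ifs <;> simp [d]

/-- The normalization by d_i makes the weights constant. On π_{i+1} the weight is 1 - d_i v_{i+1},
on v_{i+1} it is d_i v_{i+1}, in total 1; on p_i only v_i contributes, with weight -1. -/
theorem E_p {i k : ℕ} (hi : i ≤ N) (hk : k ≤ N + 1) :
    S.E i (S.p k) = if k = i + 1 then S.p k else if k = i then -S.p k else 0 := by
  have hv := derivation_inv (S.E i) (S.d_v hk)
  rw [S.E_d hi hk] at hv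
  have hπ : S.E i (S.π k) = if k = i + 1 then S.d i * (S.v i - S.v (i + 1)) * S.π k else 0 := by
    rw [E, Derivation.smul_apply, S.Y_π i k hi (by omega)]
    split_ifs <;> simp [mul_assoc]
  rw [p, Derivation.leibniz, hv, hπ]
  have h1 := S.d_v hk
  have h2 : S.d i * S.v i = 1 := S.d_v (by omega)
  rcases eq_or_ne k i with h | h
  · subst h
    simp only [smul_eq_mul, if_true, if_neg (Nat.ne_of_lt (Nat.lt_succ_self k))]
    linear_combination (-S.π k * S.v k) * h1
  · rcases eq_or_ne k (i + 1) with h' | h'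
    · subst h'
      simp only [smul_eq_mul, if_true, h, if_false]
      linear_combination (S.π (i + 1) * S.v (i + 1)) * h2
    · simp [h, h']

theorem D_d {k : ℕ} (hk : k ≤ N + 1) : S.D (S.d k) = S.π (k + 1) - S.π k +
    C S.ee * (C S.h * (S.w (k + 1) + S.w k) + C S.c₂) * S.d k := by
  rw [d, map_sub, S.D_w _ (by omega), S.D_w _ (by omega)]
  ring

theorem lie_D_E {i : ℕ} (hi : i ≤ N) : ⁅S.D, S.E i⁆ = S.m i • S.E i := by
  rw [E, lie_smul', S.lie_D_Y i hi, S.D_d (by omega), smul_smul, smul_smul, ← add_smul]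
  congr 1
  rw [m, p, p]
  have h2 : S.d i * S.v i = 1 := S.d_v (by omega)
  have h3 : S.d i = S.w (i + 1) - S.w i := rfl
  linear_combination (-S.π (i + 1) + S.π i) * h2 + (C S.ee * C S.h * S.d i) * h3

/-- Multipliers add under commutators, up to corrections from differentiating them. This supplies
the D-hypothesis of `vert_ext` in the proofs of the relations. -/
theorem lie_D_lie {X Z : Derivation ℂ A A} {m n : A} (hX : ⁅S.D, X⁆ = m • X)
    (hZ : ⁅S.D, Z⁆ = n • Z) : ⁅S.D, ⁅X, Z⁆⁆ = (m + n) • ⁅X, Z⁆ + X n • Z - Z m • X := by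
  rw [leibniz_lie, hX, hZ, smul_lie', lie_smul']
  module

theorem map_const (X : Derivation ℂ A A) (z : ℂ) : X (C z) = 0 := X.map_algebraMap z

theorem E_m (i j : ℕ) : S.E i (S.m j) =
    S.E i (S.p (j + 1)) - S.E i (S.p j) - C S.ee * C S.h * S.E i (S.d j) := by
  simp only [m, map_sub, Derivation.leibniz, map_const, smul_eq_mul]
  ring

theorem E_m_self {i : ℕ} (hi : i ≤ N) : S.E i (S.m i) =
    S.p (i + 1) + S.p i - C S.ee * C S.h * S.d i := by
  rw [S.E_m, S.E_p hi (by omega), S.E_p hi (by omega), S.E_d hi (by omega)]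
  simp

theorem E_m_succ {i : ℕ} (hi : i + 1 ≤ N) : S.E i (S.m (i + 1)) =
    -S.p (i + 1) + C S.ee * C S.h * S.d i := by
  rw [S.E_m, S.E_p (by omega) (by omega), S.E_p (by omega) (by omega),
    S.E_d (by omega) (by omega)]
  simp [show ¬i + 1 + 1 = i by omega]

theorem E_succ_m {i : ℕ} (hi : i + 1 ≤ N) : S.E (i + 1) (S.m i) = -S.p (i + 1) := by
  rw [S.E_m, S.E_p hi (by omega), S.E_p hi (by omega),
    S.E_d hi (by omega)]
  simp [show ¬i = i + 1 + 1 by omega]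

theorem lie_E_comm {i j : ℕ} (hij : i + 2 ≤ j) : ⁅S.E i, S.E j⁆ = 0 := by
  rcases lt_or_ge N j with hj | hj
  · rw [S.E_gt hj, lie_zero]
  have h1 : S.E i (S.m j) = 0 := by
    rw [S.E_m, S.E_p (by omega) (by omega), S.E_p (by omega) (by omega),
      S.E_d (by omega) (by omega)]
    simp [show j ≠ i by omega, show j ≠ i + 1 by omega, show j + 1 ≠ i by omega]
  have h2 : S.E j (S.m i) = 0 := by
    rw [S.E_m, S.E_p hj (by omega), S.E_p hj (by omega),
      S.E_d hj (by omega)]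
    simp [show i ≠ j by omega, show i ≠ j + 1 by omega, show i + 1 ≠ j by omega]
  refine S.vert_ext _ (S.m i + S.m j) (S.vert_lie _ _ (S.vert_E i) (S.vert_E j)) ?_ ?_
  · rw [S.lie_D_lie (S.lie_D_E (by omega)) (S.lie_D_E hj), h1, h2]
    module
  · intro k hk
    rw [lie_apply, S.E_w hj (by omega), S.E_w (by omega) (by omega)]
    rw [apply_ite (S.E i), apply_ite (S.E j), S.E_d (by omega) (by omega), S.E_d hj (by omega)]
    simp [show j ≠ i by omega, show j ≠ i + 1 by omega, show i ≠ j by omega,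
      show i ≠ j + 1 by omega]

section Serre

variable {i : ℕ} (hi : i + 1 ≤ N)
include hi

theorem lie_E_succ_w {k : ℕ} (hk : k ≤ N + 2) :
    ⁅S.E i, S.E (i + 1)⁆ (S.w k) = if k = i + 2 then -S.d i else 0 := by
  rw [lie_apply, S.E_w hi hk, S.E_w (by omega) hk, apply_ite (S.E i), apply_ite (S.E (i + 1)),
    S.E_d hi (by omega), S.E_d (by omega) (by omega)]
  simp [show ¬i = i + 1 + 1 by omega]

theorem lie_D_lie_E_succ : ⁅S.D, ⁅S.E i, S.E (i + 1)⁆⁆ =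
    (S.m i + S.m (i + 1)) • ⁅S.E i, S.E (i + 1)⁆ +
    (-S.p (i + 1) + C S.ee * C S.h * S.d i) • S.E (i + 1) + S.p (i + 1) • S.E i := by
  rw [S.lie_D_lie (S.lie_D_E (by omega)) (S.lie_D_E hi), S.E_m_succ hi, S.E_succ_m hi]
  module

theorem E_p_succ : S.E i (S.p (i + 1)) = S.p (i + 1) := by
  rw [S.E_p (by omega) (by omega)]; simp

theorem E_succ_p_succ : S.E (i + 1) (S.p (i + 1)) = -S.p (i + 1) := by
  rw [S.E_p (by omega) (by omega)]; simp

theorem lie_left : ⁅S.E i, ⁅S.E i, S.E (i + 1)⁆⁆ = ⁅S.E i, S.E (i + 1)⁆ := by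
  rw [← sub_eq_zero]
  have hV : S.Vert ⁅S.E i, S.E (i + 1)⁆ := S.vert_lie _ _ (S.vert_E _) (S.vert_E _)
  -- Two factors E_i and one E_{i+1} have this total multiplier. The correction terms of the triple
  -- and of the double commutator compensate only because of the weights on p and d.
  refine S.vert_ext _ (2 * S.m i + S.m (i + 1))
    (S.vert_sub (S.vert_lie _ _ (S.vert_E i) hV) hV) ?_ ?_
  · have hVm : ⁅S.E i, S.E (i + 1)⁆ (S.m i) = 0 := by
      rw [lie_apply, S.E_succ_m hi, S.E_m_self (by omega)]
      simp only [map_neg, map_sub, map_add, Derivation.leibniz, map_const, S.E_p_succ hi,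
        S.E_succ_p_succ hi]
      rw [S.E_p hi (by omega), S.E_d hi (by omega)]
      simp [show ¬i = i + 1 + 1 by omega]
    have hEd : S.E i (S.d i) = S.d i := by rw [S.E_d (by omega) (by omega)]; simp
    rw [lie_sub, leibniz_lie, S.lie_D_E (by omega), smul_lie', hVm, S.lie_D_lie_E_succ hi]
    simp only [lie_add, lie_smul', map_add, map_neg, Derivation.leibniz, map_const, hEd,
      S.E_p_succ hi, S.E_m_self (show i ≤ N by omega), S.E_m_succ hi, lie_self, smul_eq_mul]
    rw [m, m]
    module
  · intro k hk
    rw [Derivation.sub_apply, lie_apply, S.lie_E_succ_w hi (by omega), S.E_w (by omega) (by omega),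
      apply_ite (S.E i), apply_ite (⁅S.E i, S.E (i + 1)⁆ : Derivation ℂ A A), d, map_neg, map_sub, map_sub,
      S.lie_E_succ_w hi (by omega), S.lie_E_succ_w hi (by omega), ← map_sub, ← d,
      S.E_d (by omega) (by omega)]
    simp

theorem lie_right : ⁅S.E (i + 1), ⁅S.E i, S.E (i + 1)⁆⁆ = -⁅S.E i, S.E (i + 1)⁆ := by
  rw [← add_eq_zero_iff_eq_neg]
  have hV : S.Vert ⁅S.E i, S.E (i + 1)⁆ := S.vert_lie _ _ (S.vert_E _) (S.vert_E _)
  refine S.vert_ext _ (S.m i + 2 * S.m (i + 1))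
    (S.vert_add _ _ (S.vert_lie _ _ (S.vert_E _) hV) hV) ?_ ?_
  · have hVm : ⁅S.E i, S.E (i + 1)⁆ (S.m (i + 1)) = C S.ee * C S.h * S.d i := by
      rw [lie_apply, S.E_m_succ hi, S.E_m_self hi]
      simp only [map_neg, map_sub, map_add, Derivation.leibniz, map_const, S.E_p_succ hi,
        S.E_succ_p_succ hi, smul_eq_mul]
      rw [S.E_p (by omega) (by omega), S.E_d hi (by omega), S.E_d (by omega) (by omega)]
      simp [show ¬i = i + 1 + 1 by omega, show ¬i + 1 + 1 = i by omega]
    have hEd : S.E (i + 1) (S.d i) = 0 := by rw [S.E_d (by omega) (by omega)]; simp [show ¬i = i + 1 + 1 by omega]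
    rw [lie_add, leibniz_lie, S.lie_D_E hi, smul_lie', hVm, S.lie_D_lie_E_succ hi]
    simp only [lie_add, lie_smul', map_add, map_neg, Derivation.leibniz, map_const, hEd,
      S.E_succ_p_succ hi, S.E_m_self hi, S.E_succ_m hi, lie_self, smul_eq_mul]
    rw [← lie_skew (S.E i) (S.E (i + 1)), m, m]
    module
  · intro k hk
    have h1 : S.E (i + 1) (S.d i) = 0 := by
      rw [S.E_d (by omega) (by omega)]; simp [show ¬i = i + 1 + 1 by omega]
    have h2 : ⁅S.E i, S.E (i + 1)⁆ (S.d (i + 1)) = -S.d i := by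
      rw [d, map_sub, S.lie_E_succ_w hi (by omega), S.lie_E_succ_w hi (by omega)]
      simp
    rw [Derivation.add_apply, lie_apply, S.lie_E_succ_w hi (by omega), S.E_w (by omega) (by omega)]
    by_cases h : k = i + 1 <;> simp [h, h1, h2]

end Serre

theorem relations : ChainRelations S.E where
  comm _ _ h := S.lie_E_comm h
  left i := by
    rcases lt_or_ge N (i + 1) with h | h
    · rw [S.E_gt h, lie_zero, lie_zero]
    · exact S.lie_left h
  right i := by
    rcases lt_or_ge N (i + 1) with h | h
    · rw [S.E_gt h, lie_zero, lie_zero, neg_zero]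
    · exact S.lie_right h

theorem R_d {k : ℕ} (hk : k ≤ N + 1) : S.R (S.d k) =
    C S.ed * (C S.h * (S.w (k + 1) + S.w k) + C S.c₂) * S.d k := by
  rw [d, map_sub, S.R_w _ (by omega), S.R_w _ (by omega)]
  ring

/-- Obtained by applying [D, R] = 0 to w_k, since D w_k = π_k + ε_e r(w_k) and R w_k = ε_d r(w_k).
-/
theorem R_π {k : ℕ} (hk : k ≤ N + 2) : S.R (S.π k) =
    C S.ed * (2 * C S.h * S.w k + C S.c₂) * S.π k := by
  have h1 := congrArg (fun X : Derivation ℂ A A => X (S.w k)) S.lie_D_R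
  simp only [lie_apply, Derivation.zero_apply, S.R_w k hk] at h1
  rw [S.D_w k hk] at h1
  simp only [map_add, Derivation.leibniz, Derivation.leibniz_pow, map_const, S.R_w k hk,
    S.D_w k hk, smul_eq_mul, nsmul_eq_mul] at h1
  push_cast at h1
  linear_combination -h1

theorem R_p {k : ℕ} (hk : k ≤ N + 1) : S.R (S.p k) = -(C S.ed * C S.h * S.d k) * S.p k := by
  rw [p, Derivation.leibniz, S.R_π (by omega), derivation_inv S.R (S.d_v hk), S.R_d hk]
  have h2 := S.d_v hk
  have h3 : S.d k = S.w (k + 1) - S.w k := rfl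
  simp only [smul_eq_mul]
  linear_combination (-S.π k * S.v k * C S.ed * (C S.h * (S.w (k + 1) + S.w k) + C S.c₂)) * h2 +
    (C S.ed * C S.h * S.π k * S.v k) * h3

theorem lie_R_E (i : ℕ) : ⁅S.R, S.E i⁆ = -(C S.ed * C S.h * S.d i) • S.E i := by
  rcases lt_or_ge N i with hi | hi
  · rw [S.E_gt hi, lie_zero, smul_zero]
  rw [← sub_eq_zero]
  refine S.vert_ext _ (S.m i) (S.vert_sub (S.vert_lie_R _ (S.vert_E i))
    (S.vert_smul _ _ (S.vert_E i))) ?_ ?_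
  · rw [lie_sub, leibniz_lie, S.lie_D_R, zero_lie, zero_add, S.lie_D_E hi, lie_smul', lie_smul',
      S.lie_D_E hi]
    -- With λ the proposed factor, both [R, E_i] and λ E_i have multiplier m_i under D, up to the
    -- corrections R(m_i) E_i and D(λ) E_i; this equality makes them cancel in the difference.
    have h1 : S.R (S.m i) = S.D (-(C S.ed * C S.h * S.d i)) := by
      simp only [m, map_sub, map_neg, Derivation.leibniz, map_const, smul_eq_mul,
        S.R_p (show i + 1 ≤ N + 1 by omega), S.R_p (show i ≤ N + 1 by omega),
        S.R_d (show i ≤ N + 1 by omega), S.D_d (show i ≤ N + 1 by omega),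
        S.π_eq (show i + 1 ≤ N + 1 by omega), S.π_eq (show i ≤ N + 1 by omega)]
      ring
    rw [h1]
    module
  · intro k hk
    rw [Derivation.sub_apply, Derivation.smul_apply, lie_apply, S.E_w hi (by omega),
      S.R_w _ (by omega), apply_ite S.R, S.R_d (by omega)]
    simp only [map_add, Derivation.leibniz, Derivation.leibniz_pow, map_const,
      S.E_w hi (show k + 1 ≤ N + 2 by omega), smul_eq_mul, nsmul_eq_mul]
    have h3 : S.d i = S.w (i + 1) - S.w i := rfl
    split_ifs with h
    · rw [h]
      push_cast
      linear_combination (C S.ed * C S.h * S.d i) * h3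
    · simp

/-- The normalized nested commutators. -/
def F (i n : ℕ) : Derivation ℂ A A := nested S.E i n

theorem span_closed {X Z : Derivation ℂ A A}
    (hX : X ∈ Submodule.span A (insert S.R (Set.range fun q : ℕ × ℕ => S.F q.1 q.2)))
    (hZ : Z ∈ Submodule.span A (insert S.R (Set.range fun q : ℕ × ℕ => S.F q.1 q.2))) :
    ⁅X, Z⁆ ∈ Submodule.span A (insert S.R (Set.range fun q : ℕ × ℕ => S.F q.1 q.2)) :=
  span_nested_closed S.relations S.R _ S.lie_R_E hX hZ

theorem span_nested_Y :
    Submodule.span A (Set.range fun q : ℕ × ℕ => nested S.Y q.1 q.2) =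
      Submodule.span A (Set.range fun q : ℕ × ℕ => S.F q.1 q.2) :=
  span_nested_smul S.relations (N := N) S.v S.d (fun i hi => S.d_v (by omega))
    (fun i hi => by rw [E, smul_smul, mul_comm, S.d_v (by omega), one_smul])
    (fun _ => S.E_gt) S.Y_gt

end CutoffFields

end Chain

end

/-! ### Linear independence of the nested commutators. -/

noncomputable section

namespace Chain

variable {A : Type*} [CommRing A] [Algebra ℂ A] {N : ℕ}

local notation "C" => algebraMap ℂ A

theorem sum_derivation_apply {ι : Type*} (s : Finset ι) (X : ι → Derivation ℂ A A) (g : A) :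
    (∑ i ∈ s, X i) g = ∑ i ∈ s, X i g := by
  rw [← Derivation.coeFnAddMonoidHom_apply, map_sum, Finset.sum_apply]
  rfl

theorem lie_sum_smul {ι : Type*} (s : Finset ι) (D : Derivation ℂ A A) (c : ι → A)
    (X : ι → Derivation ℂ A A) :
    ⁅D, ∑ i ∈ s, c i • X i⁆ = ∑ i ∈ s, (D (c i) • X i + c i • ⁅D, X i⁆) := by
  rw [lie_sum]
  exact Finset.sum_congr rfl fun i _ => by rw [lie_smul', add_comm]

namespace CutoffFields

variable (S : CutoffFields A N)

theorem F_succ (i n : ℕ) : S.F i (n + 1) = ⁅S.E (i + (n + 1)), S.F i n⁆ := rfl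

theorem F_w {i n k : ℕ} (hi : i + n ≤ N) (hk : k ≤ N + 2) :
    S.F i n (S.w k) = if k = i + n + 1 then S.d i else 0 := by
  induction n generalizing k with
  | zero => exact S.E_w hi hk
  | succ n ih =>
    have h1 : S.F i n (S.d (i + (n + 1))) = -S.d i := by
      rw [d, map_sub, ih (by omega) (by omega), ih (by omega) (by omega)]
      simp [show i + (n + 1) = i + n + 1 by omega]
    have h2 : S.E (i + (n + 1)) (S.d i) = 0 := by
      rw [S.E_d hi (by omega)]
      simp [show ¬i = i + (n + 1) + 1 by omega]
    rw [F_succ, lie_apply, ih (by omega) hk, S.E_w hi hk]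
    rcases eq_or_ne k (i + (n + 1) + 1) with h | h
    · subst h; simp [h1]
    · rw [if_neg h, if_neg h, map_zero, sub_zero]
      split_ifs
      · exact h2
      · exact map_zero _

theorem F_d {i n : ℕ} (hi : i + (n + 1) ≤ N) : S.F i n (S.d (i + (n + 1))) = -S.d i := by
  rw [d, map_sub, S.F_w (by omega) (by omega), S.F_w (by omega) (by omega)]
  simp [show i + (n + 1) = i + n + 1 by omega]

/-- The generators act on each p_k by constant weights, so their actions on p_k commute and every
genuine commutator kills it. -/
theorem F_p {i n k : ℕ} (hi : i + (n + 1) ≤ N) (hk : k ≤ N + 1) :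
    S.F i (n + 1) (S.p k) = 0 := by
  induction n with
  | zero =>
    rw [F_succ, lie_apply]
    change S.E _ (S.E i _) - S.E i (S.E _ _) = 0
    rw [S.E_p (by omega) hk, S.E_p hi hk]
    simp only [apply_ite (S.E i), apply_ite (S.E (i + (0 + 1))), map_neg, map_zero,
      S.E_p (show i ≤ N by omega) hk, S.E_p hi hk]
    split_ifs <;> simp
  | succ n ih =>
    rw [F_succ, lie_apply, ih (by omega), S.E_p hi hk]
    simp only [apply_ite (S.F i (n + 1)), map_neg, map_zero, ih (show i + (n + 1) ≤ N by omega)]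
    simp

/-- The commutators of the total derivative with the normalized nested commutators. -/
theorem lie_D_F_succ {i n : ℕ} (hi : i + (n + 1) ≤ N) : ⁅S.D, S.F i (n + 1)⁆ =
    (S.p (i + (n + 1) + 1) - S.p i - C S.ee * C S.h * (S.w (i + (n + 1) + 1) - S.w i)) •
      S.F i (n + 1) + S.p (i + 1) • S.F (i + 1) n - S.p (i + (n + 1)) • S.F i n -
      (C S.ee * C S.h * S.d i) • ∑ l ∈ Finset.range (n + 1), S.F (i + 1 + l) (n - l) := by
  have hm : ∀ n, i + (n + 1) ≤ N → S.F i n (S.m (i + (n + 1))) =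
      (if n = 0 then -S.p (i + 1) else 0) + C S.ee * C S.h * S.d i := fun n hn => by
    have h1 : ∀ k, k ≤ N + 1 → i + n + 1 ≤ k → S.F i n (S.p k) =
        if n = 0 ∧ k = i + 1 then S.p k else 0 := fun k hk hk2 => by
      cases n with
      | zero =>
        refine (S.E_p (by omega) hk).trans ?_
        simp [show ¬k = i by omega]
      | succ n => rw [S.F_p (by omega) hk]; simp
    simp only [m, map_sub, Derivation.leibniz, map_const, S.F_d hn,
      h1 _ (show i + (n + 1) + 1 ≤ N + 1 by omega) (by omega),
      h1 _ (show i + (n + 1) ≤ N + 1 by omega) (by omega), smul_eq_mul]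
    by_cases h : n = 0
    · subst h; simp
    · simp [h]
  have hF : ∀ n, i + (n + 1) ≤ N → ⁅S.D, S.F i (n + 1)⁆ =
      S.m (i + (n + 1)) • S.F i (n + 1) - ((if n = 0 then -S.p (i + 1) else 0) +
        C S.ee * C S.h * S.d i) • S.E (i + (n + 1)) + ⁅S.E (i + (n + 1)), ⁅S.D, S.F i n⁆⁆ :=
    fun n hn => by
      rw [F_succ, leibniz_lie, S.lie_D_E hn, smul_lie', hm n hn]
  have hw : ∀ k, S.d k = S.w (k + 1) - S.w k := fun k => rfl
  have hF0 : ∀ i, S.F i 0 = S.E i := fun i => rfl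
  induction n with
  | zero =>
    rw [hF 0 hi, hF0, S.lie_D_E (by omega), lie_smul', zero_add, S.E_succ_m hi]
    have h1 : ⁅S.E (i + 1), S.E i⁆ = S.F i 1 := rfl
    rw [h1, m, m, hw (i + 1), hw i]
    simp only [Finset.range_one, Finset.sum_singleton, add_zero, hF0, Nat.sub_zero, if_true]
    module
  | succ n ih =>
    have hE : ∀ k, k ≤ N + 1 → S.E (i + (n + 1 + 1)) (S.p k) = if k = i + (n + 1 + 1) + 1
      then S.p k else if k = i + (n + 1 + 1) then -S.p k else 0 := fun k hk => S.E_p hi hk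
    have hEd : S.E (i + (n + 1 + 1)) (S.d i) = 0 := by
      rw [S.E_d hi (by omega)]
      simp [show ¬i = i + (n + 1 + 1) + 1 by omega]
    have hEw : ∀ k, k ≤ i + (n + 1) + 1 → S.E (i + (n + 1 + 1)) (S.w k) = 0 := fun k hk => by
      rw [S.E_w hi (by omega), if_neg (by omega)]
    have hsum : ⁅S.E (i + (n + 1 + 1)), ∑ l ∈ Finset.range (n + 1), S.F (i + 1 + l) (n - l)⁆ =
        ∑ l ∈ Finset.range (n + 1), S.F (i + 1 + l) (n + 1 - l) := by
      rw [lie_sum]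
      refine Finset.sum_congr rfl fun l hl => ?_
      rw [Finset.mem_range] at hl
      rw [show n + 1 - l = n - l + 1 by omega, F_succ,
        show i + 1 + l + (n - l + 1) = i + (n + 1 + 1) by omega]
    have h1 : ⁅S.E (i + (n + 1 + 1)), S.F i (n + 1)⁆ = S.F i (n + 1 + 1) := rfl
    have h2 : ⁅S.E (i + (n + 1 + 1)), S.F (i + 1) n⁆ = S.F (i + 1) (n + 1) := by
      rw [F_succ, show i + 1 + (n + 1) = i + (n + 1 + 1) by omega]
    have h3 : ⁅S.E (i + (n + 1 + 1)), S.F i n⁆ = 0 :=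
      S.relations.far i n _ (by omega)
    rw [hF (n + 1) hi, ih (by omega), lie_sub, lie_sub, lie_add, lie_smul', lie_smul', lie_smul',
      lie_smul', hsum, h1, h2, h3, Finset.sum_range_succ _ (n + 1)]
    simp only [map_sub, Derivation.leibniz, map_const, hEd, hEw i (by omega),
      hEw (i + (n + 1) + 1) (by omega), hE i (by omega), hE (i + 1) (by omega),
      hE (i + (n + 1)) (by omega), hE (i + (n + 1) + 1) (by omega)]
    rw [m, hw, Nat.sub_self, hF0, show i + 1 + (n + 1) = i + (n + 1 + 1) by omega,
      show i + (n + 1) + 1 = i + (n + 1 + 1) by omega]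
    simp [show ¬i = i + (n + 1 + 1) + 1 by omega,
      show ¬i + (n + 1) = i + (n + 1 + 1) + 1 by omega]
    module

/-- The nested commutator with the end points `i ≤ j`. -/
def G (i j : ℕ) : Derivation ℂ A A := S.F i (j - i)

theorem lie_D_G {i j : ℕ} (hij : i ≤ j) (hj : j ≤ N) : ⁅S.D, S.G i j⁆ =
    (S.p (j + 1) - S.p i - C S.ee * C S.h * (S.w (j + 1) - S.w i)) • S.G i j +
      (if i < j then S.p (i + 1) • S.G (i + 1) j else 0) -
      (if i < j then S.p j • S.G i (j - 1) else 0) -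
      (C S.ee * C S.h * S.d i) • ∑ l ∈ Finset.Ioc i j, S.G l j := by
  rcases hij.eq_or_lt with rfl | h
  · rw [G, Nat.sub_self]
    refine (S.lie_D_E hj).trans ?_
    simp only [lt_irrefl, if_false, Finset.Ioc_self, Finset.sum_empty, smul_zero, sub_zero,
      add_zero]
    rfl
  · obtain ⟨n, rfl⟩ : ∃ n, j = i + (n + 1) := ⟨j - i - 1, by omega⟩
    rw [if_pos h, if_pos h]
    simp only [G]
    have hs : ∑ l ∈ Finset.range (n + 1), S.F (i + 1 + l) (n - l) =
        ∑ l ∈ Finset.Ioc i (i + (n + 1)), S.F l (i + (n + 1) - l) := by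
      rw [← Finset.Ico_add_one_add_one_eq_Ioc, Finset.sum_Ico_eq_sum_range]
      rw [show i + (n + 1) + 1 - (i + 1) = n + 1 by omega]
      refine Finset.sum_congr rfl fun l _ => ?_
      rw [show i + (n + 1) - (i + 1 + l) = n - l by omega]
    rw [show i + (n + 1) - i = n + 1 by omega, S.lie_D_F_succ hj, hs,
      show i + (n + 1) - (i + 1) = n by omega, show i + (n + 1) - 1 - i = n by omega]

/-- Linear combinations of the nested commutators. -/
def comb (c : ℕ → ℕ → A) : Derivation ℂ A A :=
  ∑ j ∈ Finset.range (N + 1), ∑ i ∈ Finset.range (j + 1), c i j • S.G i j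

/-- The coefficients of the commutator of the total derivative with a linear combination. -/
def nabla (c : ℕ → ℕ → A) (i j : ℕ) : A :=
  S.D (c i j) + c i j * (S.p (j + 1) - S.p i - C S.ee * C S.h * (S.w (j + 1) - S.w i)) +
    (if 1 ≤ i then c (i - 1) j * S.p i else 0) -
    (if j + 1 ≤ N then c i (j + 1) * S.p (j + 1) else 0) -
    C S.ee * C S.h * ∑ l ∈ Finset.range i, c l j * S.d l

/-- Only a reindexing of `lie_D_G`. It turns a linear relation into another one, in which the
diagonal j - i = s involves the coefficients c from the diagonal s + 1. -/
theorem lie_D_comb (c : ℕ → ℕ → A) : ⁅S.D, S.comb c⁆ = S.comb (S.nabla c) := by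
  have e1 : ∀ j, ∑ i ∈ Finset.range (j + 1),
      c i j • (if i < j then S.p (i + 1) • S.G (i + 1) j else 0) =
      ∑ i ∈ Finset.range (j + 1), (if 1 ≤ i then c (i - 1) j * S.p i else 0) • S.G i j := by
    intro j
    rw [Finset.sum_range_succ, Finset.sum_range_succ' (n := j)]
    simp only [lt_irrefl, if_false, smul_zero, add_zero, Nat.le_add_left, if_true,
      Nat.add_sub_cancel, nonpos_iff_eq_zero, one_ne_zero, zero_smul]
    refine Finset.sum_congr rfl fun i hi => ?_
    rw [if_pos (Finset.mem_range.1 hi), smul_smul]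
  have e2 : ∑ j ∈ Finset.range (N + 1), ∑ i ∈ Finset.range (j + 1),
      c i j • (if i < j then S.p j • S.G i (j - 1) else 0) =
      ∑ j ∈ Finset.range (N + 1), ∑ i ∈ Finset.range (j + 1),
        (if j + 1 ≤ N then c i (j + 1) * S.p (j + 1) else 0) • S.G i j := by
    rw [Finset.sum_range_succ', Finset.sum_range_succ (n := N)]
    simp only [zero_add, Finset.range_one, Finset.sum_singleton, lt_irrefl, if_false, smul_zero,
      add_zero, Nat.add_sub_cancel, add_le_iff_nonpos_right, nonpos_iff_eq_zero, one_ne_zero,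
      zero_smul, Finset.sum_const_zero]
    refine Finset.sum_congr rfl fun j hj => ?_
    rw [Finset.sum_range_succ]
    simp only [lt_irrefl, if_false, smul_zero, add_zero]
    refine Finset.sum_congr rfl fun i hi => ?_
    rw [if_pos (Finset.mem_range.1 hi), if_pos (Nat.succ_le_of_lt (Finset.mem_range.1 hj)),
      smul_smul]
  have e3 : ∀ j, ∑ i ∈ Finset.range (j + 1),
      c i j • ((C S.ee * C S.h * S.d i) • ∑ l ∈ Finset.Ioc i j, S.G l j) =
      ∑ i ∈ Finset.range (j + 1),
        (C S.ee * C S.h * ∑ l ∈ Finset.range i, c l j * S.d l) • S.G i j := by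
    intro j
    simp only [Finset.smul_sum, Finset.mul_sum, Finset.sum_smul]
    rw [Finset.sum_comm' (t' := Finset.range (j + 1)) (s' := fun l => Finset.range l)]
    · refine Finset.sum_congr rfl fun i _ => Finset.sum_congr rfl fun l _ => ?_
      rw [smul_smul]
      congr 1
      ring
    · intro i l
      simp only [Finset.mem_range, Finset.mem_Ioc]
      omega
  have h1 : ⁅S.D, S.comb c⁆ = ∑ j ∈ Finset.range (N + 1), ∑ i ∈ Finset.range (j + 1),
      ((S.D (c i j) + c i j *
        (S.p (j + 1) - S.p i - C S.ee * C S.h * (S.w (j + 1) - S.w i))) • S.G i j +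
      c i j • (if i < j then S.p (i + 1) • S.G (i + 1) j else 0) -
      c i j • (if i < j then S.p j • S.G i (j - 1) else 0) -
      c i j • ((C S.ee * C S.h * S.d i) • ∑ l ∈ Finset.Ioc i j, S.G l j)) := by
    rw [comb, lie_sum]
    refine Finset.sum_congr rfl fun j hj => ?_
    rw [lie_sum_smul]
    refine Finset.sum_congr rfl fun i hi => ?_
    rw [S.lie_D_G (Nat.lt_succ_iff.1 (Finset.mem_range.1 hi))
      (Nat.lt_succ_iff.1 (Finset.mem_range.1 hj))]
    module
  rw [h1]
  simp only [Finset.sum_sub_distrib, Finset.sum_add_distrib]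
  rw [e2]
  simp only [e1, e3]
  simp only [← Finset.sum_sub_distrib, ← Finset.sum_add_distrib, ← sub_smul, ← add_smul]
  rfl

/-- A nested commutator moves only the node that follows its last index, so only those ending at j
contribute. -/
theorem comb_w (c : ℕ → ℕ → A) {j : ℕ} (hj : j ≤ N) :
    S.comb c (S.w (j + 1)) = ∑ i ∈ Finset.range (j + 1), c i j * S.d i := by
  rw [comb, sum_derivation_apply, Finset.sum_eq_single j]
  · rw [sum_derivation_apply]
    refine Finset.sum_congr rfl fun i hi => ?_
    have := Nat.lt_succ_iff.1 (Finset.mem_range.1 hi)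
    rw [Derivation.smul_apply, G, S.F_w (by omega) (by omega), if_pos (by omega), smul_eq_mul]
  · intro k hk hkj
    rw [sum_derivation_apply]
    refine Finset.sum_eq_zero fun i hi => ?_
    rw [Finset.mem_range] at hi hk
    rw [Derivation.smul_apply, G, S.F_w (by omega) (by omega), if_neg (by omega), smul_zero]
  · intro h
    exact absurd (Finset.mem_range.2 (Nat.lt_succ_of_le hj)) h

theorem comb_p (c : ℕ → ℕ → A) {k : ℕ} (hk : k ≤ N) : S.comb c (S.p (k + 1)) =
    (c k k - if k + 1 ≤ N then c (k + 1) (k + 1) else 0) * S.p (k + 1) := by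
  have h1 : S.comb c (S.p (k + 1)) =
      ∑ j ∈ Finset.range (N + 1), c j j * S.E j (S.p (k + 1)) := by
    rw [comb, sum_derivation_apply]
    refine Finset.sum_congr rfl fun j hj => ?_
    rw [Finset.mem_range] at hj
    rw [sum_derivation_apply, Finset.sum_range_succ, Finset.sum_eq_zero, zero_add,
      Derivation.smul_apply, G, Nat.sub_self]
    · rfl
    · intro i hi
      rw [Finset.mem_range] at hi
      rw [Derivation.smul_apply, G, show j - i = (j - i - 1) + 1 by omega,
        S.F_p (by omega) (by omega), smul_zero]
  rw [h1]
  have h2 : ∀ j ∈ Finset.range (N + 1), c j j * S.E j (S.p (k + 1)) =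
      (if j = k then c k k * S.p (k + 1) else 0) -
        if j = k + 1 then c (k + 1) (k + 1) * S.p (k + 1) else 0 := by
    intro j hj
    rw [Finset.mem_range] at hj
    rw [S.E_p (by omega) (by omega)]
    rcases eq_or_ne j k with rfl | h
    · simp
    · rcases eq_or_ne j (k + 1) with rfl | h'
      · simp
      · simp [h, h', h.symm, h'.symm]
  rw [Finset.sum_congr rfl h2, Finset.sum_sub_distrib, Finset.sum_ite_eq', Finset.sum_ite_eq',
    if_pos (Finset.mem_range.2 (by omega))]
  simp only [Finset.mem_range, Nat.lt_succ_iff]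
  split_ifs <;> ring

/-- Induction on the diagonal s = j - i. For s = 0 the action on p_{k+1} makes consecutive diagonal
coefficients equal, with zero past the end. For the next diagonal, the relation `nabla c` has zero
entries at distance s; this yields c_{k,k+s+1} p_{k+s+1} = c_{k-1,k+s} p_k, solved from k = 0, where
the right-hand side is absent. -/
theorem comb_eq_zero (hp : ∀ k, k ≤ N → S.p (k + 1) ∈ nonZeroDivisors A) (s : ℕ) :
    ∀ c : ℕ → ℕ → A, S.comb c = 0 → ∀ i, i + s ≤ N → c i (i + s) = 0 := by
  induction s using Nat.strong_induction_on with
  | _ s ih =>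
  intro c hc
  rcases s with _ | s
  · have h1 : ∀ k, k ≤ N → c k k = if k + 1 ≤ N then c (k + 1) (k + 1) else 0 := fun k hk => by
      have h2 := S.comb_p c hk
      rw [hc, Derivation.zero_apply] at h2
      exact sub_eq_zero.1 ((mem_nonZeroDivisors_iff_right.1 (hp k hk)) _ h2.symm)
    have h3 : ∀ a, a ≤ N → c (N - a) (N - a) = 0 := by
      intro a
      induction a with
      | zero => intro _; rw [h1 _ (by omega), if_neg (by omega)]
      | succ a iha =>
        intro ha
        rw [h1 _ (by omega), if_pos (by omega), show N - (a + 1) + 1 = N - a by omega]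
        exact iha (by omega)
    intro i hi
    have := h3 (N - i) (by omega)
    rwa [show N - (N - i) = i by omega] at this
  · have hn : S.comb (S.nabla c) = 0 := by rw [← S.lie_D_comb, hc, lie_zero]
    have hz : ∀ i j, i ≤ j → j ≤ i + s → j ≤ N → c i j = 0 := fun i j h1 h2 h3 => by
      have := ih (j - i) (by omega) c hc i (by omega)
      rwa [show i + (j - i) = j by omega] at this
    have hrec : ∀ k, k + (s + 1) ≤ N → c k (k + s + 1) * S.p (k + s + 1) =
        if 1 ≤ k then c (k - 1) (k + s) * S.p k else 0 := by
      intro k hk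
      have h1 := ih s (by omega) _ hn k (by omega)
      -- The nonlocal term of `nabla` disappears: it is the value of the relation on w_{k+s+1}, up
      -- to terms at distance at most s, which are already known to vanish.
      have h2 : ∑ l ∈ Finset.range k, c l (k + s) * S.d l = 0 := by
        have h3 := S.comb_w c (show k + s ≤ N by omega)
        rw [hc, Derivation.zero_apply, show k + s + 1 = k + (s + 1) by ring,
          Finset.sum_range_add, Finset.sum_eq_zero (s := Finset.range (s + 1)), add_zero] at h3
        · exact h3.symm
        · intro x hx
          rw [Finset.mem_range] at hx
          rw [hz (k + x) (k + s) (by omega) (by omega) (by omega), zero_mul]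
      rw [nabla, h2, hz k (k + s) (by omega) (by omega) (by omega), map_zero,
        if_pos (show k + s + 1 ≤ N by omega)] at h1
      linear_combination -h1
    intro i
    induction i with
    | zero =>
      intro hi
      have := hrec 0 hi
      rw [if_neg (by omega)] at this
      have := mem_nonZeroDivisors_iff_right.1 (hp _ (by omega)) _ this
      rwa [show 0 + s + 1 = 0 + (s + 1) by ring] at this
    | succ i ihi =>
      intro hi
      have := hrec (i + 1) hi
      rw [if_pos (by omega), Nat.add_sub_cancel, show i + 1 + s = i + (s + 1) by ring,
        ihi (by omega), zero_mul] at this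
      have := mem_nonZeroDivisors_iff_right.1 (hp _ (by omega)) _ this
      rwa [show i + (s + 1) + 1 = i + 1 + (s + 1) by ring] at this

end CutoffFields

end Chain

end

/-! ### From the normalized generators to a basis containing R. -/

noncomputable section

namespace Chain

section Transfer

variable {A M ι : Type*} [CommRing A] [AddCommGroup M] [Module A M] [Finite ι]

/-- A family with the span of a linearly independent family with the same finite index set is
linearly independent. -/
theorem linearIndependent_of_span_eq {b g : ι → M} (hb : LinearIndependent A b)
    (h : Submodule.span A (Set.range b) = Submodule.span A (Set.range g)) :
    LinearIndependent A g := by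
  have hmem : ∀ x : ι →₀ A, Finsupp.linearCombination A g x ∈ Submodule.span A (Set.range b) :=
    fun x => by
      rw [h, ← Finsupp.range_linearCombination]
      exact ⟨x, rfl⟩
  let f : (ι →₀ A) →ₗ[A] Submodule.span A (Set.range b) :=
    (Finsupp.linearCombination A g).codRestrict _ hmem
  have hf : Function.Surjective f := by
    rintro ⟨x, hx⟩
    rw [h, ← Finsupp.range_linearCombination] at hx
    obtain ⟨y, rfl⟩ := hx
    exact ⟨y, rfl⟩
  -- The second family gives a surjection of a finite free module onto the free span of the first;
  -- composed with coordinates it is a surjective endomorphism, hence injective.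
  have hinj : Function.Injective ((Module.Basis.span hb).repr.toLinearMap ∘ₗ f) :=
    OrzechProperty.injective_of_surjective_endomorphism _
      ((Module.Basis.span hb).repr.surjective.comp hf)
  have hfi : Function.Injective f := fun x y hxy => hinj (by simp [hxy])
  intro x y hxy
  exact hfi (Subtype.ext hxy)

end Transfer

variable {A : Type*} [CommRing A] [Algebra ℂ A] {N : ℕ}

local notation "C" => algebraMap ℂ A

instance finite_index (N : ℕ) : Finite {q : ℕ × ℕ // q.1 + q.2 ≤ N} := by
  refine Set.Finite.to_subtype (s := {q : ℕ × ℕ | q.1 + q.2 ≤ N}) ?_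
  refine (Set.finite_Iic ((N, N) : ℕ × ℕ)).subset fun q hq => ?_
  simp only [Set.mem_ofPred_eq] at hq
  exact ⟨by simp; omega, by simp; omega⟩

/-- An operator together with the nested commutators. -/
def nestedFamily (N : ℕ) (R : Derivation ℂ A A) (Y : ℕ → Derivation ℂ A A) :
    Option {q : ℕ × ℕ // q.1 + q.2 ≤ N} → Derivation ℂ A A
  | none => R
  | some q => nested Y q.1.1 q.1.2

theorem span_nestedFamily {R : Derivation ℂ A A} {Y : ℕ → Derivation ℂ A A}
    (hY : ∀ i, N < i → Y i = 0) :
    Submodule.span A (Set.range (nestedFamily N R Y)) =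
      Submodule.span A (insert R (Set.range fun q : ℕ × ℕ => nested Y q.1 q.2)) := by
  apply le_antisymm
  · refine Submodule.span_mono ?_
    rintro _ ⟨_ | q, rfl⟩
    · exact Set.mem_insert _ _
    · exact Set.mem_insert_of_mem _ ⟨q.1, rfl⟩
  · rw [Submodule.span_le]
    rintro _ (rfl | ⟨q, rfl⟩)
    · exact Submodule.subset_span ⟨none, rfl⟩
    · by_cases h : q.1 + q.2 ≤ N
      · exact Submodule.subset_span ⟨some ⟨q, h⟩, rfl⟩
      · dsimp only
        rw [nested_eq_zero hY (not_le.1 h)]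
        exact Submodule.zero_mem _

namespace CutoffFields

variable (S : CutoffFields A N)

theorem sum_eq_comb [Fintype {q : ℕ × ℕ // q.1 + q.2 ≤ N}] (c : ℕ × ℕ → A) :
    ∑ q : {q : ℕ × ℕ // q.1 + q.2 ≤ N}, c q.1 • S.F q.1.1 q.1.2 =
      S.comb fun i j => c (i, j - i) := by
  rw [comb, Finset.sum_sigma']
  refine Finset.sum_bij' (fun q _ => (⟨q.1.1 + q.1.2, q.1.1⟩ : (_ : ℕ) × ℕ))
    (fun q hq => ⟨(q.2, q.1 - q.2), ?_⟩) ?_ ?_ ?_ ?_ ?_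
  · simp only [Finset.mem_sigma, Finset.mem_range] at hq
    change q.2 + (q.1 - q.2) ≤ N
    omega
  · rintro ⟨q, hq⟩ -
    simp only [Finset.mem_sigma, Finset.mem_range]
    omega
  · intro q hq
    exact Finset.mem_univ _
  · rintro ⟨q, hq⟩ -
    simp
  · rintro ⟨j, i⟩ hq
    simp only [Finset.mem_sigma, Finset.mem_range] at hq
    simp only [Sigma.mk.injEq, heq_eq_eq, and_true]
    omega
  · rintro ⟨q, hq⟩ -
    simp [G]

theorem linearIndependent_F (hp : ∀ k, k ≤ N → S.p (k + 1) ∈ nonZeroDivisors A)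
    (hR : ∀ (a : A) (c : ℕ → ℕ → A), a • S.R + S.comb c = 0 → a = 0) :
    LinearIndependent A (nestedFamily N S.R S.E) := by
  classical
  let _ : Fintype {q : ℕ × ℕ // q.1 + q.2 ≤ N} := Fintype.ofFinite _
  rw [Fintype.linearIndependent_iff]
  intro g hg
  rw [Fintype.sum_option] at hg
  let c : ℕ × ℕ → A := fun q => if h : q.1 + q.2 ≤ N then g (some ⟨q, h⟩) else 0
  have hc : ∀ q : {q : ℕ × ℕ // q.1 + q.2 ≤ N}, g (some q) = c q.1 := fun q => by
    simp only [c, dif_pos q.2]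
  have h1 : ∑ q, g (some q) • nestedFamily N S.R S.E (some q) =
      S.comb fun i j => c (i, j - i) := by
    rw [← S.sum_eq_comb c]
    exact Finset.sum_congr rfl fun q _ => by rw [hc]; rfl
  rw [h1] at hg
  change g none • S.R + _ = 0 at hg
  have h0 : g none = 0 := hR _ _ hg
  rw [h0, zero_smul, zero_add] at hg
  rintro (_ | q)
  · exact h0
  · have := S.comb_eq_zero hp q.1.2 _ hg q.1.1 q.2
    rw [hc]
    simpa using this

/-- The explicit family spans a module that is closed under commutators. -/
theorem span_family {R₀ : Derivation ℂ A A}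
    (hR₀ : S.R - R₀ ∈ Submodule.span A (Set.range fun q : ℕ × ℕ => nested S.Y q.1 q.2)) :
    Submodule.span A (Set.range (nestedFamily N R₀ S.Y)) =
      Submodule.span A (insert S.R (Set.range fun q : ℕ × ℕ => S.F q.1 q.2)) := by
  rw [span_nestedFamily S.Y_gt, Submodule.span_insert, Submodule.span_insert S.R,
    ← S.span_nested_Y]
  have h1 : S.R = R₀ + (S.R - R₀) := by abel
  apply le_antisymm
  · refine sup_le ?_ le_sup_right
    rw [Submodule.span_singleton_le_iff_mem, ← sub_sub_cancel S.R R₀]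
    exact Submodule.sub_mem _ (Submodule.mem_sup_left (Submodule.mem_span_singleton_self _))
      (Submodule.mem_sup_right hR₀)
  · refine sup_le ?_ le_sup_right
    rw [Submodule.span_singleton_le_iff_mem, h1]
    exact Submodule.add_mem _ (Submodule.mem_sup_left (Submodule.mem_span_singleton_self _))
      (Submodule.mem_sup_right hR₀)

theorem linearIndependent_family {R₀ : Derivation ℂ A A}
    (hR₀ : S.R - R₀ ∈ Submodule.span A (Set.range fun q : ℕ × ℕ => nested S.Y q.1 q.2))
    (hp : ∀ k, k ≤ N → S.p (k + 1) ∈ nonZeroDivisors A)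
    (hR : ∀ (a : A) (c : ℕ → ℕ → A), a • S.R + S.comb c = 0 → a = 0) :
    LinearIndependent A (nestedFamily N R₀ S.Y) := by
  refine linearIndependent_of_span_eq (S.linearIndependent_F hp hR) ?_
  rw [S.span_family hR₀, span_nestedFamily fun _ => S.E_gt]
  rfl

theorem vert_F (i n : ℕ) : S.Vert (S.F i n) := by
  induction n with
  | zero => exact S.vert_E i
  | succ n ih => exact S.vert_lie _ _ (S.vert_E _) ih

/-- Independence of `R` if it is not vertical. -/
theorem coeff_R_eq_zero_of_apply {x : A} (hx : S.R x = 1) (hF : ∀ Z, S.Vert Z → Z x = 0)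
    (a : A) (c : ℕ → ℕ → A) (h : a • S.R + S.comb c = 0) : a = 0 := by
  have h1 := congrArg (fun X : Derivation ℂ A A => X x) h
  have h2 : S.comb c x = 0 := by
    rw [comb, sum_derivation_apply]
    refine Finset.sum_eq_zero fun j _ => ?_
    rw [sum_derivation_apply]
    exact Finset.sum_eq_zero fun i _ => by
      rw [Derivation.smul_apply, G, hF _ (S.vert_F _ _), smul_zero]
  simpa [hx, h2] using h1

/-- Independence of `R` for the cut-off by a simple root of `r`. -/
theorem coeff_R_eq_zero_of_root {l : ℂ} (h0 : S.w 0 = C l) (hN : S.w (N + 2) = C l)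
    (hl : S.h * l ^ 2 + S.c₂ * l + S.c₃ = 0) (hl' : S.ed * (2 * S.h * l + S.c₂) ≠ 0)
    (hp : ∀ k, k ≤ N → S.p (k + 1) ∈ nonZeroDivisors A)
    (a : A) (c : ℕ → ℕ → A) (h : a • S.R + S.comb c = 0) : a = 0 := by
  have h1 : ∀ x, S.comb c x = -(a * S.R x) := fun x => by
    have := congrArg (fun X : Derivation ℂ A A => X x) h
    simp only [Derivation.add_apply, Derivation.smul_apply, smul_eq_mul,
      Derivation.zero_apply] at this
    linear_combination this
  have h2 : ∀ k, k ≤ N → c k k = (if k + 1 ≤ N then c (k + 1) (k + 1) else 0) +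
      a * C S.ed * C S.h * S.d (k + 1) := fun k hk => by
    have h3 := S.comb_p c hk
    rw [h1, S.R_p (by omega)] at h3
    have h4 : (c k k - (if k + 1 ≤ N then c (k + 1) (k + 1) else 0) -
        a * C S.ed * C S.h * S.d (k + 1)) * S.p (k + 1) = 0 := by
      linear_combination -h3
    linear_combination (mem_nonZeroDivisors_iff_right.1 (hp k hk)) _ h4
  -- The action on p_{k+1} gives differences of consecutive diagonal coefficients; they telescope
  -- from the right end, where w_{N+2} is the root.
  have h3 : ∀ b, b ≤ N → c (N - b) (N - b) =
      a * C S.ed * C S.h * (S.w (N + 2) - S.w (N - b + 1)) := by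
    intro b
    induction b with
    | zero => intro _; rw [h2 _ (by omega), if_neg (by omega)]; simp [d]
    | succ b ih =>
      intro hb
      rw [h2 _ (by omega), if_pos (by omega), show N - (b + 1) + 1 = N - b by omega, ih (by omega), d]
      ring
  have h4 := h3 N le_rfl
  rw [Nat.sub_self] at h4
  have h5 := S.comb_w c (Nat.zero_le N)
  have hl2 : C S.h * C l ^ 2 + C S.c₂ * C l + C S.c₃ = 0 := by
    rw [← map_pow, ← map_mul, ← map_mul, ← map_add, ← map_add, hl, map_zero]
  rw [zero_add] at h4
  rw [h1, zero_add, Finset.sum_range_one, h4, S.R_w _ (by omega), hN] at h5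
  -- The action on w_1 gives a second value for c_{00} d_0, namely -a ε_d r(w_1). Since r(w_1) =
  -- (w_1 - l)(h(w_1 + l) + c₂), comparison leaves a ε_d r'(l) d_0 = 0.
  have h6 : a * C (S.ed * (2 * S.h * l + S.c₂)) * S.d 0 = 0 := by
    have h7 : S.d 0 = S.w 1 - C l := by rw [d, h0]
    rw [h7] at h5 ⊢
    simp only [map_mul, map_add, map_ofNat]
    linear_combination -h5 - a * C S.ed * hl2
  have h8 : a * C (S.ed * (2 * S.h * l + S.c₂)) = 0 := by
    have := S.d_v (Nat.zero_le (N + 1))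
    linear_combination S.v 0 * h6 - a * C (S.ed * (2 * S.h * l + S.c₂)) * this
  have h9 : C (S.ed * (2 * S.h * l + S.c₂)) * C (S.ed * (2 * S.h * l + S.c₂))⁻¹ = 1 := by
    rw [← map_mul, mul_inv_cancel₀ hl', map_one]
  linear_combination C (S.ed * (2 * S.h * l + S.c₂))⁻¹ * h8 - a * h9

end CutoffFields

end Chain

end

/-! ### Factored differential operators, their symmetries and symbols. -/

noncomputable section

namespace Chain

variable {A : Type*} [CommRing A] [Algebra ℂ A] {N : ℕ}

local notation "C" => algebraMap ℂ A

section Operators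

variable (D : Derivation ℂ A A) (q σ : ℕ → A)

/-- The coefficients of the composition of the total derivative and a differential operator. -/
def comp (c : ℕ → A) : ℕ → A
  | 0 => D (c 0)
  | l + 1 => D (c (l + 1)) + c l

/-- The coefficients of the operator `(q_{m-1} D + σ_{m-1}) ⋯ (q_0 D + σ_0)`. -/
def coeffs : ℕ → ℕ → A
  | 0 => fun l => if l = 0 then 1 else 0
  | m + 1 => fun l => q m * comp D (coeffs m) l + σ m * coeffs m l

variable {D q σ}

theorem map_D_of_lie {X : Derivation ℂ A A} {μ : A} (h : ⁅D, X⁆ = μ • X) (g : A) :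
    X (D g) = D (X g) - μ * X g := by
  have := congrArg (fun Z : Derivation ℂ A A => Z g) h
  simp only [lie_apply, Derivation.smul_apply, smul_eq_mul] at this
  linear_combination -this

theorem map_comp_of_lie {X : Derivation ℂ A A} {μ : A} (h : ⁅D, X⁆ = μ • X) (c : ℕ → A) (l : ℕ) :
    X (comp D c l) = comp D (fun l => X (c l)) l - μ * X (c l) := by
  cases l with
  | zero => exact map_D_of_lie h _
  | succ l => simp only [comp, map_add, map_D_of_lie h]; ring

theorem comp_zero (l : ℕ) : comp D (fun _ => 0) l = 0 := by
  cases l <;> simp [comp]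

theorem map_coeffs_succ {X : Derivation ℂ A A} {μ : A} (h : ⁅D, X⁆ = μ • X) {m : ℕ}
    (hσ : X (σ m) = 0) (hq : X (q m) = 0) (hc : ∀ l, X (coeffs D q σ m l) = 0) (l : ℕ) :
    X (coeffs D q σ (m + 1) l) = 0 := by
  simp only [coeffs, map_add, Derivation.leibniz, hσ, hq, map_comp_of_lie h, hc, comp_zero]
  simp

theorem map_coeffs_zero (X : Derivation ℂ A A) (l : ℕ) : X (coeffs D q σ 0 l) = 0 := by
  simp only [coeffs]
  split_ifs <;> simp

/-- Derivations that kill the `q_k` kill the coefficients. -/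
theorem map_coeffs_eq_zero {X : Derivation ℂ A A} {μ : A} (h : ⁅D, X⁆ = μ • X) {m : ℕ}
    (hσ : ∀ k, k < m → X (σ k) = 0) (hq : ∀ k, k < m → X (q k) = 0) (l : ℕ) :
    X (coeffs D q σ m l) = 0 := by
  induction m generalizing l with
  | zero => exact map_coeffs_zero X l
  | succ m ih =>
    exact map_coeffs_succ h (hσ m (by omega)) (hq m (by omega))
      (ih (fun k hk => hσ k (by omega)) fun k hk => hq k (by omega)) l

/-- A derivation that scales two consecutive `q_k` kills the coefficients. -/
theorem map_coeffs_of_pair {X : Derivation ℂ A A} {μ : A} (h : ⁅D, X⁆ = μ • X) {m j : ℕ}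
    (hσ : ∀ k, k < m → X (σ k) = 0)
    (hq : ∀ k, k < m → X (q k) = if k = j + 1 then -q k else if k = j then q k else 0)
    (hσj : σ j = 1) (hμ : q (j + 1) * q j * μ = σ (j + 1) * q j - q (j + 1)) (hj : j + 1 < m)
    (l : ℕ) : X (coeffs D q σ m l) = 0 := by
  have h0 : ∀ l, X (coeffs D q σ j l) = 0 :=
    map_coeffs_eq_zero h (fun k hk => hσ k (by omega)) fun k hk => by
      rw [hq k (by omega), if_neg (by omega), if_neg (by omega)]
  have h1 : ∀ l, X (coeffs D q σ (j + 1) l) = q j * comp D (coeffs D q σ j) l := fun l => by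
    simp only [coeffs, map_add, Derivation.leibniz, hσ j (by omega), hq j (by omega),
      map_comp_of_lie h, h0, comp_zero]
    simp [mul_comm]
  -- Let L_m be the product of the first m factors. Since σ_j = 1, X L_{j+1} = q_j D L_j = L_{j+1} -
  -- L_j. In X L_{j+2} the terms with D L_{j+1} then cancel, and D L_j is left with a factor that
  -- vanishes by `hμ`.
  have h2 : ∀ l, X (coeffs D q σ (j + 2) l) = 0 := fun l => by
    have h3 : comp D (fun l => q j * comp D (coeffs D q σ j) l) l =
        comp D (coeffs D q σ (j + 1)) l - comp D (coeffs D q σ j) l := by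
      have h4 : ∀ l, q j * comp D (coeffs D q σ j) l =
          coeffs D q σ (j + 1) l - coeffs D q σ j l := fun l => by
        simp only [coeffs, hσj]; ring
      simp only [h4]
      cases l with
      | zero => simp only [comp, map_sub]
      | succ l => simp only [comp, map_sub]; ring
    have h5 : coeffs D q σ (j + 2) l = q (j + 1) * comp D (coeffs D q σ (j + 1)) l +
      σ (j + 1) * coeffs D q σ (j + 1) l := rfl
    rw [h5]
    simp only [map_add, Derivation.leibniz, hσ (j + 1) (by omega), hq (j + 1) (by omega),
      map_comp_of_lie h, h1, h3, smul_eq_mul]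
    simp only [if_true]
    linear_combination (-comp D (coeffs D q σ j) l) * hμ
  have h6 : ∀ b, j + 2 + b ≤ m → ∀ l, X (coeffs D q σ (j + 2 + b) l) = 0 := fun b => by
    induction b with
    | zero => exact fun _ => h2
    | succ b ih =>
      intro hb
      have hn : j + 2 + b < m := by omega
      have ih := ih (by omega)
      rw [← Nat.add_assoc]
      generalize hk : j + 2 + b = k at hn ih
      exact map_coeffs_succ h (hσ k hn)
        (by rw [hq k hn, if_neg (by omega), if_neg (by omega)]) ih
  have h7 := h6 (m - j - 2) (by omega) l
  rwa [show j + 2 + (m - j - 2) = m by omega] at h7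

/-- A derivation that commutes with `D` and scales the last `q_k` scales the coefficients. -/
theorem map_coeffs_of_last {X : Derivation ℂ A A} (h : ⁅D, X⁆ = 0) {m : ℕ} {ω : A}
    (hσ : ∀ k, k ≤ m → X (σ k) = 0)
    (hq : ∀ k, k ≤ m → X (q k) = if k = m then ω * q k else 0)
    (hω : ω * σ m = 0) (l : ℕ) :
    X (coeffs D q σ (m + 1) l) = ω * coeffs D q σ (m + 1) l := by
  have h' : ⁅D, X⁆ = (0 : A) • X := by rw [h, zero_smul]
  have h0 : ∀ l, X (coeffs D q σ m l) = 0 :=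
    map_coeffs_eq_zero h' (fun k hk => hσ k (by omega)) fun k hk => by
      rw [hq k (by omega), if_neg (by omega)]
  simp only [coeffs, map_add, Derivation.leibniz, hσ m le_rfl, hq m le_rfl,
    map_comp_of_lie h', h0, comp_zero]
  simp only [smul_eq_mul, if_true]
  linear_combination (-coeffs D q σ m l) * hω

theorem coeffs_of_lt {m l : ℕ} (h : m < l) : coeffs D q σ m l = 0 := by
  induction m generalizing l with
  | zero => simp only [coeffs]; rw [if_neg (by omega)]
  | succ m ih =>
    obtain ⟨l, rfl⟩ : ∃ k, l = k + 1 := ⟨l - 1, by omega⟩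
    simp only [coeffs, comp, ih (show m < l + 1 by omega), ih (show m < l by omega)]
    simp

theorem coeffs_self (m : ℕ) : coeffs D q σ m m = ∏ k ∈ Finset.range m, q k := by
  induction m with
  | zero => simp [coeffs]
  | succ m ih =>
    rw [Finset.prod_range_succ, ← ih]
    simp only [coeffs, comp, coeffs_of_lt (show m < m + 1 by omega)]
    simp [mul_comm]

variable {P : ℕ → Derivation ℂ A A}

/-- Weight count: each factor contributes at most one D, which either raises the power l or the
order of the derivatives inside the coefficient. -/
theorem order_coeffs (hP : ∀ k g, P (k + 1) (D g) = D (P (k + 1) g) + P k g) {m : ℕ}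
    (hσ : ∀ j k, j < m → P k (σ j) = 0) (hq : ∀ j k, j < m → P (k + 1) (q j) = 0)
    (l k : ℕ) (h : m < l + k) : P k (coeffs D q σ m l) = 0 := by
  induction m generalizing l k with
  | zero => exact map_coeffs_zero _ _
  | succ m ih =>
    cases k with
    | zero => rw [coeffs_of_lt (show m + 1 < l by omega), map_zero]
    | succ k =>
      have ih' := ih (fun j k hj => hσ j k (by omega)) fun j k hj => hq j k (by omega)
      simp only [coeffs, map_add, Derivation.leibniz, hσ m _ (by omega), hq m _ (by omega),
        ih' l (k + 1) (by omega)]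
      cases l with
      | zero => simp only [comp, hP, ih' 0 (k + 1) (by omega), ih' 0 k (by omega)]; simp
      | succ l =>
        simp only [comp, map_add, hP, ih' (l + 1) (k + 1) (by omega),
          ih' (l + 1) k (by omega), ih' l (k + 1) (by omega)]
        simp

/-- The derivatives of the coefficients along the highest derivatives of an unknown. -/
theorem symbol_coeffs (hP : ∀ k g, P (k + 1) (D g) = D (P (k + 1) g) + P k g) {i : ℕ} {y : A}
    {m : ℕ} (hσ : ∀ j k, j < m → P k (σ j) = 0) (hq : ∀ j k, j < m → P (k + 1) (q j) = 0)
    (hq0 : ∀ j, j < m → P 0 (q j) = if j = i then q j * y else 0)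
    (l k : ℕ) (h : l + k = m) : P k (coeffs D q σ m l) =
      if i < m then ((m - 1 - i).choose k : A) * coeffs D q σ m m * y else 0 := by
  induction m generalizing l k with
  | zero => rw [map_coeffs_zero]; simp
  | succ m ih =>
    have ih' := ih (fun j k hj => hσ j k (by omega)) (fun j k hj => hq j k (by omega))
      fun j hj => hq0 j (by omega)
    have ho := order_coeffs hP (m := m) (fun j k hj => hσ j k (by omega))
      fun j k hj => hq j k (by omega)
    have hm : coeffs D q σ (m + 1) (m + 1) = q m * coeffs D q σ m m := by
      rw [coeffs_self, coeffs_self, Finset.prod_range_succ, mul_comm]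
    cases k with
    | zero =>
      obtain rfl : l = m + 1 := h
      rw [hm, Derivation.leibniz, hq0 m (by omega), ih' m 0 rfl]
      rcases lt_trichotomy m i with h1 | h1 | h1
      · rw [if_neg (by omega), if_neg (by omega), if_neg (by omega)]; simp
      · subst h1
        simp only [Nat.choose_zero_right, smul_eq_mul, if_true, lt_irrefl, if_false,
          Nat.lt_succ_self, Nat.cast_one]
        ring
      · rw [if_pos h1, if_neg (show ¬m = i by omega), if_pos (show i < m + 1 by omega)]
        simp only [Nat.choose_zero_right, smul_eq_mul, Nat.cast_one]
        ring
    | succ k =>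
      have h1 : P (k + 1) (comp D (coeffs D q σ m) l) =
          if i < m then ((m - i).choose (k + 1) : A) * coeffs D q σ m m * y else 0 := by
        cases l with
        | zero =>
          simp only [comp, hP, ho 0 (k + 1) (by omega), ih' 0 k (by omega), map_zero, zero_add]
          split_ifs with hi
          · rw [Nat.choose_eq_zero_of_lt (show m - 1 - i < k by omega),
              Nat.choose_eq_zero_of_lt (show m - i < k + 1 by omega)]
          · rfl
        | succ l =>
          simp only [comp, map_add, hP, ho (l + 1) (k + 1) (by omega),
            ih' (l + 1) k (by omega), ih' l (k + 1) (by omega), map_zero, zero_add]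
          split_ifs with hi
          -- Pascal's rule: a new D either differentiates the coefficient of D^{l+1} or shifts that
          -- of D^l.
          · rw [show m - i = m - 1 - i + 1 by omega, Nat.choose_succ_succ]
            push_cast
            ring
          · simp
      rw [hm]
      simp only [coeffs, map_add, Derivation.leibniz, hσ m _ (by omega), hq m _ (by omega),
        ho l (k + 1) (by omega), h1]
      rcases lt_trichotomy m i with h2 | h2 | h2
      · rw [if_neg (by omega), if_neg (by omega)]; simp
      · subst h2; simp
      · rw [if_pos h2, if_pos (by omega), Nat.add_sub_cancel]
        simp only [smul_eq_mul]
        ring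

variable (D q σ) in
/-- The logarithmic derivative of the leading coefficient and the other coefficients divided by
the leading one, where `K` is the inverse of the leading coefficient. -/
def integral (N : ℕ) (K : A) : ℕ → A
  | 0 => D (coeffs D q σ (N + 1) (N + 1)) * K
  | j + 1 => coeffs D q σ (N + 1) (N - j) * K

variable {K : A} (hK : coeffs D q σ (N + 1) (N + 1) * K = 1)
include hK

theorem map_integral_eq_zero {X : Derivation ℂ A A} {μ : A} (h : ⁅D, X⁆ = μ • X)
    (hX : ∀ l, X (coeffs D q σ (N + 1) l) = 0) (j : ℕ) : X (integral D q σ N K j) = 0 := by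
  have h1 : X K = 0 := by rw [derivation_inv X hK, hX, mul_zero]
  cases j with
  | zero => simp only [integral, Derivation.leibniz, h1, map_D_of_lie h, hX]; simp
  | succ j => simp only [integral, Derivation.leibniz, h1, hX]; simp

/-- A common factor with D ω = 0 cancels in quotients and in a logarithmic derivative. This is why
`integral 0` is not the leading coefficient itself. -/
theorem map_integral_of_scale {X : Derivation ℂ A A} (h : ⁅D, X⁆ = 0) {ω : A} (hω : D ω = 0)
    (hX : ∀ l, X (coeffs D q σ (N + 1) l) = ω * coeffs D q σ (N + 1) l) (j : ℕ) :
    X (integral D q σ N K j) = 0 := by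
  have h' : ⁅D, X⁆ = (0 : A) • X := by rw [h, zero_smul]
  have h1 : X K = -ω * K := by
    rw [derivation_inv X hK, hX]
    linear_combination -ω * K * hK
  cases j with
  | zero =>
    simp only [integral, Derivation.leibniz, h1, map_D_of_lie h', hX, hω, smul_eq_mul]
    ring
  | succ j =>
    simp only [integral, Derivation.leibniz, h1, hX, smul_eq_mul]
    ring

theorem order_integral (hP : ∀ k g, P (k + 1) (D g) = D (P (k + 1) g) + P k g)
    (hσ : ∀ j k, j < N + 1 → P k (σ j) = 0) (hq : ∀ j k, j < N + 1 → P (k + 1) (q j) = 0)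
    (j k : ℕ) (hj : j ≤ N) (hk : max 1 j < k) : P k (integral D q σ N K j) = 0 := by
  have ho := order_coeffs hP hσ hq
  obtain ⟨k, rfl⟩ : ∃ k', k = k' + 1 := ⟨k - 1, by omega⟩
  have h1 : P (k + 1) K = 0 := by
    rw [derivation_inv _ hK, ho _ _ (by omega), mul_zero]
  cases j with
  | zero =>
    simp only [integral, Derivation.leibniz, h1, hP, ho _ _ (show N + 1 < N + 1 + (k + 1) by omega),
      ho _ _ (show N + 1 < N + 1 + k by omega)]
    simp
  | succ j =>
    simp only [integral, Derivation.leibniz, h1,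
      ho _ _ (show N + 1 < N - j + (k + 1) by omega)]
    simp

/-- The inverse leading coefficient has too low an order to contribute, so the symbols are those of
the coefficients divided by the leading one. The logarithmic derivative has one more order than the
leading coefficient, hence max 1 j. -/
theorem symbol_integral (hP : ∀ k g, P (k + 1) (D g) = D (P (k + 1) g) + P k g)
    (hσ : ∀ j k, j < N + 1 → P k (σ j) = 0) (hq : ∀ j k, j < N + 1 → P (k + 1) (q j) = 0)
    {i : ℕ} (hi : i ≤ N) {y : A}
    (hq0 : ∀ j, j < N + 1 → P 0 (q j) = if j = i then q j * y else 0) (j : ℕ) (hj : j ≤ N) :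
    P (max 1 j) (integral D q σ N K j) = ((N - i).choose j : A) * y := by
  have ho := order_coeffs hP hσ hq
  have hs := symbol_coeffs hP hσ hq hq0
  have h1 : ∀ k, P (k + 1) K = 0 := fun k => by
    rw [derivation_inv _ hK, ho _ _ (by omega), mul_zero]
  cases j with
  | zero =>
    rw [show max 1 0 = 0 + 1 by rfl]
    simp only [integral, Derivation.leibniz, h1, hP,
      ho _ _ (show N + 1 < N + 1 + (0 + 1) by omega), hs (N + 1) 0 rfl]
    rw [if_pos (by omega)]
    simp only [smul_eq_mul, map_zero, mul_zero, zero_add, Nat.choose_zero_right, Nat.cast_one]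
    linear_combination y * hK
  | succ j =>
    rw [show max 1 (j + 1) = j + 1 by omega]
    simp only [integral, Derivation.leibniz, h1, hs (N - j) (j + 1) (by omega)]
    rw [if_pos (by omega), Nat.add_sub_cancel]
    simp only [smul_eq_mul, mul_zero, zero_add]
    linear_combination ((N - i).choose (j + 1) * y : A) * hK

end Operators

/-! ### The operator attached to a cut-off chain. -/

namespace CutoffFields

variable (S : CutoffFields A N) (z y : ℕ → A)

/-- The differences of a node and the first node. -/
def s (k : ℕ) : A := S.w k - S.w 0

/-- The coefficients of the factors of the operator that defines the integrals; `z_k` is the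
inverse of `s_k` and `y_k` the inverse of `p_{k+1}`. -/
def q (k : ℕ) : A := S.s (k + 1) * y k * if k < N then z (k + 2) else 1

/-- The free terms of the factors. -/
def σ (k : ℕ) : A := if k < N then 1 else S.s (N + 2)

theorem E_s {i k : ℕ} (hi : i ≤ N) (hk : k ≤ N + 2) :
    S.E i (S.s k) = if k = i + 1 then S.d i else 0 := by
  rw [s, map_sub, S.E_w hi hk, S.E_w hi (by omega), if_neg (show ¬0 = i + 1 by omega), sub_zero]

theorem D_s {k : ℕ} (hk : k ≤ N + 2) : S.D (S.s k) = S.π k +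
    C S.ee * (C S.h * (S.w k + S.w 0) + C S.c₂) * S.s k := by
  rw [s, map_sub, S.D_w k hk, S.D_w 0 (by omega), S.π_zero]
  ring

theorem R_s {k : ℕ} (hk : k ≤ N + 2) : S.R (S.s k) =
    C S.ed * (C S.h * (S.w k + S.w 0) + C S.c₂) * S.s k := by
  rw [s, map_sub, S.R_w k hk, S.R_w 0 (by omega)]
  ring

theorem E_σ {i k : ℕ} (hi : i ≤ N) : S.E i (S.σ k) = 0 := by
  rw [σ]
  split_ifs
  · simp
  · rw [S.E_s hi le_rfl, if_neg (by omega)]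

variable {z y} (hz : ∀ k, 1 ≤ k → k ≤ N + 1 → S.s k * z k = 1)
  (hy : ∀ k, k ≤ N → S.p (k + 1) * y k = 1)
include hz hy

theorem map_q {X : Derivation ℂ A A} {k : ℕ} (hk : k ≤ N) {a b c : A}
    (h1 : X (S.s (k + 1)) = a * S.s (k + 1)) (h2 : X (S.p (k + 1)) = b * S.p (k + 1))
    (h3 : k < N → X (S.s (k + 2)) = c * S.s (k + 2)) :
    X (S.q z y k) = (a - b - if k < N then c else 0) * S.q z y k := by
  have h4 : X (y k) = -b * y k := by
    rw [derivation_inv X (hy k hk), h2]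
    linear_combination -b * y k * hy k hk
  rw [q]
  split_ifs with h
  · have h5 : X (z (k + 2)) = -c * z (k + 2) := by
      have h6 := hz (k + 2) (by omega) (by omega)
      rw [derivation_inv X h6, h3 h]
      linear_combination -c * z (k + 2) * h6
    simp only [Derivation.leibniz, h1, h4, h5, smul_eq_mul]
    ring
  · simp only [Derivation.leibniz, h1, h4, smul_eq_mul, Derivation.map_one_eq_zero]
    ring

/-- E_0 scales s_1 and p_1 by the same weight, and q_0 contains only their quotient. -/
theorem E_zero_q {k : ℕ} (hk : k ≤ N) : S.E 0 (S.q z y k) = 0 := by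
  have h1 : S.E 0 (S.s (k + 1)) = (if k = 0 then 1 else 0) * S.s (k + 1) := by
    rw [S.E_s (by omega) (by omega)]
    by_cases h : k = 0
    · subst h; simp [d, s]
    · simp [h]
  have h2 : S.E 0 (S.p (k + 1)) = (if k = 0 then 1 else 0) * S.p (k + 1) := by
    rw [S.E_p (by omega) (by omega)]
    simp
  rw [S.map_q hz hy hk h1 h2 (c := 0) fun h => by
    rw [S.E_s (by omega) (by omega)]; simp]
  simp

/-- The generators in the normalization adapted to the integrals. -/
theorem E_succ_q {i k : ℕ} (hi : i + 1 ≤ N) (hk : k ≤ N) :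
    (S.s (i + 2) * z (i + 1)) • S.E (i + 1) (S.q z y k) =
      if k = i + 1 then -S.q z y k else if k = i then S.q z y k else 0 := by
  have e1 : S.d (i + 1) = S.s (i + 2) - S.s (i + 1) := by rw [d, s, s]; ring
  have e2 := hz (i + 1) (by omega) (by omega)
  have e3 := hz (i + 2) (by omega) (by omega)
  have h1 : S.E (i + 1) (S.s (k + 1)) =
      (if k = i + 1 then S.d (i + 1) * z (i + 2) else 0) * S.s (k + 1) := by
    rw [S.E_s hi (by omega)]
    by_cases h : k = i + 1
    · subst h
      simp only [if_true]
      linear_combination -S.d (i + 1) * e3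
    · simp [h]
  have h2 : S.E (i + 1) (S.p (k + 1)) =
      (if k = i + 1 then 1 else if k = i then -1 else 0) * S.p (k + 1) := by
    rw [S.E_p hi (by omega)]
    simp only [Nat.add_right_cancel_iff]
    split_ifs <;> simp
  rw [S.map_q hz hy hk h1 h2 (c := if k = i then S.d (i + 1) * z (i + 2) else 0) fun h => by
    rw [S.E_s hi (by omega)]
    by_cases h : k = i
    · subst h
      simp only [if_true]
      linear_combination -S.d (k + 1) * e3
    · simp [h], smul_eq_mul]
  rcases eq_or_ne k (i + 1) with h | h
  · subst h
    simp only [if_true, show ¬i + 1 = i by omega, if_false, ite_self]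
    rw [e1]
    linear_combination (S.q z y (i + 1)) * ((S.s (i + 2) * z (i + 1) - 1) * e3 - e2 * (S.s (i + 2) * z (i + 2)))
  · rcases eq_or_ne k i with h' | h'
    · subst h'
      simp only [if_true, show ¬k = k + 1 by omega, if_false, show k < N by omega]
      rw [e1]
      linear_combination (S.q z y k) * (e2 * (S.s (k + 2) * z (k + 2)) - (S.s (k + 2) * z (k + 1) - 1) * e3)
    · simp [h, h']

/-- The logarithmic R-derivatives of s_{k+1}, p_{k+1} and s_{k+2} cancel; only in the last factor,
which has no z, does one survive. -/
theorem R_q {k : ℕ} (hk : k ≤ N) : S.R (S.q z y k) =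
    if k = N then C S.ed * (C S.h * (S.w (N + 2) + S.w 0) + C S.c₂) * S.q z y k else 0 := by
  rw [S.map_q hz hy hk (S.R_s (by omega)) (S.R_p (by omega)) fun _ => S.R_s (by omega)]
  rcases eq_or_ne k N with h | h
  · subst h
    simp only [lt_irrefl, if_false, if_true, d]
    ring
  · rw [if_pos (by omega), if_neg h, d]
    ring

omit hy in
-- By `q_mul` this multiplier is σ_{i+1}/q_{i+1} - σ_i/q_i with σ_i = 1, precisely the condition
-- `hμ` of `map_coeffs_of_pair`.
theorem lie_D_E_succ {i : ℕ} (hi : i + 1 ≤ N) :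
    ⁅S.D, (S.s (i + 2) * z (i + 1)) • S.E (i + 1)⁆ =
      (S.p (i + 2) * S.s (i + 3) * z (i + 2) - S.p (i + 1) * S.s (i + 2) * z (i + 1)) •
        (S.s (i + 2) * z (i + 1)) • S.E (i + 1) := by
  have e0 : S.d (i + 1) = S.s (i + 2) - S.s (i + 1) := by rw [d, s, s]; ring
  have e1 : S.d (i + 2) = S.s (i + 3) - S.s (i + 2) := by rw [d, s, s]; ring
  have e2 := hz (i + 1) (by omega) (by omega)
  have e3 := hz (i + 2) (by omega) (by omega)
  have e4 : S.w (i + 2) - S.w (i + 1) = S.d (i + 1) := rfl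
  rw [lie_smul', S.lie_D_E hi, smul_smul, smul_smul, ← add_smul]
  congr 1
  simp only [Derivation.leibniz, derivation_inv S.D e2, S.D_s (show i + 1 ≤ N + 2 by omega),
    S.D_s (show i + 2 ≤ N + 2 by omega), S.π_eq (show i + 1 ≤ N + 1 by omega),
    S.π_eq (show i + 2 ≤ N + 1 by omega), smul_eq_mul, m]
  rw [← e4] at e0 ⊢
  rw [e1, e0, show S.w (i + 2) = S.s (i + 2) + S.w 0 by rw [s]; ring,
    show S.w (i + 1) = S.s (i + 1) + S.w 0 by rw [s]; ring]
  linear_combination (S.s (i + 2) * z (i + 1) * S.p (i + 1) - z (i + 1) * S.s (i + 2) * C S.ee *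
    (C S.h * (S.s (i + 1) + 2 * S.w 0) + C S.c₂)) * e2 -
    (z (i + 1) * S.p (i + 2) * S.s (i + 3)) * e3

theorem q_mul {k : ℕ} (hk : k ≤ N) :
    S.q z y k * (S.p (k + 1) * S.s (k + 2) * z (k + 1)) = S.σ k := by
  have e2 := hz (k + 1) (by omega) (by omega)
  have e3 := hy k hk
  rw [q, σ]
  split_ifs with h
  · have e4 := hz (k + 2) (by omega) (by omega)
    linear_combination e2 * (S.p (k + 1) * y k) * (S.s (k + 2) * z (k + 2)) +
      e3 * (S.s (k + 2) * z (k + 2)) + e4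
  · obtain rfl : k = N := by omega
    linear_combination e2 * (S.p (k + 1) * y k) * (S.s (k + 2)) + e3 * (S.s (k + 2))

/-- The coefficients of the operator are annihilated by the characteristic operators. -/
theorem Y_coeffs {i : ℕ} (hi : i ≤ N) (l : ℕ) :
    S.Y i (coeffs S.D (S.q z y) S.σ (N + 1) l) = 0 := by
  have key : S.E i (coeffs S.D (S.q z y) S.σ (N + 1) l) = 0 := by
    cases i with
    | zero =>
      exact map_coeffs_eq_zero (S.lie_D_E hi) (fun k _ => S.E_σ hi)
        (fun k hk => S.E_zero_q hz hy (by omega)) l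
    | succ i =>
      have h1 := map_coeffs_of_pair (S.lie_D_E_succ hz hi) (q := S.q z y) (σ := S.σ)
        (m := N + 1) (j := i) (fun k _ => by rw [Derivation.smul_apply, S.E_σ hi, smul_zero])
        (fun k hk => S.E_succ_q hz hy hi (by omega)) (if_pos (by omega)) (by
          have h2 := S.q_mul hz hy hi
          have h3 := S.q_mul hz hy (show i ≤ N by omega)
          rw [show S.σ i = 1 from if_pos (by omega)] at h3
          linear_combination S.q z y i * h2 - S.q z y (i + 1) * h3) (by omega) l
      rw [Derivation.smul_apply, smul_eq_mul] at h1
      have e2 := hz (i + 1) (by omega) (by omega)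
      have e3 := hz (i + 2) (by omega) (by omega)
      linear_combination z (i + 2) * S.s (i + 1) * h1 -
        (S.E (i + 1) (coeffs S.D (S.q z y) S.σ (N + 1) l)) *
          (e3 * (S.s (i + 1) * z (i + 1)) + e2)
  have h2 := S.d_v (show i ≤ N + 1 by omega)
  rw [E, Derivation.smul_apply, smul_eq_mul] at key
  linear_combination S.v i * key - S.Y i (coeffs S.D (S.q z y) S.σ (N + 1) l) * h2

/-- R scales the last q by ω, so the last factor scales as a whole only if ω σ_N = 0. For equal end
values σ_N = 0; for constant r, ω = 0. -/
theorem R_coeffs (hω : (C S.ed * (C S.h * (S.w (N + 2) + S.w 0) + C S.c₂)) * S.s (N + 2) = 0)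
    (l : ℕ) : S.R (coeffs S.D (S.q z y) S.σ (N + 1) l) =
      C S.ed * (C S.h * (S.w (N + 2) + S.w 0) + C S.c₂) *
        coeffs S.D (S.q z y) S.σ (N + 1) l := by
  refine map_coeffs_of_last S.lie_D_R (fun k hk => ?_) (fun k hk => S.R_q hz hy hk) ?_ l
  · rw [σ]
    split_ifs
    · simp
    · rw [S.R_s le_rfl]
      linear_combination hω
  · rw [σ, if_neg (lt_irrefl N)]
    exact hω

end CutoffFields

end Chain

end

/-! ### The cut-off system as an instance of the abstract data. -/

noncomputable section

namespace Chain

variable {N : ℕ}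

theorem Dir.other_ne (d : Dir) : d.other ≠ d := by cases d <;> decide

/-- The coefficient of the chain attached to a direction. -/
def Dir.coeff (ε : ℂ) : Dir → ℂ
  | .x => ε
  | .y => 1

variable {V : Opens (Jet N)}

/-- The polynomial `h g² + c₂ g + c₃` in an element of the ring. -/
def quad (h c₂ c₃ : ℂ) (g : Fun V) : Fun V :=
  algebraMap ℂ (Fun V) h * g ^ 2 + algebraMap ℂ (Fun V) c₂ * g + algebraMap ℂ (Fun V) c₃

local notation "C" => algebraMap ℂ (Fun V)

theorem map_quad (X : Der V) (h c₂ c₃ : ℂ) (g : Fun V) :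
    X (quad h c₂ c₃ g) = (2 * C h * g + C c₂) * X g := by
  simp only [quad, map_add, Derivation.leibniz, Derivation.map_algebraMap, smul_eq_mul, pow_two]
  ring

/-- A function of the independent variables with `∂g/∂t_e = ε_e r(g)`. -/
structure IsBoundary (ε h c₂ c₃ : ℂ) (g : Fun V) : Prop where
  t : ∀ e : Dir, pd V (.t e) g = C (e.coeff ε) * quad h c₂ c₃ g
  u : ∀ i, pd V (.u i) g = 0
  du : ∀ e i k, pd V (.du e i k) g = 0

theorem IsBoundary.apply {ε h c₂ c₃ : ℂ} {g : Fun V} (hg : IsBoundary ε h c₂ c₃ g) {X : Der V}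
    (hX : IsVF X) : X g = (X (coord V (.t .x)) * C ε + X (coord V (.t .y))) * quad h c₂ c₃ g := by
  rw [hX.apply_sum g (S := {.t .x, .t .y}) fun c hc => ?_, Finset.sum_pair (by simp), hg.t, hg.t,
    Dir.coeff, Dir.coeff, map_one]
  · ring
  · rcases c with e | i | ⟨e, i, k⟩
    · cases e <;> simp
    · exact absurd (hg.u i) hc
    · exact absurd (hg.du e i k) hc

theorem IsBoundary.apply_t {ε h c₂ c₃ : ℂ} {g : Fun V} (hg : IsBoundary ε h c₂ c₃ g) {X : Der V}
    (hX : IsVF X) {d : Dir} {τ : ℂ}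
    (ht : ∀ e, X (coord V (.t e)) = if e = d then C τ else 0) :
    X g = C τ * (C (d.coeff ε) * quad h c₂ c₃ g) := by
  rw [hg.apply hX, ht, ht]
  cases d <;> simp only [Dir.coeff, map_one, reduceCtorEq, if_true, if_false] <;> ring

theorem IsBoundary.map_eq_zero {ε h c₂ c₃ : ℂ} {g : Fun V} (hg : IsBoundary ε h c₂ c₃ g) {d : Dir}
    {X : Der V} (hX : IsVert V d X) : X g = 0 := by
  rw [hg.apply hX.isVF, hX.t, hX.t]
  ring

variable (V) in
/-- The values at the cut-off nodes and the inverses of the differences of the nodes. -/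
structure Cut (ε h c₂ c₃ : ℂ) where
  a : Fun V
  b : Fun V
  v : ℕ → Fun V
  isBoundary_a : IsBoundary ε h c₂ c₃ a
  isBoundary_b : IsBoundary ε h c₂ c₃ b
  /-- The nodes `u_{-1}, …, u_{N+1}`. -/
  w : ℕ → Fun V
  w_zero : w 0 = a
  w_succ : ∀ i : Fin (N + 1), w (i + 1) = coord V (.u i)
  w_last : w (N + 2) = b
  mul_v : ∀ k, k ≤ N + 1 → (w (k + 1) - w k) * v k = 1

namespace Cut

theorem node_cases (k : ℕ) (hk : k ≤ N + 2) :
    k = 0 ∨ (∃ i : Fin (N + 1), k = i + 1) ∨ k = N + 2 := by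
  rcases k with _ | k
  · exact .inl rfl
  · rcases Nat.lt_or_ge k (N + 1) with h | h
    · exact .inr (.inl ⟨⟨k, h⟩, rfl⟩)
    · exact .inr (.inr (by omega))

variable {ε h c₂ c₃ : ℂ} (T : Cut V ε h c₂ c₃)

/-- The shifted derivatives `u_{i,e} - ε_e r(u_i)`, extended by zero. -/
def π (_T : Cut V ε h c₂ c₃) (e : Dir) : ℕ → Fun V
  | 0 => 0
  | k + 1 => if hk : k < N + 1 then
      coord V (.du e ⟨k, hk⟩ 0) - C (e.coeff ε) * quad h c₂ c₃ (coord V (.u ⟨k, hk⟩)) else 0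

theorem π_succ (e : Dir) (i : Fin (N + 1)) : T.π e (i + 1) =
    coord V (.du e i 0) - C (e.coeff ε) * quad h c₂ c₃ (coord V (.u i)) := dif_pos i.2

theorem π_last (e : Dir) : T.π e (N + 2) = 0 := dif_neg (lt_irrefl (N + 1))

/-- The right-hand sides of the cut-off system. -/
def rhs (i : Fin (N + 1)) : Fun V :=
  (T.v i - T.v (i + 1)) * T.π .x (i + 1) * T.π .y (i + 1) +
    (2 * C h * coord V (.u i) + C c₂) * (coord V (.du .x i 0) + C ε * coord V (.du .y i 0) -
      C ε * quad h c₂ c₃ (coord V (.u i)))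

/-- The values `ε_d r(u_i)`. -/
def ρ (_T : Cut V ε h c₂ c₃) (d : Dir) (i : Fin (N + 1)) : Fun V :=
  C (d.coeff ε) * quad h c₂ c₃ (coord V (.u i))

/-- The coefficients of the linear system. -/
def B (d : Dir) (i : Fin (N + 1)) : Fun V := (T.v i - T.v (i + 1)) * T.π d.other (i + 1) +
    C (d.other.coeff ε) * (2 * C h * T.w (i + 1) + C c₂)

theorem map_w_of_isVert {d : Dir} {X : Der V} (hX : IsVert V d X)
    (hu : ∀ i, X (coord V (.u i)) = 0) (k : ℕ) (hk : k ≤ N + 2) : X (T.w k) = 0 := by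
  rcases node_cases k hk with rfl | ⟨i, rfl⟩ | rfl
  · rw [T.w_zero, T.isBoundary_a.map_eq_zero hX]
  · rw [T.w_succ, hu]
  · rw [T.w_last, T.isBoundary_b.map_eq_zero hX]

theorem isVert_pd (d : Dir) (i : Fin (N + 1)) (k : ℕ) : IsVert V d.other (pd V (.du d i k)) :=
  ⟨isVF_pd _, fun e => by simp, fun j l => by simp [d.other_ne]⟩

theorem pd_w (d : Dir) (i : Fin (N + 1)) (l k : ℕ) (hk : k ≤ N + 2) :
    pd V (.du d i l) (T.w k) = 0 :=
  T.map_w_of_isVert (isVert_pd d i l) (fun j => by simp) k hk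

theorem pd_v (d : Dir) (i : Fin (N + 1)) (l k : ℕ) (hk : k ≤ N + 1) :
    pd V (.du d i l) (T.v k) = 0 := by
  rw [derivation_inv _ (T.mul_v k hk), map_sub, T.pd_w _ _ _ _ (by omega),
    T.pd_w _ _ _ _ (by omega)]
  ring

theorem pd_π (e e' : Dir) (i j : Fin (N + 1)) (l : ℕ) : pd V (.du e i l) (T.π e' (j + 1)) =
    if e' = e ∧ j = i ∧ 0 = l then 1 else 0 := by
  rw [π_succ, map_sub, Derivation.leibniz, map_quad, Derivation.map_algebraMap]
  simp

/-- This is the factored form of the chain: D ρ_i = ε_d r'(u_i) u_{i,e}, and the remainder is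
divisible by u_{i,d} - ρ_i. -/
theorem isLinearSystem (d : Dir) : IsLinearSystem d d.other T.rhs (T.ρ d) (T.B d) where
  ne := d.other_ne
  eq i := by
    rw [ρ, Derivation.leibniz, map_quad, freeTotal_u, Derivation.map_algebraMap, B, rhs, π_succ,
      π_succ, π_succ, T.w_succ]
    cases d <;> simp only [Dir.coeff, Dir.other, smul_eq_mul, map_one] <;> ring
  free_ρ i j k := by
    rw [ρ, Derivation.leibniz, map_quad, Derivation.map_algebraMap]
    simp
  free_B i j k := by
    have := i.2
    simp only [B, map_add, map_sub, Derivation.leibniz, T.pd_v d j k i (by omega),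
      T.pd_v d j k (i + 1) (by omega), T.pd_w d j k (i + 1) (by omega), T.pd_π, Derivation.map_algebraMap, d.other_ne]
    simp [← map_ofNat (algebraMap ℂ (Fun V))]

theorem freeTotal_w (e : Dir) (k : ℕ) (hk : k ≤ N + 2) : freeTotal V e (T.w k) =
    T.π e k + C (e.coeff ε) * quad h c₂ c₃ (T.w k) := by
  have hb : ∀ g : Fun V, IsBoundary ε h c₂ c₃ g →
      freeTotal V e g = C (e.coeff ε) * quad h c₂ c₃ g := fun g hg => by
    rw [hg.apply_t (isVF_freeTotal e) (d := e) (τ := 1) fun e' => by rw [freeTotal_t, map_one]]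
    simp
  rcases node_cases k hk with rfl | ⟨i, rfl⟩ | rfl
  · rw [T.w_zero, hb _ T.isBoundary_a]
    simp [π]
  · rw [T.w_succ, freeTotal_u, π_succ]
    ring
  · rw [T.w_last, hb _ T.isBoundary_b, π_last, zero_add]

/-- On a cut-off value the field gives τ ε_d r instead of ε_d r. The hypotheses hold for τ = 1
always, and for τ = 0 when the cut-off values are roots of r. -/
theorem prolField_w (d : Dir) {τ : ℂ} (ha : C τ * quad h c₂ c₃ T.a = quad h c₂ c₃ T.a)
    (hb : C τ * quad h c₂ c₃ T.b = quad h c₂ c₃ T.b) (k : ℕ) (hk : k ≤ N + 2) :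
    prolField d d.other τ (T.ρ d) (T.w k) = C (d.coeff ε) * quad h c₂ c₃ (T.w k) := by
  rcases node_cases k hk with rfl | ⟨i, rfl⟩ | rfl
  · rw [T.w_zero, T.isBoundary_a.apply_t (isVF_prolField _ _) (prolField_t _ _)]
    linear_combination C (d.coeff ε) * ha
  · rw [T.w_succ, prolField_u, ρ]
  · rw [T.w_last, T.isBoundary_b.apply_t (isVF_prolField _ _) (prolField_t _ _)]
    linear_combination C (d.coeff ε) * hb

/-- The characteristic operators, extended by zero. -/
def Y (d : Dir) (i : ℕ) : Der V := if hi : i < N + 1 then charOp V T.rhs d ⟨i, hi⟩ else 0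

theorem Y_coe (d : Dir) (i : Fin (N + 1)) : T.Y d i = charOp V T.rhs d i := dif_pos i.2

theorem isVert_Y (d : Dir) (i : ℕ) : IsVert V d (T.Y d i) := by
  rw [Y]
  split_ifs
  · exact IsLinearSystem.isVert_charOp _
  · exact .zero

theorem charOp_w (d : Dir) (i : Fin (N + 1)) (k : ℕ) (hk : k ≤ N + 2) :
    charOp V T.rhs d i (T.w k) = if k = i + 1 then 1 else 0 := by
  have := i.2
  have hv := IsLinearSystem.isVert_charOp (d := d) (f := T.rhs) i
  rcases node_cases k hk with rfl | ⟨j, rfl⟩ | rfl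
  · rw [T.w_zero, T.isBoundary_a.map_eq_zero hv, if_neg (by omega)]
  · rw [T.w_succ, IsLinearSystem.charOp_u]
    simp [Fin.ext_iff]
  · rw [T.w_last, T.isBoundary_b.map_eq_zero hv, if_neg (by omega)]

theorem charOp_π (d : Dir) (i : Fin (N + 1)) (k : ℕ) (hk : k ≤ N + 2) :
    charOp V T.rhs d i (T.π d.other k) =
      if k = i + 1 then (T.v i - T.v (i + 1)) * T.π d.other k else 0 := by
  have := i.2
  rcases node_cases k hk with rfl | ⟨j, rfl⟩ | rfl
  · rw [if_neg (by omega), show T.π d.other 0 = 0 from rfl, map_zero]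
  · rw [π_succ, map_sub, Derivation.leibniz, map_quad, Derivation.map_algebraMap,
      IsLinearSystem.charOp_u, (T.isLinearSystem d).charOp_du]
    by_cases hj : j = i
    · subst hj
      simp only [if_true, prolong, B, T.w_succ, π_succ, smul_eq_mul]
      ring
    · simp [hj, Fin.ext_iff.not.1 hj]
  · rw [π_last, map_zero, if_neg (by omega)]

/-- The abstract data of the cut-off system in the direction `d`. -/
def fields (d : Dir) (τ : ℂ) (ha : C τ * quad h c₂ c₃ T.a = quad h c₂ c₃ T.a)
    (hb : C τ * quad h c₂ c₃ T.b = quad h c₂ c₃ T.b) : CutoffFields (Fun V) N where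
  D := freeTotal V d.other
  R := prolField d d.other τ (T.ρ d)
  Y := T.Y d
  h := h
  c₂ := c₂
  c₃ := c₃
  ee := d.other.coeff ε
  ed := d.coeff ε
  w := T.w
  π := T.π d.other
  v := T.v
  Vert := IsVert V d
  vert_smul _ _ hZ := hZ.smul _
  vert_add _ _ hX hZ := hX.add hZ
  vert_lie _ _ hX hZ := hX.lie hZ
  vert_lie_R _ hZ := hZ.lie_prolField _ _
  vert_Y := T.isVert_Y d
  vert_ext Z m hZ hm hu := hZ.eq_zero d.other_ne m hm fun i => by
    rw [← T.w_succ]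
    exact hu i (Nat.lt_succ_iff.1 i.2)
  Y_gt i hi := dif_neg (by omega)
  Y_w i k hi hk := by
    rw [Y, dif_pos (by omega)]
    exact T.charOp_w d _ k hk
  Y_π i k hi hk := by
    rw [Y, dif_pos (by omega)]
    exact T.charOp_π d _ k hk
  D_w := T.freeTotal_w d.other
  R_w := T.prolField_w d ha hb
  lie_D_R := lie_freeTotal_prolField _ d.other_ne τ
  lie_D_Y i hi := by
    rw [Y, dif_pos (by omega)]
    exact (T.isLinearSystem d).lie_freeTotal_charOp _
  π_zero := rfl
  d_mul_v := T.mul_v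

theorem multiOp_eq_nested (d : Dir) (i k : ℕ) :
    multiOp V T.rhs d i k = nested (T.Y d) i k := by
  induction k with
  | zero => rfl
  | succ k ih => rw [multiOp, nested, ih]; rfl

theorem family_eq (d : Dir) (Z : Der V) :
    family V T.rhs d Z = nestedFamily N (restOp V T.rhs d Z) (T.Y d) := by
  funext q
  rcases q with _ | q
  · rfl
  · exact T.multiOp_eq_nested d _ _

end Cut

end Chain

end

/-! ### Characteristic algebras of the cut-off system. -/

noncomputable section

namespace Chain

variable {N : ℕ} {V : Opens (Jet N)}

local notation "C" => algebraMap ℂ (Fun V)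

namespace Cut

variable {ε h c₂ c₃ : ℂ} (T : Cut V ε h c₂ c₃)

section Algebra

variable (d : Dir) {τ : ℂ} (ha : algebraMap ℂ (Fun V) τ * quad h c₂ c₃ T.a = quad h c₂ c₃ T.a)
    (hb : algebraMap ℂ (Fun V) τ * quad h c₂ c₃ T.b = quad h c₂ c₃ T.b)

theorem R_sub_restOp_mem : (T.fields d τ ha hb).R -
    restOp V T.rhs d (τ • pd V (.t d) + charField V T.rhs d) ∈
      Submodule.span (Fun V) (Set.range fun q : ℕ × ℕ => nested (T.Y d) q.1 q.2) := by
  rw [(T.isLinearSystem d).restOp_eq]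
  change prolField d d.other τ (T.ρ d) - _ ∈ _
  rw [sub_sub_cancel]
  refine Submodule.sum_mem _ fun i _ => Submodule.smul_mem _ _ (Submodule.subset_span ⟨(i, 0), ?_⟩)
  exact T.Y_coe d i

include ha hb in
-- The family is made of generators and their commutators, so any admissible subalgebra contains its
-- span. Conversely the span equals that of the normalized family, is closed under commutators, and
-- contains the generators.
theorem span_family_eq_charAlg :
    Submodule.span (Fun V) (Set.range
      (family V T.rhs d (τ • pd V (.t d) + charField V T.rhs d))) =
        charAlg V T.rhs d (τ • pd V (.t d) + charField V T.rhs d) := by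
  have h1 := (T.fields d τ ha hb).span_family (T.R_sub_restOp_mem d ha hb)
  have h2 := T.family_eq d (τ • pd V (.t d) + charField V T.rhs d)
  generalize τ • pd V (.t d) + charField V T.rhs d = Z at h1 h2 ⊢
  change Submodule.span _ (Set.range (nestedFamily N _ (T.Y d))) = _ at h1
  rw [← h2] at h1
  have hY : ∀ i, charOp V T.rhs d i ∈ Submodule.span (Fun V) (Set.range (family V T.rhs d Z)) :=
    fun i => Submodule.subset_span ⟨some ⟨(i, 0), Nat.lt_succ_iff.1 i.2⟩, by
      rw [h2]; exact T.Y_coe d i⟩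
  have hZ : Z = restOp V T.rhs d Z + ∑ i, coord V (.du d i 0) • charOp V T.rhs d i := by
    rw [restOp, sub_add_cancel]
  apply le_antisymm
  · refine le_sInf ?_
    rintro _ ⟨L, hL, hLY, rfl⟩
    have hm : ∀ j, (if h : j < N + 1 then charOp V T.rhs d ⟨j, h⟩ else 0) ∈ L := fun j => by
      split_ifs
      · exact hLY _
      · exact L.zero_mem
    rw [Submodule.span_le]
    rintro _ ⟨_ | ⟨⟨i, k⟩, hq⟩, rfl⟩
    · exact L.toSubmodule.sub_mem hL (L.toSubmodule.sum_mem fun i _ =>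
        L.toSubmodule.smul_mem _ (hLY i))
    · change multiOp V T.rhs d i k ∈ L
      clear hq
      induction k with
      | zero => exact hm i
      | succ k ih => exact L.lie_mem (hm _) ih
  · refine sInf_le ⟨⟨Submodule.span (Fun V) (Set.range (family V T.rhs d Z)), ?_⟩, ?_, hY, rfl⟩
    · intro X X' hX hX'
      change X ∈ Submodule.span _ _ at hX
      change X' ∈ Submodule.span _ _ at hX'
      change _ ∈ Submodule.span _ _
      rw [h1] at hX hX' ⊢
      exact (T.fields d τ ha hb).span_closed hX hX'
    · change Z ∈ Submodule.span _ _
      have hR : restOp V T.rhs d Z ∈ Submodule.span (Fun V) (Set.range (family V T.rhs d Z)) :=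
        Submodule.subset_span ⟨none, rfl⟩
      have := Submodule.add_mem _ hR
        (Submodule.sum_mem (t := Finset.univ) _ fun i _ => Submodule.smul_mem _ (coord V (.du d i 0)) (hY i))
      rwa [← hZ] at this

theorem p_mem_nonZeroDivisors (k : ℕ) (hk : k ≤ N) :
    (T.fields d τ ha hb).p (k + 1) ∈ nonZeroDivisors (Fun V) := by
  refine mul_mem ?_ ?_
  · refine mem_nonZeroDivisors_of_pd (.du d.other ⟨k, by omega⟩ 0) _ ?_
    change pd V _ (T.π d.other (k + 1)) = 1
    have := T.pd_π d.other d.other ⟨k, by omega⟩ ⟨k, by omega⟩ 0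
    simpa using this
  · exact (IsUnit.of_mul_eq_one_right _ (T.mul_v (k + 1) (by omega))).mem_nonZeroDivisors

theorem linearIndependent_family
    (hR : ∀ (g : Fun V) (c : ℕ → ℕ → Fun V), g • (T.fields d τ ha hb).R +
      (T.fields d τ ha hb).comb c = 0 → g = 0) :
    LinearIndependent (Fun V) (family V T.rhs d (τ • pd V (.t d) + charField V T.rhs d)) := by
  rw [T.family_eq]
  exact (T.fields d τ ha hb).linearIndependent_family (T.R_sub_restOp_mem d ha hb)
    (T.p_mem_nonZeroDivisors d ha hb) hR

theorem hasExplicitBasis : HasExplicitBasis V T.rhs d := by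
  have ha : C 1 * quad h c₂ c₃ T.a = quad h c₂ c₃ T.a := by rw [map_one, one_mul]
  have hb : C 1 * quad h c₂ c₃ T.b = quad h c₂ c₃ T.b := by rw [map_one, one_mul]
  have h1 := T.span_family_eq_charAlg d ha hb
  have h2 := T.linearIndependent_family d ha hb
    -- For τ = 1 the prolonged field sends t_d to 1, whereas vertical fields kill it.
    ((T.fields d 1 ha hb).coeff_R_eq_zero_of_apply (x := coord V (.t d))
      ((prolField_t _ _ _).trans (by simp)) fun Z hZ => hZ.t d)
  rw [one_smul] at h1 h2
  exact ⟨h2, h1⟩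

theorem span_family_charField (ha : quad h c₂ c₃ T.a = 0) (hb : quad h c₂ c₃ T.b = 0) :
    Submodule.span (Fun V) (Set.range (family V T.rhs d (charField V T.rhs d))) =
      charAlg V T.rhs d (charField V T.rhs d) := by
  have h1 := T.span_family_eq_charAlg d (τ := 0) (by simp [ha]) (by simp [hb])
  rwa [zero_smul, zero_add] at h1

theorem linearIndependent_family_charField {l : ℂ} (ha : T.a = C l) (hb : T.b = C l)
    (hl : h * l ^ 2 + c₂ * l + c₃ = 0) (hl' : d.coeff ε * (2 * h * l + c₂) ≠ 0) :
    LinearIndependent (Fun V) (family V T.rhs d (charField V T.rhs d)) := by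
  have h0 : quad h c₂ c₃ (C l) = 0 := by
    simp only [quad, ← map_pow, ← map_mul, ← map_add, hl, map_zero]
  have ha' : C 0 * quad h c₂ c₃ T.a = quad h c₂ c₃ T.a := by simp [ha, h0]
  have hb' : C 0 * quad h c₂ c₃ T.b = quad h c₂ c₃ T.b := by simp [hb, h0]
  have h2 := T.linearIndependent_family d ha' hb'
    ((T.fields d 0 ha' hb').coeff_R_eq_zero_of_root (l := l) (T.w_zero.trans ha)
      (T.w_last.trans hb) hl hl' (T.p_mem_nonZeroDivisors d ha' hb'))
  rwa [zero_smul, zero_add] at h2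

end Algebra

/-! ### Agreement with the right-hand sides of the chain on an open set. -/

section Representation

variable {φ₁ φ₂ : Cutoff}

variable (V φ₁ φ₂) in
/-- The cut-off functions are represented by elements of the ring. -/
structure IsCutoff (a b : Fun V) : Prop where
  fst : ∀ p : V, a.val p =
    φ₁ (p.1 (.t .x)) (p.1 (.t .y)) (List.ofFn fun i : Fin (N + 1) => p.1 (.u i))
  snd : ∀ p : V, b.val p =
    φ₂ (p.1 (.t .x)) (p.1 (.t .y)) (List.ofFn fun i : Fin (N + 1) => p.1 (.u i)).reverse

/-- The nodes as elements of the ring. -/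
def nodes (a b : Fun V) : ℕ → Fun V
  | 0 => a
  | k + 1 => if hk : k < N + 1 then coord V (.u ⟨k, hk⟩) else b

theorem node_eq {a b : Fun V} (hab : IsCutoff V φ₁ φ₂ a b) (p : V) (k : ℕ) (hk : k ≤ N + 2) :
    node N φ₁ φ₂ p.1 ((k : ℤ) - 1) = (nodes a b k).val p := by
  cases k with
  | zero => rw [node, if_pos (by simp)]; exact (hab.fst p).symm
  | succ k =>
    rw [show ((k + 1 : ℕ) : ℤ) - 1 = k by simp, node, if_neg (by simp), nodes]
    simp only [Int.toNat_natCast]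
    split_ifs
    · rfl
    · exact (hab.snd p).symm

theorem node_triple {a b : Fun V} (hab : IsCutoff V φ₁ φ₂ a b) (p : V) (i : Fin (N + 1)) :
    node N φ₁ φ₂ p.1 ((i : ℕ) + 1) = (nodes a b (i + 2)).val p ∧
      node N φ₁ φ₂ p.1 (i : ℕ) = (nodes a b (i + 1)).val p ∧
      node N φ₁ φ₂ p.1 ((i : ℕ) - 1) = (nodes a b i).val p := by
  have hi := i.2
  rw [← node_eq hab p (i + 2) (by omega), ← node_eq hab p (i + 1) (by omega),
    ← node_eq hab p i (by omega)]
  refine ⟨congrArg _ ?_, congrArg _ ?_, rfl⟩ <;> push_cast <;> ring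

theorem sub_nodes_ne_zero {a b : Fun V} (hab : IsCutoff V φ₁ φ₂ a b)
    (hV : (V : Set (Jet N)) ⊆ cutDom N chainDom φ₁ φ₂) (k : ℕ) (hk : k ≤ N + 1) (p : V) :
    (nodes a b (k + 1) - nodes a b k).val p ≠ 0 := by
  rw [Fun.val_sub, sub_ne_zero]
  rcases Nat.lt_or_ge k (N + 1) with h | h
  · have h1 := hV p.2 ⟨k, h⟩
    obtain ⟨e1, e2, e3⟩ := node_triple hab p ⟨k, h⟩
    rw [e1, e2, e3] at h1
    exact h1.1
  · obtain rfl : k = N + 1 := by omega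
    have h1 := hV p.2 ⟨N, by omega⟩
    obtain ⟨e1, e2, e3⟩ := node_triple hab p ⟨N, by omega⟩
    rw [e1, e2, e3] at h1
    exact h1.2

/-- The system on an open subset of its domain. -/
def ofCutoff {a b : Fun V} (hab : IsCutoff V φ₁ φ₂ a b)
    (hV : (V : Set (Jet N)) ⊆ cutDom N chainDom φ₁ φ₂)
    (ha : IsBoundary ε h c₂ c₃ a) (hb : IsBoundary ε h c₂ c₃ b) : Cut V ε h c₂ c₃ where
  a := a
  b := b
  v k := if hk : k ≤ N + 1 then (nodes a b (k + 1) - nodes a b k).inv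
    (sub_nodes_ne_zero hab hV k hk) else 0
  isBoundary_a := ha
  isBoundary_b := hb
  w := nodes a b
  w_zero := rfl
  w_succ i := dif_pos i.2
  w_last := dif_neg (lt_irrefl (N + 1))
  mul_v k hk := by rw [dif_pos hk]; exact Fun.mul_inv _ _

theorem represents {c₁ : ℂ} {a b : Fun V} (hab : IsCutoff V φ₁ φ₂ a b)
    (hV : (V : Set (Jet N)) ⊆ cutDom N chainDom φ₁ φ₂)
    (ha : IsBoundary ε (c₁ / 2) c₂ c₃ a) (hb : IsBoundary ε (c₁ / 2) c₂ c₃ b) :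
    Represents V (cutRHS N (chain c₁ c₂ c₃ ε) φ₁ φ₂) (ofCutoff hab hV ha hb).rhs := fun i p => by
  have hi := i.2
  obtain ⟨e1, e2, e3⟩ := node_triple hab p i
  have hu : nodes a b (i + 1) = coord V (.u i) := dif_pos i.2
  rw [cutRHS, e1, e2, e3, rhs, π_succ, π_succ, hu, ← map_ofNat (algebraMap ℂ (Fun V))]
  simp only [ofCutoff]
  rw [dif_pos (show (i : ℕ) ≤ N + 1 by omega), dif_pos (show (i : ℕ) + 1 ≤ N + 1 by omega)]
  simp only [Fun.val_add, Fun.val_mul, Fun.val_sub, Fun.val_inv, Fun.val_algebraMap, val_coord,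
    quad, Fun.val_pow, chain, α, β, γ, δ, r, r', Dir.coeff, hu]
  ring

end Representation

end Cut

end Chain

end

/-! ### Complete sets of integrals. -/

noncomputable section

namespace Chain

variable {N : ℕ}

namespace CutoffFields

variable {A : Type*} [CommRing A] [Algebra ℂ A] (S : CutoffFields A N) {z y : ℕ → A}
  (hz : ∀ k, 1 ≤ k → k ≤ N + 1 → S.s k * z k = 1) (hy : ∀ k, k ≤ N → S.p (k + 1) * y k = 1)

section Constants

variable {X : Derivation ℂ A A} (hw : ∀ k, k ≤ N + 2 → X (S.w k) = 0)
include hw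

theorem map_s {k : ℕ} (hk : k ≤ N + 2) : X (S.s k) = 0 := by
  rw [s, map_sub, hw k hk, hw 0 (by omega), sub_zero]

theorem map_σ (k : ℕ) : X (S.σ k) = 0 := by
  rw [σ]
  split_ifs
  · simp
  · exact S.map_s hw le_rfl

theorem map_p {k : ℕ} (hk : k ≤ N + 1) : X (S.p k) = S.v k * X (S.π k) := by
  rw [p, Derivation.leibniz, derivation_inv X (S.d_mul_v k hk), map_sub, hw _ (by omega),
    hw k (by omega)]
  simp

include hz hy in
theorem map_q_of_π {k : ℕ} (hk : k ≤ N) {b : A} (hb : X (S.π (k + 1)) = b) :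
    X (S.q z y k) = S.q z y k * -(y k * S.v (k + 1) * b) := by
  rw [S.map_q hz hy hk (X := X) (a := 0) (b := y k * S.v (k + 1) * b) (c := 0)
    (by rw [S.map_s hw (by omega), zero_mul])
    (by
      rw [S.map_p hw (by omega), hb]
      linear_combination (-S.v (k + 1) * b) * hy k hk)
    fun _ => by rw [S.map_s hw (by omega), zero_mul]]
  simp
  ring

include hz hy in
theorem map_coeffs_of_constants (hD : ⁅S.D, X⁆ = 0) (hπ : ∀ k, k ≤ N → X (S.π (k + 1)) = 0)
    (l : ℕ) : X (coeffs S.D (S.q z y) S.σ (N + 1) l) = 0 :=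
  map_coeffs_eq_zero (μ := 0) (by rw [hD, zero_smul]) (fun k _ => S.map_σ hw k)
    (fun k hk => by
      rw [S.map_q_of_π hz hy hw (by omega) (hπ k (by omega)), mul_zero, neg_zero, mul_zero]) l

end Constants

include hz hy in
theorem isUnit_coeffs_last : IsUnit (coeffs S.D (S.q z y) S.σ (N + 1) (N + 1)) := by
  rw [coeffs_self]
  refine Finset.prod_induction _ IsUnit (fun _ _ => IsUnit.mul) isUnit_one fun k hk => ?_
  rw [Finset.mem_range] at hk
  have h1 := IsUnit.of_mul_eq_one _ (hz (k + 1) (by omega) (by omega))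
  have h2 := IsUnit.of_mul_eq_one_right _ (hy k (by omega))
  rw [q]
  split_ifs with h
  · exact (h1.mul h2).mul (IsUnit.of_mul_eq_one_right _ (hz (k + 2) (by omega) (by omega)))
  · exact (h1.mul h2).mul isUnit_one

end CutoffFields

/-- The matrix of the reversed binomial coefficients is invertible. -/
theorem det_choose_ne_zero (N : ℕ) :
    (Matrix.of fun j i : Fin (N + 1) => ((N - (i : ℕ)).choose j : ℂ)).det ≠ 0 := by
  set M := Matrix.of fun j i : Fin (N + 1) => ((N - (i : ℕ)).choose j : ℂ) with hM
  -- Reversing the columns gives the upper triangular Pascal matrix.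
  have h1 : (M.submatrix id Fin.revPerm).det = 1 := by
    have h2 : ∀ j i, M.submatrix id Fin.revPerm j i = ((i : ℕ).choose j : ℂ) := fun j i => by
      rw [hM, Matrix.submatrix_apply, Matrix.of_apply, Fin.revPerm_apply, Fin.val_rev, id,
        show N - (N + 1 - ((i : ℕ) + 1)) = i by omega]
    rw [Matrix.det_of_isUpperTriangular fun i j hij => by
      rw [h2, Nat.choose_eq_zero_of_lt (show (j : ℕ) < i from hij), Nat.cast_zero]]
    exact Finset.prod_eq_one fun i _ => by rw [h2, Nat.choose_self, Nat.cast_one]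
  rw [Matrix.det_permute'] at h1
  intro h0
  rw [h0, mul_zero] at h1
  exact zero_ne_one h1

variable {V : Opens (Jet N)}

local notation "C" => algebraMap ℂ (Fun V)

theorem Fun.val_ne_zero_of_isUnit {g : Fun V} (hg : IsUnit g) (p : V) : g.val p ≠ 0 := by
  have := hg.map (evalHom p)
  exact this.ne_zero

theorem IsFree.total_eq {f : Fin (N + 1) → Fun V} {d : Dir} {g : Fun V} (hg : IsFree V d g) :
    total V f d g = (pd V (.t d) + charField V f d) g := by
  rw [((isVF_pd _).add (isVF_charField f d)).apply, (show IsVF (total V f d) from isVF_vf _).apply]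
  refine finsum_congr fun c => ?_
  rw [Derivation.add_apply, total, charField, vf_coord, vf_coord, pd_coord]
  rcases c with e | i | ⟨e, i, k⟩
  · simp
  · simp
  · by_cases he : e = d
    · subst he
      rw [hg]
      simp
    · simp [he]

namespace Cut

variable {ε h c₂ c₃ : ℂ} (T : Cut V ε h c₂ c₃)

/-- On functions free of d-derivatives the total derivative along d is ∂/∂t_d + Y, a combination of
the prolonged field and the Y_i. -/
theorem isIntegral_of_map_eq_zero {d : Dir} {g : Fun V} (hg : IsFree V d g)
    (hR : prolField d d.other 1 (T.ρ d) g = 0) (hY : ∀ i, charOp V T.rhs d i g = 0) :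
    IsIntegral V T.rhs d g := by
  refine ⟨?_, hg⟩
  have h1 := (T.isLinearSystem d).charField_eq 1
  rw [one_smul] at h1
  rw [hg.total_eq, h1, Derivation.add_apply, hR, zero_add, sum_derivation_apply]
  exact Finset.sum_eq_zero fun i _ => by rw [Derivation.smul_apply, hY, smul_zero]

/-- The complete set of integrals, where all `u_{i,x} - ε r(u_i)`, `u_{i,y} - r(u_i)` and all
differences with the first node are invertible. -/
theorem hasCompleteIntegrals (d : Dir)
    (hs : ∀ k, 1 ≤ k → k ≤ N + 1 → IsUnit (T.w k - T.w 0))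
    (hπ : ∀ i : Fin (N + 1), IsUnit (T.π d.other (i + 1)))
    (hω : (C h * (T.b + T.a) + C c₂) * (T.b - T.a) = 0)
    (hDω : ∀ X : Der V, X (C h * (T.b + T.a) + C c₂) = 0)
    (haut : (∀ i e, pd V (.t e) (T.rhs i) = 0) → ∀ e, pd V (.t e) T.a = 0 ∧ pd V (.t e) T.b = 0) :
    HasCompleteIntegrals V T.rhs d := by
  have ha : C 1 * quad h c₂ c₃ T.a = quad h c₂ c₃ T.a := by rw [map_one, one_mul]
  have hb : C 1 * quad h c₂ c₃ T.b = quad h c₂ c₃ T.b := by rw [map_one, one_mul]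
  obtain ⟨S, hS⟩ : ∃ S, S = T.fields d 1 ha hb := ⟨_, rfl⟩
  have hD : S.D = freeTotal V d.other := by rw [hS]; rfl
  have hw : S.w = T.w := by rw [hS]; rfl
  have hSπ : S.π = T.π d.other := by rw [hS]; rfl
  have hv : S.v = T.v := by rw [hS]; rfl
  have hdv : ∀ k, k ≤ N + 1 → IsUnit (T.v k) := fun k hk =>
    IsUnit.of_mul_eq_one_right _ (T.mul_v k hk)
  have hz : ∃ z : ℕ → Fun V, ∀ k, 1 ≤ k → k ≤ N + 1 → S.s k * z k = 1 := by
    have : ∀ k, ∃ z, 1 ≤ k → k ≤ N + 1 → S.s k * z = 1 := fun k => by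
      by_cases hk : 1 ≤ k ∧ k ≤ N + 1
      · obtain ⟨z, hz⟩ := (hs k hk.1 hk.2).exists_right_inv
        exact ⟨z, fun _ _ => by rw [CutoffFields.s, hw, hz]⟩
      · exact ⟨0, fun h1 h2 => absurd ⟨h1, h2⟩ hk⟩
    exact ⟨_, fun k => (this k).choose_spec⟩
  have hy : ∃ y : ℕ → Fun V, ∀ k, k ≤ N → S.p (k + 1) * y k = 1 := by
    have : ∀ k, ∃ y, k ≤ N → S.p (k + 1) * y = 1 := fun k => by
      by_cases hk : k ≤ N
      · obtain ⟨y, hy⟩ := ((hπ ⟨k, by omega⟩).mul (hdv (k + 1) (by omega))).exists_right_inv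
        exact ⟨y, fun _ => by rw [CutoffFields.p, hSπ, hv, hy]⟩
      · exact ⟨0, fun h1 => absurd h1 hk⟩
    exact ⟨_, fun k => (this k).choose_spec⟩
  obtain ⟨z, hz⟩ := hz
  obtain ⟨y, hy⟩ := hy
  obtain ⟨K, hK⟩ := (S.isUnit_coeffs_last hz hy).exists_right_inv
  have hfree : ∀ i l k, k ≤ N + 2 → pd V (.du d i l) (S.w k) = 0 := fun i l k hk => by
    rw [hw]; exact T.pd_w d i l k hk
  have hpd : ∀ i l k, k ≤ N + 2 → pd V (.du d.other i l) (S.w k) = 0 := fun i l k hk => by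
    rw [hw]; exact T.pd_w _ i l k hk
  have hP : ∀ (i : Fin (N + 1)) (k : ℕ) (g : Fun V), pd V (.du d.other i (k + 1)) (S.D g) =
      S.D (pd V (.du d.other i (k + 1)) g) + pd V (.du d.other i k) g := fun i k g => by
    rw [hD]; exact pd_freeTotal_du_succ _ _ _ _
  have hPσ : ∀ (i : Fin (N + 1)) (j k : ℕ), j < N + 1 → pd V (.du d.other i k) (S.σ j) = 0 :=
    fun i j k _ => S.map_σ (hpd i k) j
  have hPq : ∀ (i : Fin (N + 1)) (j k : ℕ), j < N + 1 →
      pd V (.du d.other i k) (S.q z y j) =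
        S.q z y j * -(y j * S.v (j + 1) * if j = i ∧ 0 = k then 1 else 0) := fun i j k hj => by
    refine S.map_q_of_π hz hy (hpd i k) (by omega) ?_
    rw [hSπ, show j = ((⟨j, hj⟩ : Fin (N + 1)) : ℕ) from rfl, T.pd_π]
    simp [Fin.ext_iff]
  have hPq1 : ∀ (i : Fin (N + 1)) (j k : ℕ), j < N + 1 →
      pd V (.du d.other i (k + 1)) (S.q z y j) = 0 := fun i j k hj => by
    rw [hPq i j _ hj, if_neg (by omega)]; simp
  have hPq0 : ∀ (i : Fin (N + 1)) (j : ℕ), j < N + 1 → pd V (.du d.other i 0) (S.q z y j) =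
      if j = i then S.q z y j * -(y i * S.v (i + 1)) else 0 := fun i j hj => by
    rw [hPq i j _ hj]
    split_ifs with h1 h2 h2
    · rw [h2, mul_one]
    · exact absurd h1.1 h2
    · exact absurd ⟨h2, rfl⟩ h1
    · simp
  -- The coordinate index k stands for a derivative of order k + 1, so these integrals have order
  -- max 1 j + 1.
  refine ⟨fun j => integral S.D (S.q z y) S.σ N K j, fun j => max 1 j, fun j => ?_,
    fun j i k hk => ?_, fun p => ?_, fun h0 j e => ?_⟩
  · refine T.isIntegral_of_map_eq_zero (fun i k => ?_) ?_ fun i => ?_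
    · have hl : ⁅S.D, pd V (.du d i k)⁆ = 0 := Derivation.ext fun g => by
        rw [hD, Derivation.commutator_apply, pd_freeTotal_du_of_ne d.other_ne, sub_self,
          Derivation.zero_apply]
      refine map_integral_eq_zero hK (μ := 0) (by rw [hl, zero_smul])
        (S.map_coeffs_of_constants hz hy (hfree i k) hl fun l hl => ?_) j
      rw [hSπ, show l = ((⟨l, by omega⟩ : Fin (N + 1)) : ℕ) from rfl, T.pd_π, if_neg]
      exact fun h => d.other_ne h.1
    · have hw0 : S.w 0 = T.a := by rw [hw, T.w_zero]
      have hwl : S.w (N + 2) = T.b := by rw [hw, T.w_last]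
      have h1 := S.R_coeffs hz hy (by
        rw [CutoffFields.s, hw0, hwl, show S.h = h by rw [hS]; rfl, show S.c₂ = c₂ by rw [hS]; rfl]
        linear_combination C S.ed * hω)
      have h2 := map_integral_of_scale hK S.lie_D_R (by
        rw [hw0, hwl, show S.h = h by rw [hS]; rfl, show S.c₂ = c₂ by rw [hS]; rfl,
          Derivation.leibniz, hDω, Derivation.map_algebraMap]
        simp) h1 j
      rwa [show S.R = prolField d d.other 1 (T.ρ d) by rw [hS]; rfl] at h2
    · have hY : S.Y i = charOp V T.rhs d i := by rw [hS]; exact T.Y_coe d i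
      rw [← hY]
      exact map_integral_eq_zero hK (S.lie_D_Y i (by omega)) (S.Y_coeffs hz hy (by omega)) j
  · exact order_integral (P := fun k => pd V (.du d.other i k)) hK (hP i) (hPσ i) (hPq1 i) j k
      (by omega) hk
  · have hsym : ∀ j i : Fin (N + 1), pd V (.du d.other i (max 1 j))
        (integral S.D (S.q z y) S.σ N K j) =
          ((N - i : ℕ).choose j : Fun V) * -(y i * S.v (i + 1)) := fun j i =>
      symbol_integral (P := fun k => pd V (.du d.other i k)) hK (hP i) (hPσ i) (hPq1 i)
        (by omega) (hPq0 i) j (by omega)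
    have hM : (Matrix.of fun j i : Fin (N + 1) => (pd V (.du d.other i (max 1 (j : ℕ)))
        (integral S.D (S.q z y) S.σ N K j)).val p) = Matrix.of fun j i : Fin (N + 1) =>
          (-(y i * S.v (i + 1))).val p *
            (Matrix.of fun j i : Fin (N + 1) => ((N - (i : ℕ)).choose j : ℂ)) j i := by
      ext j i
      rw [Matrix.of_apply, hsym, Matrix.of_apply, Matrix.of_apply, Fun.val_mul, mul_comm]
      congr 1
    rw [hM, Matrix.det_mul_row]
    refine mul_ne_zero (Finset.prod_ne_zero_iff.2 fun i _ => ?_) (det_choose_ne_zero N)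
    refine Fun.val_ne_zero_of_isUnit (IsUnit.neg (IsUnit.mul ?_ ?_)) p
    · exact IsUnit.of_mul_eq_one_right _ (hy i (by omega))
    · rw [hv]; exact hdv _ (by omega)
  -- If the cut-off values are independent of t_e, then so are all nodes and all π, hence every q
  -- and σ; ∂/∂t_e commutes with D and so kills the integrals.
  · have hl : ⁅S.D, pd V (.t e)⁆ = 0 := Derivation.ext fun g => by
      rw [hD, Derivation.commutator_apply, pd_freeTotal_t, sub_self, Derivation.zero_apply]
    refine map_integral_eq_zero hK (μ := 0) (by rw [hl, zero_smul])
      (S.map_coeffs_of_constants hz hy (fun k hk => ?_) hl fun l hl => ?_) j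
    · rw [hw]
      rcases node_cases k hk with rfl | ⟨i, rfl⟩ | rfl
      · rw [T.w_zero]; exact (haut h0 e).1
      · rw [T.w_succ]; simp
      · rw [T.w_last]; exact (haut h0 e).2
    · rw [hSπ, show l = ((⟨l, by omega⟩ : Fin (N + 1)) : ℕ) from rfl, π_succ, map_sub,
        Derivation.leibniz, map_quad, Derivation.map_algebraMap]
      simp

end Cut

end Chain

end

/-! ### Generic points and Darboux integrability. -/

noncomputable section

namespace Chain

variable {N : ℕ} {V : Opens (Jet N)}

local notation "C" => algebraMap ℂ (Fun V)

theorem Fun.isUnit_of_val_ne_zero {g : Fun V} (hg : ∀ p, g.val p ≠ 0) : IsUnit g :=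
  IsUnit.of_mul_eq_one _ (g.mul_inv hg)

/-- Functions that are not zero divisors do not vanish on a common nonempty open set. -/
theorem exists_opens_val_ne_zero (hV : (V : Set (Jet N)).Nonempty) {ι : Type*} (s : Finset ι)
    (g : ι → Fun V) (hg : ∀ i ∈ s, g i ∈ nonZeroDivisors (Fun V)) :
    ∃ U : Opens (Jet N), (U : Set (Jet N)).Nonempty ∧ U ≤ V ∧
      ∀ p : V, p.1 ∈ U → ∀ i ∈ s, (g i).val p ≠ 0 := by
  have hG : ∏ i ∈ s, g i ∈ nonZeroDivisors (Fun V) := Submonoid.prod_mem _ hg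
  have hval : ∀ p : V, (∏ i ∈ s, g i).val p = ∏ i ∈ s, (g i).val p := fun p =>
    map_prod (evalHom p) _ _
  generalize ∏ i ∈ s, g i = G at hG hval
  refine ⟨⟨Subtype.val '' {p : V | G.val p ≠ 0}, V.isOpen.isOpenMap_subtype_val _
    (isOpen_ne_fun G.continuous_val continuous_const)⟩, ?_, ?_, ?_⟩
  · by_contra hne
    obtain ⟨p, hp⟩ := hV
    have h0 : G = 0 := Fun.ext fun q => by
      by_contra hq
      exact hne ⟨q.1, q, hq, rfl⟩
    have h1 : (1 : Fun V) = 0 := (mem_nonZeroDivisors_iff_right.1 hG) 1 (by rw [h0, mul_zero])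
    have h2 := congrArg (fun g : Fun V => g.val ⟨p, hp⟩) h1
    exact one_ne_zero h2
  · rintro _ ⟨p, -, rfl⟩
    exact p.2
  · rintro p ⟨q, hq, hqp⟩ i hi
    obtain rfl : q = p := Subtype.ext hqp
    have hq' : G.val q ≠ 0 := hq
    rw [hval] at hq'
    exact Finset.prod_ne_zero_iff.1 hq' i hi

namespace Cut

variable {ε h c₂ c₃ : ℂ}

/-- An autonomous system must get autonomous integrals, so for constant r the moving cut-off values
have to be stationary. Autonomy of f_0 = (v_0 - v_1) π^x π^y gives ∂_y v_0 = ∂_y v_1. For N > 0 only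
v_0 involves a cut-off value, and v_0² c₃ = 0. -/
theorem coeff_eq_zero_of_autonomous (T : Cut V ε 0 0 c₃) (p : V)
    (hπ : ∀ (e : Dir) (i : Fin (N + 1)), IsUnit (T.π e (i + 1)))
    (h0 : ∀ i e, pd V (.t e) (T.rhs i) = 0) : c₃ = 0 := by
  have hq : ∀ g : Fun V, quad 0 0 c₃ g = C c₃ := fun g => by simp [quad]
  have hXπ : ∀ e (i : Fin (N + 1)), pd V (.t .y) (T.π e (i + 1)) = 0 := fun e i => by
    rw [π_succ, hq, ← map_mul, map_sub, Derivation.map_algebraMap]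
    simp
  have h1 : pd V (.t .y) (T.v 0) = pd V (.t .y) (T.v 1) := by
    have h2 := h0 0 .y
    simp only [rhs, map_zero, mul_zero, zero_mul, add_zero, Derivation.leibniz, hXπ, map_sub,
      zero_add, smul_eq_mul] at h2
    have h3 := ((hπ .y 0).mul_right_eq_zero.1 h2)
    rw [(hπ .x 0).mul_right_eq_zero] at h3
    exact sub_eq_zero.1 h3
  have hw0 : T.w 0 = T.a := T.w_zero
  have hw1 : T.w 1 = coord V (.u 0) := T.w_succ 0
  have e0 := T.mul_v 0 (by omega)
  have e1 := T.mul_v 1 (by omega)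
  have hXa : ∀ g : Fun V, IsBoundary ε 0 0 c₃ g → pd V (.t .y) g = C c₃ := fun g hg => by
    rw [hg.t, hq, Dir.coeff, map_one, one_mul]
  have hv : ∀ k, k ≤ N + 1 → (T.v k).val p ≠ 0 := fun k hk =>
    Fun.val_ne_zero_of_isUnit (IsUnit.of_mul_eq_one_right _ (T.mul_v k hk)) p
  rw [derivation_inv _ e0, derivation_inv _ e1] at h1
  simp only [zero_add, map_sub, hw0, hw1, hXa _ T.isBoundary_a, pd_coord] at h1
  by_cases hN : N = 0
  · have hw2 : T.w (1 + 1) = T.b := by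
      have := T.w_last
      rwa [show N + 2 = 1 + 1 by omega] at this
    rw [hw2, hXa _ T.isBoundary_b] at h1
    have h2 : (T.v 0 ^ 2 + T.v 1 ^ 2) * C c₃ = 0 := by
      simp only [reduceCtorEq, if_false] at h1
      linear_combination h1
    have h3 := congrArg (pd V (.u 0)) h2
    simp only [Derivation.leibniz, Derivation.leibniz_pow, map_add, Derivation.map_algebraMap,
      derivation_inv _ e0, derivation_inv _ e1, zero_add, map_sub, hw0, hw1, hw2,
      T.isBoundary_a.u, T.isBoundary_b.u, pd_coord, map_zero] at h3
    simp only [if_true, smul_eq_mul, nsmul_eq_mul, Nat.cast_ofNat] at h3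
    -- For N = 0 both ends move and (v_0² + v_1²) c₃ = 0. Its u_0-derivative is 2(v_1³ - v_0³) c₃ =
    -- 0; the first relation makes v_0⁶ c₃ and v_1⁶ c₃ opposite and the second makes them equal.
    have h4 : 4 * (T.v 1 ^ 6 * C c₃) = 0 := by
      linear_combination 2 * (T.v 0 ^ 4 - T.v 0 ^ 2 * T.v 1 ^ 2 + T.v 1 ^ 4) * h2 +
        (T.v 1 ^ 3 + T.v 0 ^ 3) * h3
    have h5 := congrArg (evalHom p) h4
    rw [map_mul, map_mul, map_pow, map_ofNat, map_zero] at h5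
    have h6 := (mul_eq_zero.1 h5).resolve_left (by norm_num : (4 : ℂ) ≠ 0)
    exact (mul_eq_zero.1 h6).resolve_left (pow_ne_zero _ (hv 1 (by omega)))
  · have hw2 : T.w (1 + 1) = coord V (.u ⟨1, by omega⟩) := T.w_succ ⟨1, by omega⟩
    rw [hw2, pd_coord] at h1
    have h2 := congrArg (fun g : Fun V => g.val p) h1
    simp only [reduceCtorEq, if_false] at h2
    have h3 : (T.v 0).val p ^ 2 * c₃ = 0 := by simpa using h2
    exact (mul_eq_zero.1 h3).resolve_left (pow_ne_zero _ (hv 0 (by omega)))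

variable (V ε h c₂ c₃) in
/-- The cut-off conditions that preserve integrability: both values are the same constant, or
the polynomial `r` is constant. -/
structure IsAdmissible (φ₁ φ₂ : Cutoff) (a b : Fun V) : Prop where
  isCutoff : IsCutoff V φ₁ φ₂ a b
  isBoundary_fst : IsBoundary ε h c₂ c₃ a
  isBoundary_snd : IsBoundary ε h c₂ c₃ b
  const : (∃ l : ℂ, a = C l ∧ b = C l) ∨ h = 0 ∧ c₂ = 0

variable {φ₁ φ₂ : Cutoff}

theorem hasCompleteIntegrals_of_isAdmissible {a b : Fun V}
    (hab : IsAdmissible V ε h c₂ c₃ φ₁ φ₂ a b)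
    (hV : (V : Set (Jet N)) ⊆ cutDom N chainDom φ₁ φ₂) (p : V)
    (hg : ∀ i : Fin (N + 1), ∀ p : V, (∀ e : Dir, p.1 (.du e i 0) -
      e.coeff ε * (h * p.1 (.u i) ^ 2 + c₂ * p.1 (.u i) + c₃) ≠ 0) ∧
        p.1 (.u i) - a.val p ≠ 0) (d : Dir) :
    HasCompleteIntegrals V
      (ofCutoff hab.isCutoff hV hab.isBoundary_fst hab.isBoundary_snd).rhs d := by
  obtain ⟨T, hT⟩ : ∃ T, T = ofCutoff hab.isCutoff hV hab.isBoundary_fst hab.isBoundary_snd :=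
    ⟨_, rfl⟩
  have ha : T.a = a := by rw [hT]; rfl
  have hb : T.b = b := by rw [hT]; rfl
  rw [← hT]
  have hπ : ∀ (e : Dir) (i : Fin (N + 1)), IsUnit (T.π e (i + 1)) := fun e i =>
    Fun.isUnit_of_val_ne_zero fun p => by
      rw [π_succ]
      exact (hg i p).1 e
  refine T.hasCompleteIntegrals d (fun k h1 h2 => ?_) (hπ d.other) ?_ ?_ ?_
  · obtain ⟨k, rfl⟩ : ∃ k', k = k' + 1 := ⟨k - 1, by omega⟩
    refine Fun.isUnit_of_val_ne_zero fun p => ?_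
    have := T.w_succ ⟨k, by omega⟩
    rw [show ((⟨k, by omega⟩ : Fin (N + 1)) : ℕ) = k from rfl] at this
    rw [this, T.w_zero, ha]
    exact (hg ⟨k, by omega⟩ p).2
  · rw [ha, hb]
    rcases hab.const with ⟨l, rfl, rfl⟩ | ⟨rfl, rfl⟩ <;> simp
  · intro X
    rw [ha, hb]
    rcases hab.const with ⟨l, rfl, rfl⟩ | ⟨rfl, rfl⟩ <;> simp
  · intro h0 e
    rcases hab.const with ⟨l, hl1, hl2⟩ | ⟨rfl, rfl⟩
    · rw [ha, hb, hl1, hl2]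
      simp
    · obtain rfl := T.coeff_eq_zero_of_autonomous p hπ h0
      rw [T.isBoundary_a.t, T.isBoundary_b.t]
      simp [quad]

/-- Up to sign, every difference of adjacent nodes has derivative one along some unknown, so none is
a zero divisor and all are nonzero on a common open set. -/
theorem interior_cutDom_nonempty
    (H : ∀ V : Opens (Jet N), ∃ a b : Fun V, IsAdmissible V ε h c₂ c₃ φ₁ φ₂ a b) :
    (interior (cutDom N chainDom φ₁ φ₂)).Nonempty := by
  obtain ⟨a, b, hab⟩ := H ⊤
  have hg : ∀ k ∈ Finset.range (N + 2),
      nodes a b (k + 1) - nodes a b k ∈ nonZeroDivisors (Fun (⊤ : Opens (Jet N))) := by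
    intro k hk
    rw [Finset.mem_range] at hk
    have hu : ∀ i k : Fin (N + 1), pd ⊤ (.u i) (nodes a b (k + 1)) = if k = i then 1 else 0 :=
      fun i k => by
        rw [show nodes a b (k + 1) = coord ⊤ (.u k) from dif_pos k.2, pd_coord]
        simp
    rcases Nat.lt_or_ge k (N + 1) with hk' | hk'
    · refine mem_nonZeroDivisors_of_pd (.u ⟨k, hk'⟩) _ ?_
      have h1 := hu ⟨k, hk'⟩ ⟨k, hk'⟩
      rw [map_sub, h1]
      rcases k with _ | k
      · rw [show nodes a b 0 = a from rfl, hab.isBoundary_fst.u]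
        simp
      · have h2 := hu ⟨k + 1, hk'⟩ ⟨k, by omega⟩
        rw [h2]
        simp
    · obtain rfl : k = N + 1 := by omega
      rw [← neg_sub, neg_eq_neg_one_mul]
      refine mul_mem isUnit_one.neg.mem_nonZeroDivisors ?_
      refine mem_nonZeroDivisors_of_pd (.u (Fin.last N)) _ ?_
      have h1 := hu (Fin.last N) (Fin.last N)
      rw [Fin.val_last] at h1
      rw [map_sub, h1, show nodes a b (N + 1 + 1) = b from dif_neg (lt_irrefl (N + 1)),
        hab.isBoundary_snd.u]
      simp
  obtain ⟨U, ⟨q, hq⟩, -, hU⟩ := exists_opens_val_ne_zero (V := ⊤) ⟨0, trivial⟩ _ _ hg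
  refine ⟨q, mem_interior.2 ⟨U, fun p hp i => ?_, U.isOpen, hq⟩⟩
  obtain ⟨e1, e2, e3⟩ := node_triple hab.isCutoff ⟨p, trivial⟩ i
  have hi := i.2
  have h1 := hU ⟨p, trivial⟩ hp i (Finset.mem_range.2 (by omega))
  have h2 := hU ⟨p, trivial⟩ hp (i + 1) (Finset.mem_range.2 (by omega))
  rw [Fun.val_sub, sub_ne_zero] at h1 h2
  dsimp only at e1 e2 e3
  rw [e1, e2, e3]
  exact ⟨h1, h2⟩

/-- Here generic means that all π_i^x, π_i^y and u_i - u_{-1} are nonzero. Each has derivative one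
along a coordinate, so this holds on a nonempty open part of any nonempty open set. -/
theorem darbouxIntegrable {c₁ : ℂ}
    (H : ∀ V : Opens (Jet N), ∃ a b : Fun V, IsAdmissible V ε (c₁ / 2) c₂ c₃ φ₁ φ₂ a b) :
    DarbouxIntegrable (cutDom N chainDom φ₁ φ₂) (cutRHS N (chain c₁ c₂ c₃ ε) φ₁ φ₂) := by
  refine ⟨interior_cutDom_nonempty H, fun V hne hV => ?_⟩
  obtain ⟨a, b, hab⟩ := H V
  let T := ofCutoff hab.isCutoff hV hab.isBoundary_fst hab.isBoundary_snd
  have hg : ∀ i ∈ (Finset.univ : Finset (Fin (N + 1))),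
      T.π .x (i + 1) * T.π .y (i + 1) * (coord V (.u i) - a) ∈ nonZeroDivisors (Fun V) := by
    intro i _
    refine mul_mem (mul_mem ?_ ?_) ?_
    · exact mem_nonZeroDivisors_of_pd (.du .x i 0) _ (by rw [T.pd_π]; simp)
    · exact mem_nonZeroDivisors_of_pd (.du .y i 0) _ (by rw [T.pd_π]; simp)
    · exact mem_nonZeroDivisors_of_pd (.u i) _ (by
        rw [map_sub, hab.isBoundary_fst.u, pd_coord]; simp)
  obtain ⟨U, ⟨q, hq⟩, hUV, hU⟩ := exists_opens_val_ne_zero hne _ _ hg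
  -- The ring over the smaller set is a different one, so the cut-off values are represented anew;
  -- both representations take the values prescribed by φ₁.
  obtain ⟨a', b', hab'⟩ := H U
  have hU' : (U : Set (Jet N)) ⊆ cutDom N chainDom φ₁ φ₂ := fun p hp => hV (hUV hp)
  refine ⟨U, ⟨q, hq⟩, hUV, _, represents hab'.isCutoff hU' hab'.isBoundary_fst hab'.isBoundary_snd,
    fun d => hasCompleteIntegrals_of_isAdmissible hab' hU' ⟨q, hq⟩ (fun i p => ?_) d⟩
  have h1 := hU ⟨p.1, hUV p.2⟩ p.2 i (Finset.mem_univ i)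
  rw [Fun.val_mul, Fun.val_mul] at h1
  obtain ⟨h2, h3⟩ := mul_ne_zero_iff.1 h1
  obtain ⟨h4, h5⟩ := mul_ne_zero_iff.1 h2
  rw [π_succ] at h4 h5
  refine ⟨fun e => ?_, ?_⟩
  · cases e
    · exact h4
    · exact h5
  · rw [Fun.val_sub, hab.isCutoff.fst] at h3
    rw [hab'.isCutoff.fst]
    exact h3

theorem isBoundary_algebraMap {l : ℂ} (hl : h * l ^ 2 + c₂ * l + c₃ = 0) :
    IsBoundary ε h c₂ c₃ (C l) where
  t e := by
    simp only [quad, ← map_pow, ← map_mul, ← map_add, hl, Derivation.map_algebraMap]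
    simp
  u i := Derivation.map_algebraMap _ _
  du e i k := Derivation.map_algebraMap _ _

theorem isAdmissible_root {c₁ l : ℂ} (hl : r c₁ c₂ c₃ l = 0) {φ : Cutoff}
    (hφ : φ = fun _ _ _ => l) : IsAdmissible V ε (c₁ / 2) c₂ c₃ φ φ (C l) (C l) where
  isCutoff := by subst hφ; exact ⟨fun _ => rfl, fun _ => rfl⟩
  isBoundary_fst := isBoundary_algebraMap hl
  isBoundary_snd := isBoundary_algebraMap hl
  const := .inl ⟨l, rfl, rfl⟩

variable (V ε c₃) in
/-- The function `c₃ (ε x + y) + c`. -/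
def linearCutoff (c : ℂ) : Fun V :=
  C c₃ * (C ε * coord V (.t .x) + coord V (.t .y)) + C c

theorem isBoundary_linearCutoff (c : ℂ) : IsBoundary ε 0 0 c₃ (linearCutoff V ε c₃ c) where
  t e := by
    simp only [linearCutoff, quad, map_add, Derivation.leibniz, Derivation.map_algebraMap, pd_coord]
    cases e <;> simp [Dir.coeff, mul_comm]
  u i := by
    simp only [linearCutoff, map_add, Derivation.leibniz, Derivation.map_algebraMap, pd_coord]
    simp
  du e i k := by
    simp only [linearCutoff, map_add, Derivation.leibniz, Derivation.map_algebraMap, pd_coord]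
    simp

theorem isAdmissible_linearCutoff {c₄ c₅ : ℂ} {φ₁ φ₂ : Cutoff}
    (h₁ : φ₁ = fun x y _ => c₃ * (ε * x + y) + c₄) (h₂ : φ₂ = fun x y _ => c₃ * (ε * x + y) + c₅) :
    IsAdmissible V ε (0 / 2) 0 c₃ φ₁ φ₂ (linearCutoff V ε c₃ c₄) (linearCutoff V ε c₃ c₅) := by
  rw [zero_div]
  subst h₁ h₂
  exact ⟨⟨fun _ => rfl, fun _ => rfl⟩, isBoundary_linearCutoff _, isBoundary_linearCutoff _,
    .inr ⟨rfl, rfl⟩⟩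

end Cut

theorem exists_root {c₁ c₂ c₃ : ℂ} (h : c₁ ≠ 0 ∨ c₂ ≠ 0) : ∃ l, r c₁ c₂ c₃ l = 0 := by
  by_cases h1 : c₁ = 0
  · have h2 : c₂ ≠ 0 := h.resolve_left fun h => h h1
    refine ⟨-c₃ / c₂, ?_⟩
    rw [r, h1]
    field_simp
    ring
  · obtain ⟨s, hs⟩ := IsAlgClosed.exists_pow_nat_eq (c₂ ^ 2 - 2 * c₁ * c₃) (n := 2) (by norm_num)
    refine ⟨(-c₂ + s) / c₁, ?_⟩
    rw [r]
    field_simp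
    linear_combination hs

/-- A root of r supplies constant cut-offs independent of N. If c₁ = c₂ = 0 there may be no root,
and the moving cut-off c₃(εx + y) is used at both ends. -/
theorem integrableChain (c₁ c₂ c₃ ε : ℂ) : IntegrableChain chainDom (chain c₁ c₂ c₃ ε) := by
  by_cases h : c₁ ≠ 0 ∨ c₂ ≠ 0
  · obtain ⟨l, hl⟩ := exists_root (c₃ := c₃) h
    exact ⟨fun _ _ _ => l, fun _ _ _ => l, fun _ _ _ N _ =>
      Cut.darbouxIntegrable fun V => ⟨_, _, Cut.isAdmissible_root hl rfl⟩⟩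
  · push Not at h
    obtain ⟨rfl, rfl⟩ := h
    exact ⟨fun x y _ => c₃ * (ε * x + y) + 0, fun x y _ => c₃ * (ε * x + y) + 0, fun _ _ _ N _ =>
      Cut.darbouxIntegrable fun V => ⟨_, _, Cut.isAdmissible_linearCutoff rfl rfl⟩⟩

end Chain

end

theorem theorem4 (c₁ c₂ c₃ ε : ℂ) :
    -- the chain is integrable
    Chain.IntegrableChain Chain.chainDom (Chain.chain c₁ c₂ c₃ ε) ∧
    -- cut-off by a root of `r`
    (∀ a : ℂ, Chain.r c₁ c₂ c₃ a = 0 → ∀ (N : ℕ) (φ : Chain.Cutoff), (φ = fun _ _ _ => a) →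
      Chain.DarbouxIntegrable (Chain.cutDom N Chain.chainDom φ φ)
        (Chain.cutRHS N (Chain.chain c₁ c₂ c₃ ε) φ φ) ∧
      ∀ V : TopologicalSpace.Opens (Chain.Jet N),
        (V : Set (Chain.Jet N)) ⊆ Chain.cutDom N Chain.chainDom φ φ →
        ∃ f : Fin (N + 1) → Chain.Fun V,
          Chain.Represents V (Chain.cutRHS N (Chain.chain c₁ c₂ c₃ ε) φ φ) f ∧
          ∀ d : Chain.Dir,
            Chain.HasExplicitBasis V f d ∧
            -- the autonomous version, with the field `Y` that has no `∂/∂y` or `∂/∂x` term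
            Submodule.span (Chain.Fun V)
              (Set.range (Chain.family V f d (Chain.charField V f d))) =
                Chain.charAlg V f d (Chain.charField V f d) ∧
            (Chain.r' c₁ c₂ a ≠ 0 → (d = Chain.Dir.x → ε ≠ 0) →
              LinearIndependent (Chain.Fun V) (Chain.family V f d (Chain.charField V f d)))) ∧
    -- cut-off when `r` is constant
    (c₁ = 0 → c₂ = 0 → ∀ (c₄ c₅ : ℂ) (N : ℕ) (φ₁ φ₂ : Chain.Cutoff),
      (φ₁ = fun x y _ => c₃ * (ε * x + y) + c₄) → (φ₂ = fun x y _ => c₃ * (ε * x + y) + c₅) →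
      Chain.DarbouxIntegrable (Chain.cutDom N Chain.chainDom φ₁ φ₂)
        (Chain.cutRHS N (Chain.chain c₁ c₂ c₃ ε) φ₁ φ₂) ∧
      ∀ V : TopologicalSpace.Opens (Chain.Jet N),
        (V : Set (Chain.Jet N)) ⊆ Chain.cutDom N Chain.chainDom φ₁ φ₂ →
        ∃ f : Fin (N + 1) → Chain.Fun V,
          Chain.Represents V (Chain.cutRHS N (Chain.chain c₁ c₂ c₃ ε) φ₁ φ₂) f ∧
          ∀ d : Chain.Dir, Chain.HasExplicitBasis V f d) := by
  refine ⟨Chain.integrableChain c₁ c₂ c₃ ε, fun l hl N φ hφ => ⟨?_, fun V hV => ?_⟩, ?_⟩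
  · exact Chain.Cut.darbouxIntegrable fun V => ⟨_, _, Chain.Cut.isAdmissible_root hl hφ⟩
  · have hab : Chain.Cut.IsAdmissible V ε (c₁ / 2) c₂ c₃ φ φ _ _ :=
      Chain.Cut.isAdmissible_root hl hφ
    have hq : Chain.quad (c₁ / 2) c₂ c₃ (algebraMap ℂ (Chain.Fun V) l) = 0 := by
      simp only [Chain.quad, ← map_pow, ← map_mul, ← map_add]
      exact (congrArg _ hl).trans (map_zero _)
    refine ⟨_, Chain.Cut.represents hab.isCutoff hV hab.isBoundary_fst hab.isBoundary_snd,
      fun d => ⟨Chain.Cut.hasExplicitBasis _ d, Chain.Cut.span_family_charField _ d hq hq,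
        fun hr hd => Chain.Cut.linearIndependent_family_charField _ d rfl rfl hl
          (mul_ne_zero ?_ ?_)⟩⟩
    · cases d
      · exact hd rfl
      · exact one_ne_zero
    · rw [Chain.r'] at hr
      convert hr using 2
      ring
  · rintro rfl rfl c₄ c₅ N φ₁ φ₂ h₁ h₂
    refine ⟨Chain.Cut.darbouxIntegrable fun V => ⟨_, _,
      Chain.Cut.isAdmissible_linearCutoff h₁ h₂⟩, fun V hV => ?_⟩
    have hab := Chain.Cut.isAdmissible_linearCutoff (V := V) h₁ h₂
    exact ⟨_, Chain.Cut.represents hab.isCutoff hV hab.isBoundary_fst hab.isBoundary_snd,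
      fun d => Chain.Cut.hasExplicitBasis _ d⟩
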